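/- **Setting.** For $p\in\mathbb N=\{1,2,\dots\}$, a coarsest number of intervals $n_0>p$ and levels $\ell=0,1,2,\dots$, let $n_\ell=n_02^\ell$ and $h_\ell=1/n_\ell$, and let $\varphi^{(1)},\dots,\varphi^{(m_\ell)}$, $m_\ell=n_\ell+p$, be the normalized B-splines of degree $p$ over the open knot vector $(0,\dots,0,h_\ell,2h_\ell,\dots,(n_\ell-1)h_\ell,1,\dots,1)$ on $(0,1)$, in which $0$ and $1$ occur $p+1$ times each. Let $S_{p,\ell}(0,1)$ be their span. In one dimension let $M_\ell=\big((\varphi^{(i)},\varphi^{(j)})_{L^2(0,1)}\big)_{ij}$ and $A_\ell=\big(((\varphi^{(i)})',(\varphi^{(j)})')_{L^2(0,1)}+(\varphi^{(i)},\varphi^{(j)})_{L^2(0,1)}\big)_{ij}$. Let $S^I_{p,\ell}(0,1)$ be the span of all $\varphi^{(j)}$ except the first $p$ and the last $p$, let $T^I_\ell:S_{p,\ell}(0,1)\to S^I_{p,\ell}(0,1)$ be the $A_\ell$-orthogonal projector, and set $$C_\ell=(I-T^I_\ell)^TA_\ell(I-T^I_\ell),\qquad L_\ell=h_\ell^{-2}M_\ell+C_\ell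 .$$ On $\Omega=(0,1)^2$ use the tensor-product basis $\varphi^{(i_1)}(x)\varphi^{(i_2)}(y)$ of $\mathcal S_{p,\ell}(\Omega)=S_{p,\ell}(0,1)\otimes S_{p,\ell}(0,1)$. Let $\mathcal A_\ell$ be the matrix of the bilinear form $(\nabla u,\nabla v)_{L^2(\Omega)}+(u,v)_{L^2(\Omega)}$ in this basis, let $\mathcal I_{\ell-1}^{\ell}$ be the matrix of the embedding $\mathcal S_{p,\ell-1}(\Omega)\subset\mathcal S_{p,\ell}(\Omega)$ and $\mathcal I_\ell^{\ell-1}=(\mathcal I_{\ell-1}^{\ell})^T$, and let $$\mathcal L_\ell=h_\ell^2\,(L_\ell\otimes L_\ell-C_\ell\otimes C_\ell).$$ For a system $\mathcal A_\ell u=f$, a smoothing step is $u\mapsto u+\tau\mathcal L_\ell^{-1}(f-\mathcal A_\ell u)$. A step of the *two-grid method* with $\nu$ smoothing steps ($\ell\ge1$) applies $\nu$ smoothing steps and then $u\mapsto u+\mathcal I_{\ell-1}^{\ell}\mathcal A_{\ell-1}^{-1}\mathcal I_\ell^{\ell-1}(f-\mathcal A_\ell u)$. A step of the *W-cycle* with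 $\nu/2$ pre- and $\nu/2$ post-smoothing steps ($\nu$ even) is an exact solve for $\ell=0$. For $\ell\ge1$ it applies $\nu/2$ smoothing steps, then $u\mapsto u+\mathcal I_{\ell-1}^{\ell}c$, where $c$ results from two W-cycle steps on level $\ell-1$, starting from $0$, for the system $\mathcal A_{\ell-1}c=\mathcal I_\ell^{\ell-1}(f-\mathcal A_\ell u)$, and then $\nu/2$ smoothing steps. For a symmetric positive definite matrix $Q$ let $\|v\|_Q=(Qv,v)^{1/2}$. A method *converges in $\|\cdot\|_Q$ with rate $q$* if $q<1$ and, for every right-hand side $f$ with exact solution $u^*$ and every $u$, one step of the method takes $u$ to some $u^{(1)}$ with $\|u^*-u^{(1)}\|_Q\le q\,\|u^*-u\|_Q$. **Theorem 5.4.** There are $\tau>0$ and $\nu_0>0$, independent of $\ell$ and $p$ (and of $n_0$), such that for all $p\ge1$ and $n_0>p$ the following holds. All $\mathcal A_\ell$ and $\mathcal L_\ell$, $\ell\ge0$, are symmetric positive definite, the spaces are nested, $\mathcal S_{p,\ell-1}(\Omega)\subset\mathcal S_{p,\ell}(\Omega)$ for $\ell\ge1$ (so that the methods are well defined), and: 1.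 for every $\ell\ge1$ and every integer $\nu>\nu_0$, the two-grid method on level $\ell$ with damping parameter $\tau$ and $\nu$ smoothing steps converges in $\|\cdot\|_{\mathcal L_\ell}$ with rate $q=\nu_0/\nu$; 2. for every $\ell\ge0$ and every even integer $\nu>4\nu_0$, the W-cycle on level $\ell$ with the same $\tau$ and with $\nu/2$ pre- and $\nu/2$ post-smoothing steps converges in the energy norm $\|\cdot\|_{\mathcal A_\ell}$ with rate $q=2\nu_0/\nu$. -/

import Mathlib

open MeasureTheory Set
open scoped Matrix Kronecker

noncomputable section

namespace SplineMultigrid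

/-! ### B-splines of maximal smoothness on `(0,1)` -/

/-- Open knot vector of degree `p` on the uniform grid with `n` intervals, indexed from `0`:
`0` for `i ≤ p` (where the truncated difference `i - p` vanishes), then `(i - p) / n`, and `1` for
`i ≥ n + p`. The basis functions below use the indices `0, …, n + 2 p`, so that `0` and `1` both
occur `p + 1` times. -/
def knot (p n i : ℕ) : ℝ := min (((i - p : ℕ) : ℝ) / (n : ℝ)) 1

open Classical in
/-- Cox-de Boor recursion for the normalized B-splines over the knots `t`
(with the usual convention `0 / 0 = 0`): `coxDeBoor t k i` has degree `k` and
support `[t i, t (i + k + 1)]`. -/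
def coxDeBoor (t : ℕ → ℝ) : ℕ → ℕ → ℝ → ℝ
  | 0, i, x => if t i ≤ x ∧ x < t (i + 1) then 1 else 0
  | k + 1, i, x =>
      (x - t i) / (t (i + k + 1) - t i) * coxDeBoor t k i x
        + (t (i + k + 2) - x) / (t (i + k + 2) - t (i + 1)) * coxDeBoor t k (i + 1) x

/-- The B-spline basis functions of degree `p` on the uniform grid of `(0,1)` with `n` intervals;
there are `n + p` of them. -/
def bspline (p n : ℕ) (i : Fin (n + p)) : ℝ → ℝ := coxDeBoor (knot p n) p i

/-! ### One-dimensional matrices -/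

/-- The mass matrix `M`, i.e. the Gram matrix of the `L²(0,1)` scalar product. -/
def massMatrix (p n : ℕ) : Matrix (Fin (n + p)) (Fin (n + p)) ℝ :=
  Matrix.of fun i j => ∫ x in Ioo (0 : ℝ) 1, bspline p n i x * bspline p n j x

/-- The stiffness matrix `A`, i.e. the Gram matrix of `(u', v') + (u, v)`, the scalar product of
`H¹(0,1)`. -/
def stiffnessMatrix (p n : ℕ) : Matrix (Fin (n + p)) (Fin (n + p)) ℝ :=
  Matrix.of fun i j => ∫ x in Ioo (0 : ℝ) 1,
    (deriv (bspline p n i) x * deriv (bspline p n j) x + bspline p n i x * bspline p n j x)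

/-- The inner indices: all but the first `p` and the last `p` of the `n + p` indices. -/
abbrev InnerIdx (p n : ℕ) : Type := {i : Fin (n + p) // p ≤ (i : ℕ) ∧ (i : ℕ) < n}

/-- Coefficient matrix of the inclusion into the spline space of the subspace that is spanned by
the inner B-splines. -/
def innerInclusion (p n : ℕ) : Matrix (Fin (n + p)) (InnerIdx p n) ℝ :=
  Matrix.of fun i j => if i = j.1 then 1 else 0

/-- The `A`-orthogonal projector onto the column space of `E`, for symmetric positive definite `A`
and `E` with linearly independent columns. -/
def orthProjector {ι κ : Type*} [Fintype ι] [Fintype κ] [DecidableEq κ]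
    (A : Matrix ι ι ℝ) (E : Matrix ι κ ℝ) : Matrix ι ι ℝ :=
  E * (Eᵀ * A * E)⁻¹ * Eᵀ * A

/-- The `A`-orthogonal projector `T^I` from the spline space onto the span of the inner
B-splines. -/
def innerProjector (p n : ℕ) : Matrix (Fin (n + p)) (Fin (n + p)) ℝ :=
  orthProjector (stiffnessMatrix p n) (innerInclusion p n)

/-- The boundary correction `C = (I - T^I)ᵀ A (I - T^I)`. -/
def boundaryCorrection (p n : ℕ) : Matrix (Fin (n + p)) (Fin (n + p)) ℝ :=
  (1 - innerProjector p n)ᵀ * stiffnessMatrix p n * (1 - innerProjector p n)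

/-- The one-dimensional smoother matrix `L = h⁻² M + C`, where `h = 1 / n`. -/
def smootherMatrix (p n : ℕ) : Matrix (Fin (n + p)) (Fin (n + p)) ℝ :=
  ((1 / (n : ℝ)) ^ 2)⁻¹ • massMatrix p n + boundaryCorrection p n

/-! ### Two-dimensional matrices -/

/-- The domain `Ω = (0,1)²`. -/
def unitSquare : Set (ℝ × ℝ) := Ioo (0 : ℝ) 1 ×ˢ Ioo (0 : ℝ) 1

/-- The partial derivative in the first variable. -/
def partialX (u : ℝ × ℝ → ℝ) (z : ℝ × ℝ) : ℝ := deriv (fun s => u (s, z.2)) z.1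

/-- The partial derivative in the second variable. -/
def partialY (u : ℝ × ℝ → ℝ) (z : ℝ × ℝ) : ℝ := deriv (fun s => u (z.1, s)) z.2

/-- The bilinear form `(∇u, ∇v) + (u, v)` over the unit square. -/
def energyForm (u v : ℝ × ℝ → ℝ) : ℝ :=
  ∫ z in unitSquare, (partialX u z * partialX v z + partialY u z * partialY v z + u z * v z)

/-- Index set of the tensor-product basis for `n` intervals in each direction. -/
abbrev Idx (p n : ℕ) : Type := Fin (n + p) × Fin (n + p)

/-- The tensor-product B-spline basis. -/
def tensorBspline (p n : ℕ) (i : Idx p n) (z : ℝ × ℝ) : ℝ :=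
  bspline p n i.1 z.1 * bspline p n i.2 z.2

/-- The two-dimensional stiffness matrix. -/
def stiffnessMatrix₂ (p n : ℕ) : Matrix (Idx p n) (Idx p n) ℝ :=
  Matrix.of fun i j => energyForm (tensorBspline p n i) (tensorBspline p n j)

/-- The two-dimensional smoother matrix `h² (L ⊗ L - C ⊗ C)`, where `h = 1 / n`. -/
def smootherMatrix₂ (p n : ℕ) : Matrix (Idx p n) (Idx p n) ℝ :=
  (1 / (n : ℝ)) ^ 2 • (smootherMatrix p n ⊗ₖ smootherMatrix p n
    - boundaryCorrection p n ⊗ₖ boundaryCorrection p n)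

/-- `P` is the matrix, with respect to the tensor-product B-splines, of the embedding of the
spline space with `n` intervals per direction into the one with `n'`. -/
def IsEmbeddingMatrix (p n n' : ℕ) (P : Matrix (Idx p n') (Idx p n) ℝ) : Prop :=
  ∀ j, ∀ z ∈ unitSquare, tensorBspline p n j z = ∑ i, P i j * tensorBspline p n' i z

/-- The prolongation matrix: the matrix of the canonical embedding. (It exists for nested spaces,
and is unique as the B-splines are linearly independent on the unit square.) -/
def prolongation (p n n' : ℕ) : Matrix (Idx p n') (Idx p n) ℝ :=
  Classical.epsilon (IsEmbeddingMatrix p n n')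

/-! ### The multigrid method -/

/-- The number `n_ℓ = n₀ 2^ℓ` of intervals on level `ℓ`. -/
def gridCount (n₀ ℓ : ℕ) : ℕ := n₀ * 2 ^ ℓ

/-- The coefficient vectors on level `ℓ`. -/
abbrev Vec (p n₀ ℓ : ℕ) : Type := Idx p (gridCount n₀ ℓ) → ℝ

/-- The stiffness matrix on level `ℓ`. -/
def levelA (p n₀ ℓ : ℕ) : Matrix (Idx p (gridCount n₀ ℓ)) (Idx p (gridCount n₀ ℓ)) ℝ :=
  stiffnessMatrix₂ p (gridCount n₀ ℓ)

/-- The smoother matrix on level `ℓ`. -/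
def levelL (p n₀ ℓ : ℕ) : Matrix (Idx p (gridCount n₀ ℓ)) (Idx p (gridCount n₀ ℓ)) ℝ :=
  smootherMatrix₂ p (gridCount n₀ ℓ)

/-- The prolongation from level `ℓ` to level `ℓ + 1`; the restriction is its transpose. -/
def levelP (p n₀ ℓ : ℕ) : Matrix (Idx p (gridCount n₀ (ℓ + 1))) (Idx p (gridCount n₀ ℓ)) ℝ :=
  prolongation p (gridCount n₀ ℓ) (gridCount n₀ (ℓ + 1))

/-- `k` smoothing steps `u ↦ u + τ L⁻¹ (f - A u)` on level `ℓ`. -/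
def smooth (p n₀ : ℕ) (τ : ℝ) (ℓ k : ℕ) (f u : Vec p n₀ ℓ) : Vec p n₀ ℓ :=
  (fun v => v + τ • ((levelL p n₀ ℓ)⁻¹ *ᵥ (f - levelA p n₀ ℓ *ᵥ v)))^[k] u

/-- The defect of `u` on level `ℓ + 1`, restricted to level `ℓ`. -/
def restrictedDefect (p n₀ ℓ : ℕ) (f u : Vec p n₀ (ℓ + 1)) : Vec p n₀ ℓ :=
  (levelP p n₀ ℓ)ᵀ *ᵥ (f - levelA p n₀ (ℓ + 1) *ᵥ u)

/-- One step of the two-grid method on level `ℓ + 1` for the system `A u = f`: `ν` smoothing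
steps, followed by the coarse-grid correction with an exact solve on level `ℓ`. -/
def twoGridStep (p n₀ : ℕ) (τ : ℝ) (ν ℓ : ℕ) (f u : Vec p n₀ (ℓ + 1)) : Vec p n₀ (ℓ + 1) :=
  let v := smooth p n₀ τ (ℓ + 1) ν f u
  v + levelP p n₀ ℓ *ᵥ ((levelA p n₀ ℓ)⁻¹ *ᵥ restrictedDefect p n₀ ℓ f v)

/-- One step of the W-cycle with `k` pre-smoothing and `k` post-smoothing steps for `A u = f`: an
exact solve on level `0`; on the higher levels, the coarse-grid problem is solved approximately by
two steps of the method on the next coarser level, starting from `0`. -/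
def wCycleStep (p n₀ : ℕ) (τ : ℝ) (k : ℕ) :
    (ℓ : ℕ) → Vec p n₀ ℓ → Vec p n₀ ℓ → Vec p n₀ ℓ
  | 0, f, _ => (levelA p n₀ 0)⁻¹ *ᵥ f
  | ℓ + 1, f, u =>
      let v := smooth p n₀ τ (ℓ + 1) k f u
      let r := restrictedDefect p n₀ ℓ f v
      let c := wCycleStep p n₀ τ k ℓ r (wCycleStep p n₀ τ k ℓ r 0)
      smooth p n₀ τ (ℓ + 1) k f (v + levelP p n₀ ℓ *ᵥ c)

/-- The norm `‖v‖_Q = (Q v, v)^{1/2}`. -/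
def matrixNorm {ι : Type*} [Fintype ι] (Q : Matrix ι ι ℝ) (v : ι → ℝ) : ℝ :=
  Real.sqrt ((Q *ᵥ v) ⬝ᵥ v)

/-- The iteration with step function `step f` for the systems `A u = f` converges in the norm
`‖·‖_Q` with rate `q`: we have `q < 1`, and, whatever the right-hand side, each step reduces the
error at least by the factor `q`. -/
def ConvergesWithRate {ι : Type*} [Fintype ι] (A Q : Matrix ι ι ℝ)
    (step : (ι → ℝ) → (ι → ℝ) → ι → ℝ) (q : ℝ) : Prop :=
  q < 1 ∧ ∀ f uStar u : ι → ℝ, A *ᵥ uStar = f →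
    matrixNorm Q (uStar - step f u) ≤ q * matrixNorm Q (uStar - u)

end SplineMultigrid

end

/-! The proof splits the convergence into a smoothing and an approximation property, both with
constants independent of degree and grid: 𝓐 ≤ 106 𝓛 everywhere (`stiffnessMatrix₂_le`), and 𝓛 ≤ 194
𝓐 on the 𝓐-orthogonal complement of the coarse space (`prolongation_properties`). With τ = 1/106 the
two-grid rate is then 194 · 106 / ν, whence ν₀ = 20564.

Independence of `p` comes from splines with symmetric boundary conditions: "odd" splines have
vanishing odd derivatives at 0 and 1, "even" ones vanishing even derivatives. Differentiation
exchanges the two families, and the boundary terms of integration by parts vanish. Hence ‖u'‖² =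
-(u, u''), so by Cauchy-Schwarz ‖u'‖/‖u‖ ≤ ‖u''‖/‖u'‖: an inverse inequality for u' passes to u with
the same constant. Inductively the constant is that of step functions (`inverse_inequality_aux`).
The approximation estimate is proved in dual form by the same mechanism: if r is orthogonal to one
family, its primitive is orthogonal to the other family one degree lower (`dual_approximation`). An
Aubin-Nitsche argument then bounds the L² norm of functions that are H¹-orthogonal to the odd
splines (`aubin_nitsche`).

The inverse inequality fails to be robust on the full spline space, and the correction C repairs
this. Inner B-splines are odd splines (`single_mem_symSplines`), so the H¹ distance of x to the odd
splines is at most its distance to the inner ones, whose square is the quadratic form of C at x.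
Splitting x into its projection onto the odd splines and the rest gives A ≤ 53 (n²M + C)
(`stiffnessMatrix_le`).

In two dimensions C ⊗ C cancels in 𝓛, leaving C ⊗ M + M ⊗ C + n² M ⊗ M, so the smoothing property
follows factor by factor. The approximation property follows from C ≤ A and an L² estimate on the
tensor grid (`tensor_approximation`). The latter is a discrete duality argument: expanding 𝓐 (M⁻¹ ⊗
M⁻¹) 𝓐 gives nonnegative terms only, including the mixed one A ⊗ K with K the matrix of (u', v'),
and this replaces H² regularity.

The rest is linear algebra. Telescoping sums of monotone sequences give the smoothing estimates.
They yield `two_grid_estimate`, its symmetric version in the energy norm, and the W-cycle recursion,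
where the rate q satisfies q ≥ γ + q² with γ the symmetric two-grid bound. -/

noncomputable section

namespace SplineMultigrid

/-! ### The scalar product of `L²(0,1)` and primitives -/

/-- Square integrability on `(0,1)`. -/
def MemL2 (f : ℝ → ℝ) : Prop := MemLp f 2 (volume.restrict (Ioc (0 : ℝ) 1))

/-- The scalar product of `L²(0,1)`. -/
def ip (f g : ℝ → ℝ) : ℝ := ∫ x in (0 : ℝ)..1, f x * g x

/-- The primitive vanishing at `0`. -/
def prim (f : ℝ → ℝ) (x : ℝ) : ℝ := ∫ t in (0 : ℝ)..x, f t

theorem sq_integral_mul_le {α : Type*} [MeasurableSpace α] {μ : Measure α} {f g : α → ℝ}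
    (hf : MemLp f 2 μ) (hg : MemLp g 2 μ) :
    (∫ x, f x * g x ∂μ) ^ 2 ≤ (∫ x, f x * f x ∂μ) * ∫ x, g x * g x ∂μ := by
  have hfg : Integrable (fun x => f x * g x) μ := hf.integrable_mul hg
  have hff : Integrable (fun x => f x * f x) μ := hf.integrable_mul hf
  have hgg : Integrable (fun x => g x * g x) μ := hg.integrable_mul hg
  have key : ∀ t : ℝ, 0 ≤ (∫ x, g x * g x ∂μ) * (t * t) + (2 * ∫ x, f x * g x ∂μ) * t
      + ∫ x, f x * f x ∂μ := by
    intro t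
    have h0 : 0 ≤ ∫ x, (f x + t * g x) * (f x + t * g x) ∂μ :=
      integral_nonneg fun x => mul_self_nonneg _
    have h1 : ∫ x, (f x + t * g x) * (f x + t * g x) ∂μ
        = ∫ x, (f x * f x + (2 * t) * (f x * g x) + (t * t) * (g x * g x)) ∂μ := by
      congr 1; ext x; ring
    have h2 : Integrable (fun x => f x * f x + (2 * t) * (f x * g x)) μ :=
      hff.add (hfg.const_mul _)
    rw [h1, integral_add h2 (hgg.const_mul _),
      integral_add hff (hfg.const_mul _), integral_const_mul, integral_const_mul] at h0
    linarith
  have := discrim_le_zero key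
  rw [discrim] at this
  nlinarith

theorem MemL2.add {f g : ℝ → ℝ} (hf : MemL2 f) (hg : MemL2 g) : MemL2 (f + g) := MemLp.add hf hg

theorem MemL2.sub {f g : ℝ → ℝ} (hf : MemL2 f) (hg : MemL2 g) : MemL2 (f - g) := MemLp.sub hf hg

theorem memL2_const (c : ℝ) : MemL2 (fun _ => c) := memLp_const c

theorem MemL2.integrableOn {f : ℝ → ℝ} (hf : MemL2 f) : IntegrableOn f (Ioc 0 1) :=
  hf.integrable one_le_two

theorem MemL2.intervalIntegrable {f : ℝ → ℝ} (hf : MemL2 f) : IntervalIntegrable f volume 0 1 :=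
  (intervalIntegrable_iff_integrableOn_Ioc_of_le zero_le_one).2 hf.integrableOn

theorem MemL2.intervalIntegrable' {f : ℝ → ℝ} (hf : MemL2 f) {a b : ℝ} (ha : a ∈ Icc (0 : ℝ) 1)
    (hb : b ∈ Icc (0 : ℝ) 1) : IntervalIntegrable f volume a b :=
  hf.intervalIntegrable.mono_set (by
    rw [uIcc_of_le zero_le_one]; exact uIcc_subset_Icc ha hb)

theorem MemL2.mul {f g : ℝ → ℝ} (hf : MemL2 f) (hg : MemL2 g) :
    IntervalIntegrable (fun x => f x * g x) volume 0 1 :=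
  (intervalIntegrable_iff_integrableOn_Ioc_of_le zero_le_one).2 (MemLp.integrable_mul hf hg)

theorem ContinuousOn.memL2 {f : ℝ → ℝ} (hf : ContinuousOn f (Icc 0 1)) : MemL2 f := by
  obtain ⟨C, hC⟩ := isCompact_Icc.exists_bound_of_continuousOn hf
  refine MemLp.of_bound ((hf.mono Ioc_subset_Icc_self).aestronglyMeasurable measurableSet_Ioc) C ?_
  filter_upwards [ae_restrict_mem measurableSet_Ioc] with x hx
  exact hC x (Ioc_subset_Icc_self hx)

theorem ip_comm (f g : ℝ → ℝ) : ip f g = ip g f := by simp only [ip, mul_comm]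

theorem ip_add_left {f g k : ℝ → ℝ} (hf : MemL2 f) (hg : MemL2 g) (hk : MemL2 k) :
    ip (f + g) k = ip f k + ip g k := by
  simp only [ip, Pi.add_apply, add_mul]
  exact intervalIntegral.integral_add (hf.mul hk) (hg.mul hk)

theorem ip_sub_left {f g k : ℝ → ℝ} (hf : MemL2 f) (hg : MemL2 g) (hk : MemL2 k) :
    ip (f - g) k = ip f k - ip g k := by
  simp only [ip, Pi.sub_apply, sub_mul]
  exact intervalIntegral.integral_sub (hf.mul hk) (hg.mul hk)

theorem ip_add_right {f g k : ℝ → ℝ} (hf : MemL2 f) (hg : MemL2 g) (hk : MemL2 k) :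
    ip k (f + g) = ip k f + ip k g := by
  rw [ip_comm, ip_add_left hf hg hk, ip_comm f, ip_comm g]

theorem ip_sub_right {f g k : ℝ → ℝ} (hf : MemL2 f) (hg : MemL2 g) (hk : MemL2 k) :
    ip k (f - g) = ip k f - ip k g := by
  rw [ip_comm, ip_sub_left hf hg hk, ip_comm f, ip_comm g]

theorem ip_self_nonneg (f : ℝ → ℝ) : 0 ≤ ip f f :=
  intervalIntegral.integral_nonneg zero_le_one fun _ _ => mul_self_nonneg _

theorem ip_const_left (c : ℝ) (f : ℝ → ℝ) : ip (fun _ => c) f = c * prim f 1 := by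
  simp [ip, prim]

theorem ip_const_right (c : ℝ) (f : ℝ → ℝ) : ip f (fun _ => c) = c * prim f 1 := by
  rw [ip_comm, ip_const_left]

theorem ip_sq_le {f g : ℝ → ℝ} (hf : MemL2 f) (hg : MemL2 g) :
    ip f g ^ 2 ≤ ip f f * ip g g := by
  simp only [ip, intervalIntegral.integral_of_le zero_le_one]
  exact sq_integral_mul_le hf hg

theorem ip_congr_ae {f f' g g' : ℝ → ℝ} (h : ∀ᵐ x, x ∈ Ioo (0 : ℝ) 1 → f x = f' x)
    (h' : ∀ᵐ x, x ∈ Ioo (0 : ℝ) 1 → g x = g' x) : ip f g = ip f' g' := by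
  simp only [ip, intervalIntegral.integral_of_le zero_le_one, integral_Ioc_eq_integral_Ioo]
  refine setIntegral_congr_ae measurableSet_Ioo ?_
  filter_upwards [h, h'] with x h1 h2 hx
  rw [h1 hx, h2 hx]

@[simp] theorem prim_zero (f : ℝ → ℝ) : prim f 0 = 0 := by simp [prim]

theorem prim_sub_prim {f : ℝ → ℝ} (hf : MemL2 f) {a b : ℝ} (ha : a ∈ Icc (0 : ℝ) 1)
    (hb : b ∈ Icc (0 : ℝ) 1) : prim f b - prim f a = ∫ t in a..b, f t :=
  intervalIntegral.integral_interval_sub_left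
    (hf.intervalIntegrable' (by simp) hb) (hf.intervalIntegrable' (by simp) ha)

theorem absolutelyContinuous_prim {f : ℝ → ℝ} (hf : MemL2 f) :
    AbsolutelyContinuousOnInterval (prim f) 0 1 :=
  hf.intervalIntegrable.absolutelyContinuousOnInterval_intervalIntegral (by simp)

theorem continuousOn_prim {f : ℝ → ℝ} (hf : MemL2 f) : ContinuousOn (prim f) (Icc 0 1) := by
  simpa using (absolutelyContinuous_prim hf).continuousOn

theorem MemL2.prim {f : ℝ → ℝ} (hf : MemL2 f) : MemL2 (prim f) :=
  ContinuousOn.memL2 (continuousOn_prim hf)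

theorem ae_hasDerivAt_prim {f : ℝ → ℝ} (hf : MemL2 f) :
    ∀ᵐ x, x ∈ Icc (0 : ℝ) 1 → HasDerivAt (SplineMultigrid.prim f) (f x) x := by
  filter_upwards [hf.intervalIntegrable.ae_hasDerivAt_integral] with x hx h
  rw [uIcc_of_le zero_le_one] at hx
  exact hx h 0 (by simp)

/-- Integration by parts. -/
theorem ip_prim {f g : ℝ → ℝ} (hf : MemL2 f) (hg : MemL2 g) :
    ip (prim f) g = prim f 1 * prim g 1 - ip f (prim g) := by
  have h := (absolutelyContinuous_prim hf).integral_mul_deriv_eq_deriv_mul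
    (absolutelyContinuous_prim hg)
  have h1 : ∫ x in (0:ℝ)..1, prim f x * deriv (prim g) x = ip (prim f) g := by
    refine ip_congr_ae (by simp) ?_
    filter_upwards [ae_hasDerivAt_prim hg] with x hx h
    exact (hx (Ioo_subset_Icc_self h)).deriv
  have h2 : ∫ x in (0:ℝ)..1, deriv (prim f) x * prim g x = ip f (prim g) := by
    refine ip_congr_ae ?_ (by simp)
    filter_upwards [ae_hasDerivAt_prim hf] with x hx h
    exact (hx (Ioo_subset_Icc_self h)).deriv
  rw [h1, h2] at h
  simpa using h

theorem prim_add {f g : ℝ → ℝ} (hf : MemL2 f) (hg : MemL2 g) {x : ℝ} (hx : x ∈ Icc (0 : ℝ) 1) :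
    prim (f + g) x = prim f x + prim g x :=
  intervalIntegral.integral_add (hf.intervalIntegrable' (by simp) hx)
    (hg.intervalIntegrable' (by simp) hx)

theorem prim_sub {f g : ℝ → ℝ} (hf : MemL2 f) (hg : MemL2 g) {x : ℝ} (hx : x ∈ Icc (0 : ℝ) 1) :
    prim (f - g) x = prim f x - prim g x :=
  intervalIntegral.integral_sub (hf.intervalIntegrable' (by simp) hx)
    (hg.intervalIntegrable' (by simp) hx)

theorem prim_const_one (c : ℝ) : prim (fun _ => c) 1 = c := by simp [prim]

theorem integral_eq_sum_cells {F : ℝ → ℝ} (hF : IntervalIntegrable F volume 0 1) {n : ℕ}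
    (hn : 0 < n) : ∫ x in (0 : ℝ)..1, F x
      = ∑ i ∈ Finset.range n, ∫ x in ((i : ℝ) / n)..((i + 1 : ℕ) / n : ℝ), F x := by
  have hn' : (0 : ℝ) < n := by exact_mod_cast hn
  rw [intervalIntegral.sum_integral_adjacent_intervals (a := fun i : ℕ => (i : ℝ) / n)]
  · simp [hn'.ne']
  · intro k hk
    refine hF.mono_set ?_
    rw [uIcc_of_le zero_le_one]
    have h1 : (k : ℝ) + 1 ≤ n := by exact_mod_cast hk
    refine uIcc_subset_Icc ⟨by positivity, ?_⟩ ⟨by positivity, ?_⟩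
    · rw [div_le_one hn']; linarith
    · rw [div_le_one hn']; push_cast; linarith

theorem sq_integral_le {f : ℝ → ℝ} (hf : MemL2 f) {a b : ℝ} (ha : 0 ≤ a) (hab : a ≤ b)
    (hb : b ≤ 1) : (∫ x in a..b, f x) ^ 2 ≤ (b - a) * ∫ x in a..b, f x * f x := by
  rw [intervalIntegral.integral_of_le hab, intervalIntegral.integral_of_le hab]
  have hf' : MemLp f 2 (volume.restrict (Ioc a b)) :=
    hf.mono_measure (Measure.restrict_mono (Ioc_subset_Ioc ha hb) le_rfl)
  have := sq_integral_mul_le hf' (memLp_const (1 : ℝ))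
  simp only [mul_one] at this
  rw [mul_comm]
  simpa [hab] using this

/-- Poincaré-Friedrichs inequality. -/
theorem ip_prim_self_le {f : ℝ → ℝ} (hf : MemL2 f) : ip (prim f) (prim f) ≤ ip f f := by
  have h : ∀ x ∈ Icc (0 : ℝ) 1, prim f x * prim f x ≤ ip f f := by
    intro x hx
    have h1 := sq_integral_le hf le_rfl hx.1 hx.2
    have h2 : ∫ t in (0 : ℝ)..x, f t * f t ≤ ip f f :=
      intervalIntegral.integral_mono_interval le_rfl hx.1 hx.2
        (Filter.Eventually.of_forall fun t => mul_self_nonneg _) (hf.mul hf)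
    have h3 : 0 ≤ ∫ t in (0 : ℝ)..x, f t * f t :=
      intervalIntegral.integral_nonneg hx.1 fun t _ => mul_self_nonneg _
    have : prim f x = ∫ t in (0 : ℝ)..x, f t := rfl
    rw [← this] at h1
    nlinarith [hx.2]
  have := intervalIntegral.integral_mono_on zero_le_one (hf.prim.mul hf.prim)
    (intervalIntegrable_const (c := ip f f)) h
  simpa [ip] using this

/-! ### Splines in B-spline coefficients -/

/-- The reciprocal of the integral of the `j`-th B-spline of degree `p`. -/
def wt (p n j : ℕ) : ℝ := (p + 1) / (knot p n (j + p + 1) - knot p n j)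

theorem knot_strict {p n j : ℕ} (hn : 0 < n) (hj : j < n + p) :
    knot p n j < knot p n (j + p + 1) := by
  have hn' : (0 : ℝ) < n := by exact_mod_cast hn
  have h1 : ((j - p : ℕ) : ℝ) / n < 1 := by
    rw [div_lt_one hn']; exact_mod_cast (by omega : j - p < n)
  have h2 : ((j - p : ℕ) : ℝ) / n < ((j + p + 1 - p : ℕ) : ℝ) / n := by
    apply div_lt_div_of_pos_right _ hn'
    exact_mod_cast (by omega : j - p < j + p + 1 - p)
  exact lt_min (lt_of_le_of_lt (min_le_left _ _) h2) (lt_of_le_of_lt (min_le_left _ _) h1)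

theorem wt_pos {p n j : ℕ} (hn : 0 < n) (hj : j < n + p) : 0 < wt p n j :=
  div_pos (by positivity) (sub_pos.2 (knot_strict hn hj))

/-- The step function with the given values on the `n` cells of the uniform grid. -/
def stepFn (n : ℕ) (c : Fin n → ℝ) (x : ℝ) : ℝ :=
  ∑ i : Fin n, (Ico ((i : ℝ) / n) (((i : ℕ) + 1 : ℕ) / n)).indicator (fun _ => c i) x

/-- B-spline coefficients of the derivative. -/
def dcoef (p n : ℕ) : (Fin (n + (p + 1)) → ℝ) →ₗ[ℝ] (Fin (n + p) → ℝ) where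
  toFun c j := wt p n j * (c (Fin.succ j) - c (Fin.castSucc j))
  map_add' c d := by ext j; simp only [Pi.add_apply]; ring
  map_smul' a c := by ext j; simp only [Pi.smul_apply, smul_eq_mul, RingHom.id_apply]; ring

/-- The spline of degree `p` with the given B-spline coefficients, built by repeated
integration from a step function. -/
def pf (n : ℕ) : (p : ℕ) → (Fin (n + p) → ℝ) → ℝ → ℝ
  | 0, c => stepFn n c
  | p + 1, c => (fun _ => c (0 : Fin (n + p + 1))) + prim (pf n p (dcoef p n c))

theorem cell_disjoint {n i j : ℕ} {x : ℝ} (hi : x ∈ Ico ((i : ℝ) / n) ((i + 1 : ℕ) / n))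
    (hj : x ∈ Ico ((j : ℝ) / n) ((j + 1 : ℕ) / n)) : i = j := by
  have hn : (0 : ℝ) < n := by
    rcases Nat.eq_zero_or_pos n with rfl | h
    · simp at hi
    · exact_mod_cast h
  have h1 := lt_of_le_of_lt hi.1 hj.2
  have h2 := lt_of_le_of_lt hj.1 hi.2
  rw [div_lt_div_iff_of_pos_right hn] at h1 h2
  norm_cast at h1 h2
  omega

theorem stepFn_eq {n : ℕ} (c : Fin n → ℝ) (i : Fin n) {x : ℝ}
    (hx : x ∈ Ico ((i : ℝ) / n) (((i : ℕ) + 1 : ℕ) / n)) : stepFn n c x = c i := by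
  rw [stepFn, Finset.sum_eq_single i]
  · rw [indicator_of_mem hx]
  · intro j _ hj
    refine indicator_of_notMem (fun h => hj ?_) _
    exact Fin.ext (cell_disjoint h hx)
  · simp

theorem exists_cell {n : ℕ} (hn : 0 < n) {x : ℝ} (hx : x ∈ Ico (0 : ℝ) 1) :
    ∃ i : Fin n, x ∈ Ico ((i : ℝ) / n) (((i : ℕ) + 1 : ℕ) / n) := by
  have hn' : (0 : ℝ) < n := by exact_mod_cast hn
  have h0 : 0 ≤ x * n := mul_nonneg hx.1 hn'.le
  refine ⟨⟨⌊x * n⌋₊, ?_⟩, ?_, ?_⟩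
  · rw [Nat.floor_lt h0]; nlinarith [hx.2]
  · rw [div_le_iff₀ hn']; exact Nat.floor_le h0
  · rw [lt_div_iff₀ hn']; push_cast; exact Nat.lt_floor_add_one _

theorem memL2_stepFn (n : ℕ) (c : Fin n → ℝ) : MemL2 (stepFn n c) := by
  have : stepFn n c = ∑ i : Fin n,
      (Ico ((i : ℝ) / n) (((i : ℕ) + 1 : ℕ) / n)).indicator (fun _ => c i) := by
    ext x; simp [stepFn]
  rw [this]
  exact memLp_finsetSum' _ fun i _ => (memL2_const (c i)).indicator measurableSet_Ico

theorem memL2_pf (n p : ℕ) (c : Fin (n + p) → ℝ) : MemL2 (pf n p c) := by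
  induction p with
  | zero => exact memL2_stepFn n c
  | succ p ih => exact (memL2_const _).add (ih _).prim

theorem pf_add {n p : ℕ} (c d : Fin (n + p) → ℝ) {x : ℝ} (hx : x ∈ Icc (0 : ℝ) 1) :
    pf n p (c + d) x = pf n p c x + pf n p d x := by
  induction p generalizing x with
  | zero =>
    simp only [pf, stepFn, ← Finset.sum_add_distrib]
    refine Finset.sum_congr rfl fun i _ => ?_
    by_cases h : x ∈ Ico ((i : ℝ) / n) (((i : ℕ) + 1 : ℕ) / n)
    · simp only [indicator_of_mem h]; rfl
    · simp only [indicator_of_notMem h, add_zero]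
  | succ p ih =>
    simp only [pf, Pi.add_apply, map_add]
    have : prim (pf n p (dcoef p n c + dcoef p n d)) x
        = prim (pf n p (dcoef p n c) + pf n p (dcoef p n d)) x := by
      refine intervalIntegral.integral_congr fun t ht => ?_
      rw [uIcc_of_le hx.1] at ht
      exact ih _ _ ⟨ht.1, ht.2.trans hx.2⟩
    rw [this, prim_add (memL2_pf _ _ _) (memL2_pf _ _ _) hx]
    ring

theorem pf_smul {n p : ℕ} (a : ℝ) (c : Fin (n + p) → ℝ) : pf n p (a • c) = a • pf n p c := by
  induction p with
  | zero =>
    ext x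
    simp only [pf, stepFn, Pi.smul_apply, smul_eq_mul, Finset.mul_sum]
    refine Finset.sum_congr rfl fun i _ => ?_
    by_cases h : x ∈ Ico ((i : ℝ) / n) (((i : ℕ) + 1 : ℕ) / n)
    · simp only [indicator_of_mem h]
    · simp only [indicator_of_notMem h, mul_zero]
  | succ p ih =>
    ext x
    simp only [pf, Pi.add_apply, map_smul, ih, Pi.smul_apply, prim, smul_eq_mul,
      intervalIntegral.integral_const_mul, mul_add]

/-- Partial sums of `c j / wt j` are the coefficients of the primitive. This turns any spline into
the derivative of an admissible test function with prescribed value at 0. -/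
theorem exists_dcoef_eq {p n : ℕ} (hn : 0 < n) (a : ℝ) (c : Fin (n + p) → ℝ) :
    ∃ d : Fin (n + (p + 1)) → ℝ, d (0 : Fin (n + p + 1)) = a ∧ dcoef p n d = c := by
  let e : ℕ → ℝ := fun k => if h : k < n + p then c ⟨k, h⟩ / wt p n k else 0
  refine ⟨fun i => a + ∑ k ∈ Finset.range i, e k, by simp, ?_⟩
  ext j
  have hj : (j : ℕ) < n + p := j.2
  have hw := (wt_pos (p := p) hn hj).ne'
  simp only [dcoef, LinearMap.coe_mk, AddHom.coe_mk, Fin.val_succ, Fin.val_castSucc,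
    Finset.sum_range_succ]
  simp only [e, hj, dif_pos]
  field_simp
  ring

/-- The mean value of a spline, as a functional of its coefficients. -/
def meanCoef (n p : ℕ) : (Fin (n + p) → ℝ) →ₗ[ℝ] ℝ where
  toFun c := prim (pf n p c) 1
  map_add' c d := by
    rw [← prim_add (memL2_pf _ _ _) (memL2_pf _ _ _) (by simp)]
    refine intervalIntegral.integral_congr fun t ht => ?_
    rw [uIcc_of_le zero_le_one] at ht
    exact pf_add c d ht
  map_smul' a c := by
    simp [pf_smul, prim]

/-- First component: coefficients of the splines whose derivatives of odd order less than `p`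
vanish at the boundary; second component: those whose derivatives of even order less than `p`
vanish there. -/
def symSplines (n : ℕ) : (p : ℕ) →
    Submodule ℝ (Fin (n + p) → ℝ) × Submodule ℝ (Fin (n + p) → ℝ)
  | 0 => (⊤, ⊤)
  | p + 1 => ((symSplines n p).2.comap (dcoef p n),
      (symSplines n p).1.comap (dcoef p n) ⊓
        (LinearMap.ker (LinearMap.proj (R := ℝ) (φ := fun _ => ℝ) (0 : Fin (n + p + 1))) ⊓
          LinearMap.ker (meanCoef n p ∘ₗ dcoef p n)))

/-- The space of splines whose odd derivatives vanish at the boundary. -/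
abbrev oddSplines (n p : ℕ) : Submodule ℝ (Fin (n + p) → ℝ) := (symSplines n p).1

/-- The space of splines whose even derivatives vanish at the boundary. -/
abbrev evenSplines (n p : ℕ) : Submodule ℝ (Fin (n + p) → ℝ) := (symSplines n p).2

theorem mem_oddSplines_succ {n p : ℕ} {c : Fin (n + (p + 1)) → ℝ} :
    c ∈ oddSplines n (p + 1) ↔ dcoef p n c ∈ evenSplines n p := Iff.rfl

theorem mem_evenSplines_succ {n p : ℕ} {c : Fin (n + (p + 1)) → ℝ} :
    c ∈ evenSplines n (p + 1) ↔ dcoef p n c ∈ oddSplines n p ∧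
      c (0 : Fin (n + p + 1)) = 0 ∧ prim (pf n p (dcoef p n c)) 1 = 0 := Iff.rfl

/-- Constants are odd splines, so orthogonality to the odd splines forces mean value zero. The point
1 is excluded because step functions on half-open cells vanish there. -/
theorem exists_const_mem_oddSplines {n : ℕ} (hn : 0 < n) (a : ℝ) (p : ℕ) :
    ∃ c ∈ oddSplines n p, ∀ x ∈ Ico (0 : ℝ) 1, pf n p c x = a := by
  cases p with
  | zero =>
    refine ⟨fun _ => a, trivial, fun x hx => ?_⟩
    obtain ⟨i, hi⟩ := exists_cell hn hx
    exact stepFn_eq _ i hi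
  | succ p =>
    obtain ⟨d, h0, h1⟩ := exists_dcoef_eq (p := p) hn a 0
    refine ⟨d, ?_, fun x hx => ?_⟩
    · rw [mem_oddSplines_succ, h1]; exact Submodule.zero_mem _
    · have h2 : pf n p (0 : Fin (n + p) → ℝ) = 0 := by
        simpa using pf_smul (n := n) (p := p) 0 0
      simp only [pf, Pi.add_apply, h0, h1, h2]
      simp [prim]

/-! ### Approximation properties in dual form -/

theorem ip_eq_ip_of_eqOn {f f' g : ℝ → ℝ} (h : ∀ x ∈ Ico (0 : ℝ) 1, f x = f' x) :
    ip g f = ip g f' :=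
  ip_congr_ae (by simp) (Filter.Eventually.of_forall fun x hx => h x (Ioo_subset_Ico_self hx))

/-- By Cauchy-Schwarz ‖y‖² ≤ ‖r‖ ‖k‖, and √H ‖k‖ ≤ ‖y‖ lets one factor ‖y‖ cancel. The constant `H`
is handed on unchanged from the pair (k, y) to the pair (y, r), which makes the induction on the
degree lossless. -/
theorem le_of_ip_eq_neg {y r k : ℝ → ℝ} {H : ℝ} (hH : 0 ≤ H) (hr : MemL2 r) (hk : MemL2 k)
    (h : ip y y = -ip r k) (hk' : H * ip k k ≤ ip y y) : H * ip y y ≤ ip r r := by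
  have h1 := ip_sq_le hr hk
  have h2 := ip_self_nonneg y
  have h3 := ip_self_nonneg r
  rcases h2.eq_or_lt with h4 | h4
  · rw [← h4]; simpa using h3
  · have h5 : ip y y * (H * ip y y) ≤ ip y y * ip r r := by
      have : ip y y ^ 2 ≤ ip r r * ip k k := by rw [h]; linarith [neg_sq (ip r k)]
      nlinarith
    exact le_of_mul_le_mul_left h5 h4

/-- Such an `r` has mean zero on every cell, so its primitive vanishes at all grid points. On a cell
of length 1/n Cauchy-Schwarz bounds the squared primitive by 1/n times the cell integral of r², and
integrating gives another factor 1/n. -/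
theorem prim_self_le_of_orth_step {n : ℕ} (hn : 0 < n) {r : ℝ → ℝ} (hr : MemL2 r)
    (h : ∀ c : Fin n → ℝ, ip r (stepFn n c) = 0) :
    (n : ℝ) ^ 2 * ip (prim r) (prim r) ≤ ip r r := by
  have hn' : (0 : ℝ) < n := by exact_mod_cast hn
  have hmem : ∀ i : ℕ, i ≤ n → (i : ℝ) / n ∈ Icc (0 : ℝ) 1 := fun i hi =>
    ⟨by positivity, by rw [div_le_one hn']; exact_mod_cast hi⟩
  have hcell : ∀ i : Fin n, ∫ x in ((i : ℝ) / n)..(((i : ℕ) + 1 : ℕ) / n : ℝ), r x = 0 := by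
    intro i
    have h1 := h (Pi.single i 1)
    rw [ip, integral_eq_sum_cells (hr.mul (memL2_stepFn _ _)) hn, Finset.sum_eq_single (i : ℕ)]
      at h1
    · rw [← h1]
      refine intervalIntegral.integral_congr_Ioo_of_le ?_ fun x hx => ?_
      · gcongr; omega
      · simp [stepFn_eq _ i (Ioo_subset_Ico_self hx)]
    · intro j hj hji
      rw [intervalIntegral.integral_congr_Ioo_of_le (g := fun _ => 0) ?_ fun x hx => ?_]
      · simp
      · gcongr; omega
      · have hj' := Finset.mem_range.1 hj
        simp only
        rw [stepFn_eq _ ⟨j, hj'⟩ (Ioo_subset_Ico_self hx), Pi.single_eq_of_ne, mul_zero]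
        exact fun h => hji (by rw [← h])
    · simp
  have hgrid : ∀ i : ℕ, i ≤ n → prim r (i / n) = 0 := by
    intro i
    induction i with
    | zero => simp
    | succ i ih =>
      intro hi
      have := prim_sub_prim hr (hmem i (by omega)) (hmem (i + 1) hi)
      rw [ih (by omega), hcell ⟨i, hi⟩] at this
      linarith
  rw [ip, ip, integral_eq_sum_cells (hr.prim.mul hr.prim) hn,
    integral_eq_sum_cells (hr.mul hr) hn, Finset.mul_sum]
  refine Finset.sum_le_sum fun i hi => ?_
  have hi' := Finset.mem_range.1 hi
  have ha := hmem i (by omega)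
  have hb := hmem (i + 1) hi'
  have hab : (i : ℝ) / n ≤ ((i + 1 : ℕ) : ℝ) / n := by gcongr; omega
  have hlen : ((i + 1 : ℕ) : ℝ) / n - (i : ℝ) / n = 1 / n := by push_cast; ring
  set a := (i : ℝ) / n
  set b := ((i + 1 : ℕ) : ℝ) / n
  set J := ∫ x in a..b, r x * r x
  have hbound : ∀ x ∈ Icc a b, prim r x * prim r x ≤ 1 / n * J := by
    intro x hx
    have hx' : x ∈ Icc (0 : ℝ) 1 := ⟨ha.1.trans hx.1, hx.2.trans hb.2⟩
    have h1 := prim_sub_prim hr ha hx'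
    rw [hgrid i (by omega), sub_zero] at h1
    have h2 := sq_integral_le hr ha.1 hx.1 hx'.2
    have h3 : ∫ t in a..x, r t * r t ≤ J :=
      intervalIntegral.integral_mono_interval le_rfl hx.1 hx.2
        (Filter.Eventually.of_forall fun t => mul_self_nonneg _)
        ((hr.mul hr).mono_set (by
          rw [uIcc_of_le zero_le_one]; exact uIcc_subset_Icc ha hb))
    have h4 : 0 ≤ ∫ t in a..x, r t * r t :=
      intervalIntegral.integral_nonneg hx.1 fun t _ => mul_self_nonneg _
    rw [← h1] at h2
    have h5 : x - a ≤ 1 / n := by linarith [hx.2]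
    have h6 : 0 ≤ x - a := sub_nonneg.2 hx.1
    calc prim r x * prim r x = prim r x ^ 2 := by ring
      _ ≤ (x - a) * ∫ t in a..x, r t * r t := h2
      _ ≤ 1 / n * J := mul_le_mul h5 h3 h4 (by positivity)
  have h7 := intervalIntegral.integral_mono_on hab
    ((hr.prim.mul hr.prim).mono_set (by
      rw [uIcc_of_le zero_le_one]; exact uIcc_subset_Icc ha hb))
    (intervalIntegrable_const (c := 1 / n * J)) hbound
  rw [intervalIntegral.integral_const, hlen, smul_eq_mul] at h7
  calc (n : ℝ) ^ 2 * ∫ x in a..b, prim r x * prim r x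
      ≤ (n : ℝ) ^ 2 * (1 / n * (1 / n * J)) := by gcongr
    _ = J := by field_simp

/-- A primitive minus its mean value. -/
def primMean (f : ℝ → ℝ) : ℝ → ℝ := prim f - fun _ => prim (prim f) 1

theorem MemL2.primMean {f : ℝ → ℝ} (hf : MemL2 f) : MemL2 (primMean f) :=
  hf.prim.sub (memL2_const _)

theorem prim_primMean {f : ℝ → ℝ} (hf : MemL2 f) : prim (primMean f) 1 = 0 := by
  rw [SplineMultigrid.primMean, prim_sub hf.prim (memL2_const _) (by simp), prim_const_one,
    sub_self]

theorem ip_primMean_self {f : ℝ → ℝ} (hf : MemL2 f) :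
    ip (primMean f) (primMean f) = ip (prim f) (primMean f) := by
  change ip (prim f - fun _ => prim (prim f) 1) (primMean f) = _
  rw [ip_sub_left hf.prim (memL2_const _) hf.primMean, ip_const_left,
    prim_primMean hf, mul_zero, sub_zero]

theorem ip_primMean_self_le {f : ℝ → ℝ} (hf : MemL2 f) :
    ip (primMean f) (primMean f) ≤ ip (prim f) (prim f) := by
  have h1 := ip_primMean_self hf
  have h2 := ip_sq_le hf.prim hf.primMean
  rw [← h1] at h2
  have h3 := ip_self_nonneg (primMean f)
  rcases h3.eq_or_lt with h4 | h4
  · rw [← h4]; exact ip_self_nonneg _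
  · nlinarith

/-- The two halves feed each other: integration by parts turns orthogonality of `r` to one family of
degree p + 1 into orthogonality of its primitive, normalized as the boundary conditions demand, to
the other family of degree p. `le_of_ip_eq_neg` then preserves the constant. -/
theorem dual_approximation {n : ℕ} (hn : 0 < n) (p : ℕ) :
    (∀ r, MemL2 r → (∀ c ∈ oddSplines n p, ip r (pf n p c) = 0) →
      (n : ℝ) ^ 2 * ip (prim r) (prim r) ≤ ip r r) ∧
    (∀ r, MemL2 r → (∀ c ∈ evenSplines n p, ip r (pf n p c) = 0) →
      (n : ℝ) ^ 2 * ip (primMean r) (primMean r) ≤ ip r r) := by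
  have hn2 : (0 : ℝ) ≤ (n : ℝ) ^ 2 := by positivity
  induction p with
  | zero =>
    refine ⟨fun r hr h => prim_self_le_of_orth_step hn hr fun c => h c trivial,
      fun r hr h => ?_⟩
    refine le_trans ?_ (prim_self_le_of_orth_step hn hr fun c => h c trivial)
    exact mul_le_mul_of_nonneg_left (ip_primMean_self_le hr) hn2
  | succ p ih =>
    refine ⟨fun r hr h => ?_, fun r hr h => ?_⟩
    · have h1 : prim r 1 = 0 := by
        obtain ⟨c, hc, hc'⟩ := exists_const_mem_oddSplines hn 1 (p + 1)
        have := h c hc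
        rwa [ip_eq_ip_of_eqOn hc', ip_const_right, one_mul] at this
      have h2 : ∀ c ∈ evenSplines n p, ip (prim r) (pf n p c) = 0 := by
        intro c hc
        obtain ⟨d, hd0, hd⟩ := exists_dcoef_eq hn 0 c
        have h3 := h d (by rw [mem_oddSplines_succ, hd]; exact hc)
        rw [pf, hd, hd0, ip_add_right (memL2_const _) (memL2_pf _ _ _).prim hr,
          ip_const_right, h1] at h3
        rw [ip_prim hr (memL2_pf _ _ _), h1]
        linarith
      refine le_of_ip_eq_neg hn2 hr hr.prim.primMean ?_ (ih.2 _ hr.prim h2)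
      rw [primMean, ip_sub_right hr.prim.prim (memL2_const _) hr, ip_const_right, h1,
        ip_prim hr hr.prim, h1]
      ring
    · have hm := prim_primMean hr
      have h1 : ∀ c ∈ oddSplines n p, ip (primMean r) (pf n p c) = 0 := by
        intro c hc
        -- Subtracting the mean of the odd spline makes its primitive vanish at both ends, hence an
        -- even spline that may be used as test function. The constant part is harmless because
        -- `primMean r` has mean zero.
        obtain ⟨c₁, hc₁, hc₁'⟩ := exists_const_mem_oddSplines hn (prim (pf n p c) 1) p
        have hI : ip (primMean r) (pf n p c₁) = 0 := by
          rw [ip_eq_ip_of_eqOn hc₁', ip_const_right, hm, mul_zero]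
        have hmean : meanCoef n p (c - c₁) = 0 := by
          have e : meanCoef n p c₁ = prim (fun _ => prim (pf n p c) 1) 1 := by
            have := ip_eq_ip_of_eqOn (g := fun _ => 1) hc₁'
            rw [ip_const_left, ip_const_left, one_mul, one_mul] at this
            exact this
          rw [map_sub, e, prim_const_one]
          exact sub_self _
        obtain ⟨d, hd0, hd⟩ := exists_dcoef_eq hn 0 (c - c₁)
        have hdm : prim (pf n p (c - c₁)) 1 = 0 := hmean
        have h3 := h d (by
          rw [mem_evenSplines_succ, hd]; exact ⟨Submodule.sub_mem _ hc hc₁, hd0, hmean⟩)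
        rw [pf, hd, hd0, ip_add_right (memL2_const _) (memL2_pf _ _ _).prim hr,
          ip_const_right, zero_mul, zero_add] at h3
        have h4 : ip (primMean r) (pf n p (c - c₁)) = 0 := by
          rw [primMean, ip_sub_left hr.prim (memL2_const _) (memL2_pf _ _ _), ip_const_left,
            ip_prim hr (memL2_pf _ _ _), h3, hdm]
          ring
        have h5 : ip (primMean r) (pf n p c)
            = ip (primMean r) (pf n p (c - c₁) + pf n p c₁) := by
          refine ip_congr_ae (by simp) (Filter.Eventually.of_forall fun x hx => ?_)
          rw [Pi.add_apply, ← pf_add _ _ (Ioo_subset_Icc_self hx), sub_add_cancel]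
        rw [h5, ip_add_right (memL2_pf _ _ _) (memL2_pf _ _ _) hr.primMean, h4, hI, add_zero]
      refine le_of_ip_eq_neg hn2 hr hr.primMean.prim ?_ (ih.1 _ hr.primMean h1)
      rw [ip_primMean_self hr, ip_prim hr hr.primMean, hm]
      ring

/-- The Aubin-Nitsche estimate for functions that are `H¹`-orthogonal to the splines with
vanishing odd derivatives at the boundary. -/
theorem aubin_nitsche {n : ℕ} (hn : 0 < n) (p : ℕ) {a : ℝ} {w g : ℝ → ℝ} (hg : MemL2 g)
    (hw : w = (fun _ => a) + prim g)
    (h : ∀ c ∈ oddSplines n (p + 1),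
      ip g (pf n p (dcoef p n c)) + ip w (pf n (p + 1) c) = 0) :
    (n : ℝ) ^ 2 * ip w w ≤ 2 * (ip g g + ip w w) := by
  have hwm : MemL2 w := by rw [hw]; exact (memL2_const _).add hg.prim
  have hmean : prim w 1 = 0 := by
    obtain ⟨d, h0, h1⟩ := exists_dcoef_eq (p := p) hn 1 0
    have h2 := h d (by rw [mem_oddSplines_succ, h1]; exact Submodule.zero_mem _)
    have h3 : pf n p (0 : Fin (n + p) → ℝ) = fun _ => 0 := by
      have := pf_smul (n := n) (p := p) 0 0
      rw [zero_smul, zero_smul] at this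
      exact this
    rw [pf, h1, h3, h0, ip_const_right, ip_add_right (memL2_const _) (memL2_const _).prim hwm,
      ip_const_right] at h2
    have h4 : prim (fun _ => (0 : ℝ)) = fun _ => 0 := by ext; simp [prim]
    rw [h4, ip_const_right] at h2
    linarith
  set r := g - prim w with hr
  have hrm : MemL2 r := hg.sub hwm.prim
  have horth : ∀ c ∈ evenSplines n p, ip r (pf n p c) = 0 := by
    intro c hc
    obtain ⟨d, hd0, hd⟩ := exists_dcoef_eq hn 0 c
    have h3 := h d (by rw [mem_oddSplines_succ, hd]; exact hc)
    rw [pf, hd, hd0, ip_add_right (memL2_const _) (memL2_pf _ _ _).prim hwm,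
      ip_const_right] at h3
    rw [hr, ip_sub_left hg hwm.prim (memL2_pf _ _ _), ip_prim hwm (memL2_pf _ _ _), hmean]
    linarith
  have hdual := (dual_approximation hn p).2 r hrm horth
  -- Up to constants, which `w` does not see, `primMean r` is w minus its second primitive. Another
  -- integration by parts makes the second primitive contribute ‖prim w‖² with the favourable sign.
  have hww : ip w w = ip w (primMean r) - ip (prim w) (prim w) := by
    have e1 : ip w (primMean r) = ip w (prim r) := by
      rw [primMean, ip_sub_right hrm.prim (memL2_const _) hwm, ip_const_right, hmean]; ring
    have e2 : ip w (prim r) = ip w (prim g - prim (prim w)) :=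
      ip_congr_ae (by simp) (Filter.Eventually.of_forall fun x hx => by
        rw [hr, prim_sub hg hwm.prim (Ioo_subset_Icc_self hx)]; rfl)
    have e3 : ip w (prim g) = ip w w := by
      have : ip w w = ip w ((fun _ => a) + prim g) := congrArg (ip w) hw
      rw [this, ip_add_right (memL2_const _) hg.prim hwm, ip_const_right, hmean]; ring
    have e4 := ip_prim hwm hwm.prim
    rw [hmean] at e4
    rw [e1, e2, ip_sub_right hg.prim hwm.prim.prim hwm, e3]
    linarith
  have hK := ip_self_nonneg (prim w)
  have hW := ip_self_nonneg w
  have hN := ip_self_nonneg (primMean r)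
  have h1 : ip w w ≤ ip (primMean r) (primMean r) := by
    have h2 := ip_sq_le hwm hrm.primMean
    rcases hW.eq_or_lt with h4 | h4
    · rw [← h4]; exact hN
    · have : ip w w ^ 2 ≤ ip w (primMean r) ^ 2 := by
        apply pow_le_pow_left₀ hW; linarith
      nlinarith
  have h2 : ip r r ≤ 2 * (ip g g + ip (prim w) (prim w)) := by
    have h3 := ip_self_nonneg (g + prim w)
    rw [ip_add_left hg hwm.prim (hg.add hwm.prim), ip_add_right hg hwm.prim hg,
      ip_add_right hg hwm.prim hwm.prim] at h3
    rw [hr, ip_sub_left hg hwm.prim (hg.sub hwm.prim), ip_sub_right hg hwm.prim hg,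
      ip_sub_right hg hwm.prim hwm.prim]
    linarith
  have h3 := ip_prim_self_le hwm
  calc (n : ℝ) ^ 2 * ip w w ≤ (n : ℝ) ^ 2 * ip (primMean r) (primMean r) := by gcongr
    _ ≤ ip r r := hdual
    _ ≤ 2 * (ip g g + ip w w) := by linarith

/-! ### Inverse inequality -/

/-- The counterpart of `le_of_ip_eq_neg` for inverse inequalities: ‖y‖² ≤ ‖u‖ ‖k‖ and ‖k‖ ≤ √H ‖y‖
leave ‖y‖ ≤ √H ‖u‖, again without loss in `H`. -/
theorem le_of_ip_self_eq {y u k : ℝ → ℝ} {H : ℝ} (hH : 0 ≤ H) (hu : MemL2 u) (hk : MemL2 k)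
    (h : ip y y = -ip u k) (hk' : ip k k ≤ H * ip y y) : ip y y ≤ H * ip u u := by
  have h1 := ip_sq_le hu hk
  have h2 := ip_self_nonneg y
  have h3 := ip_self_nonneg u
  rcases h2.eq_or_lt with h4 | h4
  · rw [← h4]; positivity
  · have h5 : ip y y * ip y y ≤ ip y y * (H * ip u u) := by
      have : ip y y ^ 2 ≤ ip u u * ip k k := by rw [h]; linarith [neg_sq (ip u k)]
      nlinarith
    exact le_of_mul_le_mul_left h5 h4

/-- The function on the right is affine on each cell, so the estimate is local. Among affine
functions of slope s on a cell of length h, the least squared norm is s²h³/12, attained when the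
midpoint value is zero. -/
theorem inverse_step {n : ℕ} (hn : 0 < n) (a : ℝ) (c : Fin n → ℝ) :
    ip (stepFn n c) (stepFn n c) ≤ 12 * (n : ℝ) ^ 2 *
      ip ((fun _ => a) + prim (stepFn n c)) ((fun _ => a) + prim (stepFn n c)) := by
  have hn' : (0 : ℝ) < n := by exact_mod_cast hn
  have hs := memL2_stepFn n c
  have hu : MemL2 ((fun _ => a) + prim (stepFn n c)) := (memL2_const _).add hs.prim
  rw [ip, ip, integral_eq_sum_cells (hs.mul hs) hn, integral_eq_sum_cells (hu.mul hu) hn,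
    Finset.mul_sum]
  refine Finset.sum_le_sum fun i hi => ?_
  have hi' := Finset.mem_range.1 hi
  have hmem : ∀ i : ℕ, i ≤ n → (i : ℝ) / n ∈ Icc (0 : ℝ) 1 := fun i hi =>
    ⟨by positivity, by rw [div_le_one hn']; exact_mod_cast hi⟩
  have ha := hmem i (by omega)
  have hb := hmem (i + 1) hi'
  have hab : (i : ℝ) / n ≤ ((i + 1 : ℕ) : ℝ) / n := by gcongr; omega
  have hlen : ((i + 1 : ℕ) : ℝ) / n = (i : ℝ) / n + 1 / n := by push_cast; ring
  have hval : ∀ x ∈ Ioo ((i : ℝ) / n) (((i + 1 : ℕ) : ℝ) / n), stepFn n c x = c ⟨i, hi'⟩ :=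
    fun x hx => stepFn_eq c ⟨i, hi'⟩ (Ioo_subset_Ico_self hx)
  set A := (i : ℝ) / n
  set B := ((i + 1 : ℕ) : ℝ) / n
  set s := c ⟨i, hi'⟩
  set α := a + prim (stepFn n c) A
  have h1 : ∫ x in A..B, stepFn n c x * stepFn n c x = 1 / n * s ^ 2 := by
    rw [intervalIntegral.integral_congr_Ioo_of_le (g := fun _ => s ^ 2) hab fun x hx => ?_]
    · rw [intervalIntegral.integral_const, hlen]; simp
    · simp only [hval x hx]; ring
  have h2 : ∫ x in A..B, ((fun _ => a) + prim (stepFn n c) : ℝ → ℝ) x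
        * ((fun _ => a) + prim (stepFn n c) : ℝ → ℝ) x
      = ∫ x in A..B, (α + s * (x - A)) ^ 2 := by
    refine intervalIntegral.integral_congr_Ioo_of_le hab fun x hx => ?_
    have hx' : x ∈ Icc (0 : ℝ) 1 := ⟨ha.1.trans hx.1.le, hx.2.le.trans hb.2⟩
    have h3 := prim_sub_prim hs ha hx'
    rw [intervalIntegral.integral_congr_Ioo_of_le (g := fun _ => s) hx.1.le fun y hy =>
      hval y ⟨hy.1, hy.2.trans hx.2⟩, intervalIntegral.integral_const, smul_eq_mul] at h3
    have h4 : ((fun _ => a) + prim (stepFn n c) : ℝ → ℝ) x = α + s * (x - A) := by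
      simp only [Pi.add_apply, α]; linarith
    simp only [h4]; ring
  have h3 : ∫ x in A..B, (α + s * (x - A)) ^ 2
      = α ^ 2 * (1 / n) + α * s * (1 / n) ^ 2 + s ^ 2 * (1 / n) ^ 3 / 3 := by
    rw [intervalIntegral.integral_eq_sub_of_hasDerivAt
      (f := fun x => α ^ 2 * (x - A) + α * s * (x - A) ^ 2 + s ^ 2 * (x - A) ^ 3 / 3)]
    · simp only [hlen]; ring
    · intro x _
      have e : HasDerivAt (fun x : ℝ => x - A) 1 x := (hasDerivAt_id x).sub_const A
      convert! ((e.const_mul (α ^ 2)).add ((e.pow 2).const_mul (α * s))).add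
        (((e.pow 3).const_mul (s ^ 2)).div_const 3) using 1
      push_cast
      ring
    · exact Continuous.intervalIntegrable (by fun_prop) _ _
  rw [h1, h2, h3]
  -- Completing the square in the midpoint value of the affine function.
  have h4 : 12 * (n : ℝ) ^ 2 * (α ^ 2 * (1 / n) + α * s * (1 / n) ^ 2 + s ^ 2 * (1 / n) ^ 3 / 3)
      = 1 / n * s ^ 2 + 12 * n * (α + s * (1 / n) / 2) ^ 2 := by
    field_simp
    ring
  rw [h4]
  have : 0 ≤ 12 * n * (α + s * (1 / n) / 2) ^ 2 := by positivity
  linarith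

/-- For y = u' with derivative k, the symmetry conditions kill the boundary terms in ‖y‖² = -(u, k),
and the induction hypothesis bounds ‖k‖ by ‖y‖. The free constant `a` is allowed only in the first
half, because even splines of positive degree vanish at both ends. The second half has its boundary
values of the primitive fixed to zero instead. -/
theorem inverse_inequality_aux {n : ℕ} (hn : 0 < n) (p : ℕ) :
    (∀ c ∈ evenSplines n p, ∀ a : ℝ, ip (pf n p c) (pf n p c) ≤ 12 * (n : ℝ) ^ 2 *
      ip ((fun _ => a) + prim (pf n p c)) ((fun _ => a) + prim (pf n p c))) ∧
    (∀ c ∈ oddSplines n p, prim (pf n p c) 1 = 0 →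
      ip (pf n p c) (pf n p c) ≤ 12 * (n : ℝ) ^ 2 * ip (prim (pf n p c)) (prim (pf n p c))) := by
  have hn2 : (0 : ℝ) ≤ 12 * (n : ℝ) ^ 2 := by positivity
  induction p with
  | zero =>
    refine ⟨fun c _ a => inverse_step hn a c, fun c _ _ => ?_⟩
    have := inverse_step hn 0 c
    have e : (fun _ => (0 : ℝ)) + prim (stepFn n c) = prim (stepFn n c) := by ext; simp
    rwa [e] at this
  | succ p ih =>
    refine ⟨fun c hc a => ?_, fun c hc hm => ?_⟩
    · obtain ⟨h1, h2, h3⟩ := mem_evenSplines_succ.1 hc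
      have hx := memL2_pf n p (dcoef p n c)
      have e : pf n (p + 1) c = prim (pf n p (dcoef p n c)) := by
        ext x; simp [pf, h2]
      rw [e]
      refine le_of_ip_self_eq hn2 ((memL2_const _).add hx.prim.prim) hx ?_ (ih.2 _ h1 h3)
      rw [ip_add_left (memL2_const _) hx.prim.prim hx, ip_const_left, ip_prim hx.prim hx, h3]
      ring
    · have hx := memL2_pf n p (dcoef p n c)
      have hu := memL2_pf n (p + 1) c
      refine le_of_ip_self_eq hn2 hu.prim hx ?_ (ih.1 _ hc _)
      change ip ((fun _ => c (0 : Fin (n + p + 1))) + prim (pf n p (dcoef p n c)))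
        (pf n (p + 1) c) = _
      rw [ip_add_left (memL2_const _) hx.prim hu, ip_const_left, hm, ip_prim hx hu, hm,
        ip_comm]
      ring

/-- The inverse inequality, with a constant that does not depend on the degree. -/
theorem inverse_inequality {n : ℕ} (hn : 0 < n) (p : ℕ) {c : Fin (n + (p + 1)) → ℝ}
    (hc : c ∈ oddSplines n (p + 1)) :
    ip (pf n p (dcoef p n c)) (pf n p (dcoef p n c))
      ≤ 12 * (n : ℝ) ^ 2 * ip (pf n (p + 1) c) (pf n (p + 1) c) :=
  (inverse_inequality_aux hn p).1 _ hc _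

/-! ### B-splines -/

theorem knot_mono (p n : ℕ) : Monotone (knot p n) := by
  intro i j hij
  refine min_le_min_right _ ?_
  gcongr

theorem knot_shift (p n i : ℕ) : knot (p + 1) n (i + 1) = knot p n i := by
  simp [knot]

theorem knot_of_le {p n i : ℕ} (h : i ≤ p) : knot p n i = 0 := by
  simp [knot, Nat.sub_eq_zero_of_le h]

theorem knot_of_ge {p n i : ℕ} (hn : 0 < n) (h : n + p ≤ i) : knot p n i = 1 := by
  have hn' : (0 : ℝ) < n := by exact_mod_cast hn
  refine min_eq_right ?_
  rw [le_div_iff₀ hn', one_mul]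
  exact_mod_cast (by omega : n ≤ i - p)

theorem knot_nonneg (p n i : ℕ) : 0 ≤ knot p n i := le_min (by positivity) zero_le_one

theorem knot_le_one (p n i : ℕ) : knot p n i ≤ 1 := min_le_right _ _

theorem knot_lt_one {p n i : ℕ} (h : i < n + p) (hn : 0 < n) : knot p n i < 1 :=
  (knot_strict hn h).trans_le (knot_le_one _ _ _)

/-- An interior knot has multiplicity one. -/
theorem knot_eq_zero_of_eq {p n i : ℕ} (hn : 0 < n) (h : knot p n i = knot p n (i + 1))
    (h1 : knot p n i ≠ 1) : knot p n i = 0 := by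
  have hn' : (0 : ℝ) < n := by exact_mod_cast hn
  by_contra h0
  have hi : p < i := by
    by_contra hle
    exact h0 (knot_of_le (by omega))
  have hlt : ((i - p : ℕ) : ℝ) / n < 1 := by
    by_contra hge
    exact h1 (min_eq_right (not_lt.1 hge))
  have hlt' : ((i - p : ℕ) : ℝ) / n < ((i + 1 - p : ℕ) : ℝ) / n := by
    apply div_lt_div_of_pos_right _ hn'
    exact_mod_cast (by omega : i - p < i + 1 - p)
  have : knot p n i < knot p n (i + 1) := by
    rw [knot, min_eq_left hlt.le]
    exact lt_min hlt' hlt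
  exact this.ne h

theorem coxDeBoor_shift (t : ℕ → ℝ) (k i : ℕ) :
    coxDeBoor t k (i + 1) = coxDeBoor (fun j => t (j + 1)) k i := by
  induction k generalizing i with
  | zero => ext x; simp [coxDeBoor]
  | succ k ih =>
    ext x
    have e1 : i + 1 + k + 1 = i + k + 1 + 1 := by omega
    have e2 : i + 1 + k + 2 = i + k + 2 + 1 := by omega
    simp only [coxDeBoor, ih, e1, e2]

theorem coxDeBoor_knot_shift (p n k i : ℕ) :
    coxDeBoor (knot (p + 1) n) k (i + 1) = coxDeBoor (knot p n) k i := by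
  rw [coxDeBoor_shift]
  congr 1
  ext j
  exact knot_shift p n j

theorem hasDerivAt_coxDeBoor_zero {t : ℕ → ℝ} (i : ℕ) {x : ℝ} (hx : x ∉ range t) :
    HasDerivAt (coxDeBoor t 0 i) 0 x := by
  have h1 : t i ≠ x := fun h => hx ⟨_, h⟩
  have h2 : t (i + 1) ≠ x := fun h => hx ⟨_, h⟩
  have : coxDeBoor t 0 i =ᶠ[nhds x] fun _ => coxDeBoor t 0 i x := by
    have e1 : ∀ᶠ y in nhds x, (t i ≤ y ↔ t i ≤ x) := by
      rcases h1.lt_or_gt with h | h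
      · filter_upwards [lt_mem_nhds h] with y hy
        exact ⟨fun _ => h.le, fun _ => le_of_lt hy⟩
      · filter_upwards [gt_mem_nhds h] with y hy
        exact ⟨fun h' => absurd h' (not_le.2 hy), fun h' => absurd h' (not_le.2 h)⟩
    have e2 : ∀ᶠ y in nhds x, (y < t (i + 1) ↔ x < t (i + 1)) := by
      rcases h2.lt_or_gt with h | h
      · filter_upwards [lt_mem_nhds h] with y hy
        exact ⟨fun h' => absurd h' (not_lt.2 (le_of_lt hy)), fun h' => absurd h' (not_lt.2 h.le)⟩
      · filter_upwards [gt_mem_nhds h] with y hy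
        exact ⟨fun _ => h, fun _ => hy⟩
    filter_upwards [e1, e2] with y hy1 hy2
    simp only [coxDeBoor, hy1, hy2]
  exact (hasDerivAt_const x _).congr_of_eventuallyEq this

theorem hasDerivAt_coxDeBoor_succ {t : ℕ → ℝ} {k i : ℕ} {x a b : ℝ}
    (ha : HasDerivAt (coxDeBoor t k i) a x) (hb : HasDerivAt (coxDeBoor t k (i + 1)) b x) :
    HasDerivAt (coxDeBoor t (k + 1) i)
      (1 / (t (i + k + 1) - t i) * coxDeBoor t k i x + (x - t i) / (t (i + k + 1) - t i) * a
        + (-1 / (t (i + k + 2) - t (i + 1)) * coxDeBoor t k (i + 1) x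
          + (t (i + k + 2) - x) / (t (i + k + 2) - t (i + 1)) * b)) x := by
  have e1 : HasDerivAt (fun x => (x - t i) / (t (i + k + 1) - t i))
      (1 / (t (i + k + 1) - t i)) x := ((hasDerivAt_id x).sub_const _).div_const _
  have e2 : HasDerivAt (fun x => (t (i + k + 2) - x) / (t (i + k + 2) - t (i + 1)))
      (-1 / (t (i + k + 2) - t (i + 1))) x := ((hasDerivAt_id x).const_sub _).div_const _
  exact (e1.mul ha).add (e2.mul hb)

/-- The derivative of a B-spline away from the knots. -/
theorem hasDerivAt_coxDeBoor {t : ℕ → ℝ} (ht : Monotone t) (k i : ℕ) {x : ℝ}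
    (hx : x ∉ range t) :
    HasDerivAt (coxDeBoor t (k + 1) i)
      ((k + 1) * (coxDeBoor t k i x / (t (i + k + 1) - t i)
        - coxDeBoor t k (i + 1) x / (t (i + k + 2) - t (i + 1)))) x := by
  induction k generalizing i with
  | zero =>
    convert! hasDerivAt_coxDeBoor_succ (hasDerivAt_coxDeBoor_zero i hx)
      (hasDerivAt_coxDeBoor_zero (i + 1) hx) using 1
    push_cast
    ring
  | succ k ih =>
    convert! hasDerivAt_coxDeBoor_succ (ih i) (ih (i + 1)) using 1
    have m0 : t i ≤ t (i + 1) := ht (by omega)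
    have m1 : t (i + 1) ≤ t (i + k + 1) := ht (by omega)
    have m2 : t (i + k + 1) ≤ t (i + k + 2) := ht (by omega)
    have m3 : t (i + k + 2) ≤ t (i + k + 3) := ht (by omega)
    have i1 : i + 1 + k + 1 = i + k + 2 := by omega
    have i2 : i + 1 + k + 2 = i + k + 3 := by omega
    have i3 : i + (k + 1) + 1 = i + k + 2 := by omega
    have i4 : i + (k + 1) + 2 = i + k + 3 := by omega
    simp only [coxDeBoor, i1, i2, i3, i4]
    set a := coxDeBoor t k i x
    set b := coxDeBoor t k (i + 1) x
    set c := coxDeBoor t k (i + 1 + 1) x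
    -- This term is all that separates the two forms of the derivative. If the knots coincide, the
    -- first factor is zero by the convention on division by zero; otherwise both quotients in the
    -- second factor are 1.
    have key : (b / (t (i + k + 2) - t (i + 1))) *
        (((t (i + k + 2) - t i) / (t (i + k + 2) - t i))
          - ((t (i + k + 3) - t (i + 1)) / (t (i + k + 3) - t (i + 1)))) = 0 := by
      by_cases h : t (i + k + 2) - t (i + 1) = 0
      · simp [h]
      · have h' : 0 < t (i + k + 2) - t (i + 1) :=
          lt_of_le_of_ne (by linarith) (Ne.symm h)
        have h1 : t (i + k + 2) - t i ≠ 0 := (by linarith : 0 < t (i + k + 2) - t i).ne'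
        have h2 : t (i + k + 3) - t (i + 1) ≠ 0 :=
          (by linarith : 0 < t (i + k + 3) - t (i + 1)).ne'
        rw [div_self h1, div_self h2, sub_self, mul_zero]
    push_cast
    linear_combination (k + 1 : ℝ) * key

/-! ### Continuity and boundary values -/

/-- Repeated knots occur only at 0 and 1. The function is therefore a full hat, one half of a hat at
an end of the interval, or zero when all three knots coincide. The jump of a half hat at 0 or 1 is
invisible on the half-open interval. -/
theorem continuousOn_coxDeBoor_one {p n : ℕ} (hn : 0 < n) (i : ℕ) :
    ContinuousOn (coxDeBoor (knot p n) 1 i) (Ico 0 1) := by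
  have m0 := knot_mono p n (by omega : i ≤ i + 1)
  have m1 := knot_mono p n (by omega : i + 1 ≤ i + 2)
  have hmult0 := knot_eq_zero_of_eq (p := p) (i := i) hn
  have hmult1 := knot_eq_zero_of_eq (p := p) (i := i + 1) hn
  have hle := knot_le_one p n (i + 2)
  have hge := knot_nonneg p n i
  simp only [coxDeBoor, add_zero]
  simp only [show i + 1 + 1 = i + 2 from rfl] at *
  generalize knot p n i = a at *
  generalize knot p n (i + 1) = b at *
  generalize knot p n (i + 2) = c at *
  rcases m0.eq_or_lt with hab | hab
  · subst hab
    rcases m1.eq_or_lt with hbc | hbc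
    · subst hbc
      simp only [sub_self, div_zero, zero_mul, add_zero]
      exact continuousOn_const
    · have ha0 : a = 0 := hmult0 rfl (by linarith)
      have hc : (0 : ℝ) < c := by linarith
      refine ContinuousOn.congr (f := fun x => max 0 ((c - x) / c)) (by fun_prop) ?_
      intro x hx
      subst ha0
      by_cases h : x < c
      · have : 0 ≤ (c - x) / c := div_nonneg (by linarith) (by linarith)
        simp [hx.1, h, max_eq_right this]
      · have : (c - x) / c ≤ 0 :=
          div_nonpos_of_nonpos_of_nonneg (by linarith) (by linarith)
        simp [hx.1, h, max_eq_left this]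
  · rcases m1.eq_or_lt with hbc | hbc
    · subst hbc
      have hb1 : b = 1 := by
        by_contra hb
        have := hmult1 rfl hb
        linarith
      refine ContinuousOn.congr (f := fun x => max 0 ((x - a) / (b - a))) (by fun_prop) ?_
      intro x hx
      have hx1 : x < b := by rw [hb1]; exact hx.2
      by_cases h : a ≤ x
      · have : 0 ≤ (x - a) / (b - a) := div_nonneg (by linarith) (by linarith)
        simp [h, hx1, max_eq_right this]
      · have : (x - a) / (b - a) ≤ 0 :=
          div_nonpos_of_nonpos_of_nonneg (by linarith) (by linarith)
        simp [h, max_eq_left this]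
    · refine ContinuousOn.congr
        (f := fun x => max 0 (min ((x - a) / (b - a)) ((c - x) / (c - b)))) (by fun_prop) ?_
      intro x hx
      have hba : 0 < b - a := by linarith
      have hcb : 0 < c - b := by linarith
      by_cases h1 : a ≤ x
      · by_cases h2 : x < b
        · have e1 : (x - a) / (b - a) ≤ (c - x) / (c - b) :=
            ((div_le_one hba).2 (by linarith)).trans ((one_le_div hcb).2 (by linarith))
          have e2 : 0 ≤ (x - a) / (b - a) := div_nonneg (by linarith) hba.le
          simp [h1, h2, not_le.2 h2, min_eq_left e1, max_eq_right e2]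
        · by_cases h3 : x < c
          · have e1 : (c - x) / (c - b) ≤ (x - a) / (b - a) :=
              ((div_le_one hcb).2 (by linarith)).trans ((one_le_div hba).2 (by linarith))
            have e2 : 0 ≤ (c - x) / (c - b) := div_nonneg (by linarith) hcb.le
            simp [h2, h3, not_lt.1 h2, min_eq_right e1, max_eq_right e2]
          · have e1 : (c - x) / (c - b) ≤ 0 :=
              div_nonpos_of_nonpos_of_nonneg (by linarith) hcb.le
            simp [h2, h3, max_eq_left ((min_le_right _ _).trans e1)]
      · have e1 : (x - a) / (b - a) ≤ 0 :=
          div_nonpos_of_nonpos_of_nonneg (by linarith) hba.le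
        have h2 : ¬ b ≤ x := by linarith
        simp [h1, h2, max_eq_left ((min_le_left _ _).trans e1)]

theorem continuousOn_coxDeBoor {p n : ℕ} (hn : 0 < n) (k i : ℕ) :
    ContinuousOn (coxDeBoor (knot p n) (k + 1) i) (Ico 0 1) := by
  induction k generalizing i with
  | zero => exact continuousOn_coxDeBoor_one hn i
  | succ k ih =>
    have h1 := ih i
    have h2 := ih (i + 1)
    rw [show coxDeBoor (knot p n) (k + 1 + 1) i = fun x =>
      (x - knot p n i) / (knot p n (i + (k + 1) + 1) - knot p n i)
        * coxDeBoor (knot p n) (k + 1) i x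
      + (knot p n (i + (k + 1) + 2) - x) / (knot p n (i + (k + 1) + 2) - knot p n (i + 1))
        * coxDeBoor (knot p n) (k + 1) (i + 1) x from rfl]
    exact ContinuousOn.add (ContinuousOn.mul (by fun_prop) h1) (ContinuousOn.mul (by fun_prop) h2)

theorem coxDeBoor_at_zero {p n : ℕ} (hn : 0 < n) {k i : ℕ} (hk : k ≤ p) :
    coxDeBoor (knot p n) k i 0 = if i + k = p then 1 else 0 := by
  have hn' : (0 : ℝ) < n := by exact_mod_cast hn
  have hpos : ∀ j, p < j → 0 < knot p n j := fun j hj =>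
    lt_min (div_pos (by exact_mod_cast (by omega : 0 < j - p)) hn') one_pos
  induction k generalizing i with
  | zero =>
    simp only [coxDeBoor, add_zero]
    rcases lt_trichotomy i p with h | h | h
    · simp [knot_of_le (show i + 1 ≤ p by omega), h.ne]
    · simp [h, knot_of_le (le_refl p), hpos]
    · simp [(hpos i h).not_ge, h.ne']
  | succ k ih =>
    simp only [coxDeBoor, ih (by omega : k ≤ p)]
    by_cases h1 : i + k = p
    · simp [h1, knot_of_le (show i ≤ p by omega), show ¬ (i + 1 + k = p) by omega,
        show ¬ (i + (k + 1) = p) by omega]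
    · by_cases h2 : i + 1 + k = p
      · have := (hpos (i + k + 2) (by omega)).ne'
        simp [h1, h2, knot_of_le (show i + 1 ≤ p by omega), show i + (k + 1) = p by omega,
          div_self this]
      · simp [h1, h2, show ¬ (i + (k + 1) = p) by omega]

/-- A left limit is needed because the half-open convention makes every B-spline vanish at 1 itself.
The limit is the same for every degree `k`: all knots from index n + p on equal 1, so the recursion
keeps only the function of index n + p - 1. -/
theorem tendsto_coxDeBoor_one {p n : ℕ} (hn : 0 < n) (k i : ℕ) :
    Filter.Tendsto (coxDeBoor (knot p n) k i) (nhdsWithin 1 (Iio 1))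
      (nhds (if i + 1 = n + p then 1 else 0)) := by
  induction k generalizing i with
  | zero =>
    refine tendsto_const_nhds.congr' ?_
    rcases lt_trichotomy (i + 1) (n + p) with h | h | h
    · have h1 := knot_lt_one h hn
      filter_upwards [Ioo_mem_nhdsLT h1] with x hx
      simp [coxDeBoor, h.ne, hx.1.le]
    · have h1 := knot_lt_one (show i < n + p by omega) hn
      filter_upwards [Ioo_mem_nhdsLT h1] with x hx
      simp [coxDeBoor, h, knot_of_ge hn (le_refl (n + p)), hx.1.le, hx.2]
    · filter_upwards [self_mem_nhdsWithin] with x hx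
      have : ¬ (1 ≤ x) := not_le.2 hx
      simp [coxDeBoor, h.ne', knot_of_ge hn (show n + p ≤ i by omega), this]
  | succ k ih =>
    have hid : Filter.Tendsto (fun x : ℝ => x) (nhdsWithin 1 (Iio 1)) (nhds 1) :=
      tendsto_nhdsWithin_of_tendsto_nhds Filter.tendsto_id
    have h1 := (((hid.sub_const (knot p n i)).div_const
      (knot p n (i + k + 1) - knot p n i)).mul (ih i)).add
      (((hid.const_sub (knot p n (i + k + 2))).div_const
        (knot p n (i + k + 2) - knot p n (i + 1))).mul (ih (i + 1)))
    have e : (1 - knot p n i) / (knot p n (i + k + 1) - knot p n i)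
          * (if i + 1 = n + p then 1 else 0)
        + (knot p n (i + k + 2) - 1) / (knot p n (i + k + 2) - knot p n (i + 1))
          * (if i + 1 + 1 = n + p then 1 else 0) = if i + 1 = n + p then (1 : ℝ) else 0 := by
      by_cases c1 : i + 1 = n + p
      · have := knot_lt_one (show i < n + p by omega) hn
        have h2 : 1 - knot p n i ≠ 0 := by linarith
        simp [c1, knot_of_ge hn (show n + p ≤ i + k + 1 by omega), div_self h2]
      · by_cases c2 : i + 1 + 1 = n + p
        · simp [c1, c2, knot_of_ge hn (show n + p ≤ i + k + 2 by omega)]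
        · simp [c1, c2]
    rw [e] at h1
    exact h1

/-! ### Identification of B-spline expansions with iterated primitives -/

theorem sum_mul_sub_eq {m : ℕ} (c : Fin (m + 1) → ℝ) {g : ℕ → ℝ} (h0 : g 0 = 0)
    (h1 : g (m + 1) = 0) :
    ∑ i : Fin (m + 1), c i * (g i - g (i + 1))
      = ∑ j : Fin m, (c j.succ - c j.castSucc) * g (j + 1) := by
  simp only [mul_sub, sub_mul, Finset.sum_sub_distrib]
  rw [Fin.sum_univ_succ fun i : Fin (m + 1) => c i * g i,
    Fin.sum_univ_castSucc fun i : Fin (m + 1) => c i * g (i + 1)]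
  simp [h0, h1]

/-- The B-spline expansion agrees with the spline obtained by repeated integration. -/
theorem sum_bspline_eq_pf {n : ℕ} (hn : 0 < n) (p : ℕ) (c : Fin (n + p) → ℝ) {x : ℝ}
    (hx : x ∈ Ico (0 : ℝ) 1) : ∑ i, c i * bspline p n i x = pf n p c x := by
  induction p generalizing x with
  | zero =>
    simp only [pf, stepFn, Nat.add_zero]
    refine Finset.sum_congr rfl fun i _ => ?_
    have hn' : (0 : ℝ) < n := by exact_mod_cast hn
    have hk : ∀ j : ℕ, j ≤ n → knot 0 n j = (j : ℝ) / n := fun j hj =>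
      min_eq_left ((div_le_one hn').2 (by exact_mod_cast hj))
    have h1 := hk i i.2.le
    have h2 := hk (i + 1) i.2
    simp only [bspline, coxDeBoor, h1, h2, indicator, mem_Ico, mul_ite, mul_one, mul_zero]
  | succ p ih =>
    set S : ℝ → ℝ := fun y => ∑ i, c i * bspline (p + 1) n i y with hS
    have hcont : ContinuousOn S (Icc 0 x) := by
      refine continuousOn_finsetSum _ fun i _ => continuousOn_const.mul ?_
      exact (continuousOn_coxDeBoor hn p i).mono fun y hy => ⟨hy.1, hy.2.trans_lt hx.2⟩
    -- The derivative formula holds off the countable set of knots, which suffices for the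
    -- fundamental theorem of calculus because `S` is continuous.
    have hder : ∀ y ∈ Ioo 0 x \ range (knot (p + 1) n),
        HasDerivAt S (pf n p (dcoef p n c) y) y := by
      intro y hy
      have hy' : y ∈ Ico (0 : ℝ) 1 := ⟨hy.1.1.le, hy.1.2.trans hx.2⟩
      rw [← ih (dcoef p n c) hy']
      have h1 : ∀ i : Fin (n + (p + 1)), i ∈ Finset.univ → HasDerivAt
          (fun y => c i * bspline (p + 1) n i y) _ y := fun i _ =>
        (hasDerivAt_coxDeBoor (knot_mono (p + 1) n) p i hy.2).const_mul (c i)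
      have h2 := HasDerivAt.fun_sum h1
      refine h2.congr_deriv ?_
      set g : ℕ → ℝ := fun i => (p + 1) * (coxDeBoor (knot (p + 1) n) p i y /
        (knot (p + 1) n (i + p + 1) - knot (p + 1) n i))
      -- The first and the last function of degree p over the knots of degree p + 1 have coinciding
      -- end knots, so `g` is zero there and summation by parts has no boundary terms. The remaining
      -- ones are the B-splines of degree p with the index shifted by one.
      have hg0 : g 0 = 0 := by
        simp only [g, knot_of_le (show 0 + p + 1 ≤ p + 1 by omega),
          knot_of_le (Nat.zero_le (p + 1)), sub_self, div_zero, mul_zero]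
      have hg1 : g (n + p + 1) = 0 := by
        simp [g, knot_of_ge hn (show n + (p + 1) ≤ n + p + 1 + p + 1 by omega),
          knot_of_ge hn (show n + (p + 1) ≤ n + p + 1 by omega)]
      have h3 := sum_mul_sub_eq (m := n + p) c hg0 hg1
      refine Eq.trans (Finset.sum_congr rfl fun i _ => ?_) (h3.trans
        (Finset.sum_congr rfl fun j _ => ?_))
      · simp only [g, show (i : ℕ) + 1 + p + 1 = i + p + 2 by omega]
        ring
      · simp only [g, knot_shift, show (j : ℕ) + 1 + p = j + p + 1 by omega,
          coxDeBoor_knot_shift, dcoef, LinearMap.coe_mk, AddHom.coe_mk, wt, bspline]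
        ring
    have := integral_eq_of_hasDerivAt_off_countable_of_le S _ hx.1 (countable_range _) hcont hder
      ((memL2_pf _ _ _).intervalIntegrable' (by simp) (Ico_subset_Icc_self hx))
    have h0 : S 0 = c (0 : Fin (n + p + 1)) := by
      simp only [hS, bspline, coxDeBoor_at_zero hn (le_refl (p + 1))]
      refine (Finset.sum_eq_single (0 : Fin (n + p + 1)) (fun i _ hi => ?_) (by simp)).trans ?_
      · have : (i : ℕ) ≠ 0 := fun h => hi (Fin.ext h)
        simp [this]
      · simp
    rw [pf, Pi.add_apply, prim, this, h0]
    ring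

theorem bspline_eq_pf {n : ℕ} (hn : 0 < n) (p : ℕ) (i : Fin (n + p)) {x : ℝ}
    (hx : x ∈ Ico (0 : ℝ) 1) : bspline p n i x = pf n p (Pi.single i 1) x := by
  rw [← sum_bspline_eq_pf hn p _ hx]
  simp [Pi.single_apply]

theorem continuousOn_pf_succ (n p : ℕ) (c : Fin (n + (p + 1)) → ℝ) :
    ContinuousOn (pf n (p + 1) c) (Icc 0 1) :=
  continuousOn_const.add (continuousOn_prim (memL2_pf _ _ _))

/-- The iterated primitive is continuous up to 1, where the B-spline expansion is not valid; its
value there is the left limit of the expansion, to which only the last B-spline contributes. -/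
theorem pf_succ_one {n : ℕ} (hn : 0 < n) (p : ℕ) (c : Fin (n + (p + 1)) → ℝ) :
    pf n (p + 1) c 1 = c (Fin.last (n + p)) := by
  have h1 : Filter.Tendsto (pf n (p + 1) c) (nhdsWithin 1 (Iio 1)) (nhds (pf n (p + 1) c 1)) := by
    have := continuousOn_pf_succ n p c 1 (by simp)
    refine this.mono_left ?_
    rw [← nhdsWithin_Ioo_eq_nhdsLT (zero_lt_one' ℝ)]
    exact nhdsWithin_mono _ Ioo_subset_Icc_self
  have h2 : Filter.Tendsto (fun x => ∑ i, c i * bspline (p + 1) n i x) (nhdsWithin 1 (Iio 1))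
      (nhds (∑ i, c i * if (i : ℕ) + 1 = n + (p + 1) then 1 else 0)) :=
    tendsto_finsetSum _ fun i _ => (tendsto_coxDeBoor_one hn (p + 1) i).const_mul (c i)
  have h3 : (fun x => ∑ i, c i * bspline (p + 1) n i x) =ᶠ[nhdsWithin 1 (Iio 1)]
      pf n (p + 1) c := by
    filter_upwards [Ioo_mem_nhdsLT (zero_lt_one' ℝ)] with x hx
    exact sum_bspline_eq_pf hn _ c ⟨hx.1.le, hx.2⟩
  rw [tendsto_nhds_unique h1 (h2.congr' h3)]
  refine (Finset.sum_eq_single (Fin.last (n + p)) (fun i _ hi => ?_) (by simp)).trans ?_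
  · have : ¬ (i : ℕ) + 1 = n + (p + 1) := fun h => hi (Fin.ext (by simp; omega))
    simp [this]
  · simp [add_assoc]

theorem ae_deriv_bspline {n : ℕ} (hn : 0 < n) (p : ℕ) (i : Fin (n + (p + 1))) :
    ∀ᵐ x, x ∈ Ioo (0 : ℝ) 1 →
      deriv (bspline (p + 1) n i) x = pf n p (dcoef p n (Pi.single i 1)) x := by
  filter_upwards [ae_hasDerivAt_prim (memL2_pf n p (dcoef p n (Pi.single i 1)))] with x hx h
  have h1 := (hx (Ioo_subset_Icc_self h)).const_add
    ((Pi.single i 1 : Fin (n + (p + 1)) → ℝ) (0 : Fin (n + p + 1)))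
  refine (h1.congr_of_eventuallyEq ?_).deriv
  filter_upwards [isOpen_Ioo.mem_nhds h] with y hy
  exact bspline_eq_pf hn _ i (Ioo_subset_Ico_self hy)

/-! ### Linear independence, refinement and inner B-splines -/

theorem eq_zero_of_dcoef_eq_zero {n p : ℕ} (hn : 0 < n) {c : Fin (n + (p + 1)) → ℝ}
    (h : dcoef p n c = 0) (h0 : c (0 : Fin (n + p + 1)) = 0) : c = 0 := by
  funext i
  refine Fin.induction (n := n + p) (motive := fun i => c i = 0) h0 (fun j hj => ?_) i
  have h1 : wt p n j * (c (Fin.succ j) - c (Fin.castSucc j)) = 0 := congrFun h j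
  have h2 := (mul_eq_zero.1 h1).resolve_left (wt_pos hn j.2).ne'
  linarith

theorem eq_zero_of_pf_eq_zero {n : ℕ} (hn : 0 < n) {p : ℕ} {c : Fin (n + p) → ℝ}
    (h : ∀ᵐ x, x ∈ Ioo (0 : ℝ) 1 → pf n p c x = 0) : c = 0 := by
  have hn' : (0 : ℝ) < n := by exact_mod_cast hn
  induction p with
  | zero =>
    funext i
    have hlt : ((i : ℕ) : ℝ) / n < (((i : ℕ) + 1 : ℕ) : ℝ) / n := by
      apply div_lt_div_of_pos_right _ hn'
      exact_mod_cast Nat.lt_succ_self _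
    obtain ⟨x, hx, hxi⟩ : ∃ x, (x ∈ Ioo (0 : ℝ) 1 → pf n 0 c x = 0) ∧
        x ∈ Ioo (((i : ℕ) : ℝ) / n) ((((i : ℕ) + 1 : ℕ) : ℝ) / n) := by
      by_contra hne
      push Not at hne
      have : volume (Ioo (((i : ℕ) : ℝ) / n) ((((i : ℕ) + 1 : ℕ) : ℝ) / n)) = 0 := by
        refine measure_mono_null (fun x hx => ?_) h
        exact fun hc => hne x hc hx
      rw [Real.volume_Ioo, ENNReal.ofReal_eq_zero] at this
      linarith
    have hx1 : x ∈ Ioo (0 : ℝ) 1 := by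
      refine ⟨lt_of_le_of_lt (by positivity) hxi.1, hxi.2.trans_le ?_⟩
      rw [div_le_one hn']
      exact_mod_cast i.2
    rw [← stepFn_eq c i (Ioo_subset_Ico_self hxi)]
    exact hx hx1
  | succ p ih =>
    have hcont := continuousOn_pf_succ n p c
    have h1 : EqOn (pf n (p + 1) c) (fun _ => 0) (Ioo 0 1) := by
      refine Measure.eqOn_open_of_ae_eq (μ := volume) ?_ isOpen_Ioo (hcont.mono Ioo_subset_Icc_self)
        continuousOn_const
      exact (ae_restrict_iff' measurableSet_Ioo).2 h
    have h2 : dcoef p n c = 0 := by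
      refine ih ?_
      filter_upwards [ae_hasDerivAt_prim (memL2_pf n p (dcoef p n c))] with x hx hx1
      have h3 := (hx (Ioo_subset_Icc_self hx1)).const_add (c (0 : Fin (n + p + 1)))
      refine (h3.congr_of_eventuallyEq (f₁ := fun _ => 0) ?_).unique (hasDerivAt_const x 0)
      filter_upwards [isOpen_Ioo.mem_nhds hx1] with y hy
      exact (h1 hy).symm
    refine eq_zero_of_dcoef_eq_zero hn h2 ?_
    have h4 := h1 (show (1 / 2 : ℝ) ∈ Ioo 0 1 by norm_num)
    have h5 : pf n p (0 : Fin (n + p) → ℝ) = fun _ => 0 := by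
      have := pf_smul (n := n) (p := p) 0 0
      rwa [zero_smul, zero_smul] at this
    simpa [pf, h2, h5, prim] using h4

/-- Refinement: splines on a grid are splines on the bisected grid. -/
theorem exists_pf_refine {n : ℕ} (hn : 0 < n) (p : ℕ) (c : Fin (n + p) → ℝ) :
    ∃ d : Fin (n * 2 + p) → ℝ, ∀ x ∈ Ico (0 : ℝ) 1, pf n p c x = pf (n * 2) p d x := by
  have hn' : (0 : ℝ) < n := by exact_mod_cast hn
  induction p with
  | zero =>
    -- Fine cell `j` lies in coarse cell `j / 2`. Higher degrees follow by integrating, so no knot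
    -- insertion formula is needed.
    refine ⟨fun j => c ⟨j / 2, by have := j.2; omega⟩, fun x hx => ?_⟩
    obtain ⟨j, hj⟩ := exists_cell (n := n * 2) (by omega) hx
    have h1 : j / 2 < n := by have := j.2; omega
    have h2 : x ∈ Ico (((j / 2 : ℕ) : ℝ) / n) (((j / 2 : ℕ) + 1 : ℕ) / n) := by
      have e1 : (2 * (j / 2 : ℕ) : ℝ) ≤ j := by exact_mod_cast Nat.mul_div_le j 2
      have e2 : (j : ℝ) + 1 ≤ 2 * ((j / 2 : ℕ) + 1) := by
        exact_mod_cast (by omega : (j : ℕ) + 1 ≤ 2 * (j / 2 + 1))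
      refine ⟨le_trans ?_ hj.1, hj.2.trans_le ?_⟩
      · push_cast
        rw [div_le_div_iff₀ hn' (by positivity)]
        nlinarith
      · push_cast
        rw [div_le_div_iff₀ (by positivity) hn']
        nlinarith
    rw [pf, pf, stepFn_eq _ j hj]
    exact stepFn_eq c ⟨j / 2, h1⟩ h2
  | succ p ih =>
    obtain ⟨d, hd⟩ := ih (dcoef p n c)
    obtain ⟨e, he0, he⟩ := exists_dcoef_eq (n := n * 2) (p := p) (by omega)
      (c (0 : Fin (n + p + 1))) d
    refine ⟨e, fun x hx => ?_⟩
    simp only [pf, Pi.add_apply, he, he0, prim]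
    congr 1
    refine intervalIntegral.integral_congr fun t ht => ?_
    rw [uIcc_of_le hx.1] at ht
    exact hd t ⟨ht.1, ht.2.trans_lt hx.2⟩

/-- An inner B-spline vanishes at both ends together with its derivatives of order less than p, so
it satisfies both sets of boundary conditions. The induction works because the derivative of inner
B-spline i of degree p + 1 combines those of index i - 1 and i of degree p, which are inner again.
-/
theorem single_mem_symSplines {n : ℕ} (hn : 0 < n) (p : ℕ) (i : Fin (n + p)) (h1 : p ≤ i)
    (h2 : (i : ℕ) < n) :
    (Pi.single i 1 : Fin (n + p) → ℝ) ∈ oddSplines n p ∧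
      (Pi.single i 1 : Fin (n + p) → ℝ) ∈ evenSplines n p := by
  induction p with
  | zero => exact ⟨trivial, trivial⟩
  | succ p ih =>
    have hlt : (i : ℕ) - 1 < n + p := by omega
    have hlt' : (i : ℕ) < n + p := by omega
    have hd : dcoef p n (Pi.single i 1) =
        wt p n (i - 1) • (Pi.single ⟨i - 1, hlt⟩ 1 : Fin (n + p) → ℝ)
          - wt p n i • (Pi.single ⟨i, hlt'⟩ 1 : Fin (n + p) → ℝ) := by
      funext j
      have e1 : (Fin.succ j : Fin (n + p + 1)) = i ↔ j = ⟨i - 1, hlt⟩ := by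
        rw [Fin.ext_iff, Fin.ext_iff]; simp only [Fin.val_succ]; omega
      have e2 : (Fin.castSucc j : Fin (n + p + 1)) = i ↔ j = ⟨i, hlt'⟩ := by
        rw [Fin.ext_iff, Fin.ext_iff]; simp
      have e3 : ∀ k : Fin (n + p + 1), (Pi.single i 1 : Fin (n + (p + 1)) → ℝ) k
          = if k = i then 1 else 0 := fun k => Pi.single_apply (M := ℝ) i 1 k
      simp only [dcoef, LinearMap.coe_mk, AddHom.coe_mk, e3, e1, e2, Pi.sub_apply, Pi.smul_apply,
        smul_eq_mul, Pi.single_apply]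
      split_ifs with a b b
      · rw [a] at b; simp only [Fin.mk.injEq] at b; omega
      · subst a; ring
      · subst b; ring
      · ring
    have i1 := ih ⟨i - 1, hlt⟩ (by simp only; omega) (by simp only; omega)
    have i2 := ih ⟨i, hlt'⟩ (by simp only; omega) (by simp only; omega)
    have hz : (Pi.single i 1 : Fin (n + (p + 1)) → ℝ) (0 : Fin (n + p + 1)) = 0 := by
      refine Pi.single_eq_of_ne ?_ _
      intro h
      have := congrArg Fin.val h
      simp at this
      omega
    have hl : (Pi.single i 1 : Fin (n + (p + 1)) → ℝ) (Fin.last (n + p)) = 0 := by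
      refine Pi.single_eq_of_ne ?_ _
      intro h
      have := congrArg Fin.val h
      simp at this
      omega
    rw [mem_oddSplines_succ, mem_evenSplines_succ, hd]
    refine ⟨Submodule.sub_mem _ (Submodule.smul_mem _ _ i1.2) (Submodule.smul_mem _ _ i2.2),
      Submodule.sub_mem _ (Submodule.smul_mem _ _ i1.1) (Submodule.smul_mem _ _ i2.1), hz, ?_⟩
    have := pf_succ_one hn p (Pi.single i 1)
    rw [hl, pf, Pi.add_apply, hz, zero_add, hd] at this
    exact this

/-! ### Positive definite matrices and orthogonal projectors -/

section Projector

variable {ι κ : Type*} [Fintype ι] [Fintype κ]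

theorem posSemidef_iff_real {A : Matrix ι ι ℝ} :
    A.PosSemidef ↔ Aᵀ = A ∧ ∀ x, 0 ≤ x ⬝ᵥ A *ᵥ x := by
  rw [Matrix.posSemidef_iff_dotProduct_mulVec]
  simp [Matrix.IsHermitian, Matrix.conjTranspose_eq_transpose_of_trivial]

theorem posDef_iff_real {A : Matrix ι ι ℝ} :
    A.PosDef ↔ Aᵀ = A ∧ ∀ x, x ≠ 0 → 0 < x ⬝ᵥ A *ᵥ x := by
  rw [Matrix.posDef_iff_dotProduct_mulVec]
  simp [Matrix.IsHermitian, Matrix.conjTranspose_eq_transpose_of_trivial]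

theorem dotProduct_mulVec_transpose (A : Matrix ι κ ℝ) (x : ι → ℝ) (y : κ → ℝ) :
    y ⬝ᵥ Aᵀ *ᵥ x = x ⬝ᵥ A *ᵥ y := by
  rw [Matrix.mulVec_transpose, dotProduct_comm, ← Matrix.dotProduct_mulVec]

theorem dotProduct_mulVec_symm {A : Matrix ι ι ℝ} (hA : Aᵀ = A) (x y : ι → ℝ) :
    x ⬝ᵥ A *ᵥ y = y ⬝ᵥ A *ᵥ x := by
  rw [← dotProduct_mulVec_transpose, hA]

theorem dotProduct_conj_mulVec (A : Matrix ι ι ℝ) (B : Matrix ι κ ℝ) (x y : κ → ℝ) :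
    x ⬝ᵥ (Bᵀ * A * B) *ᵥ y = (B *ᵥ x) ⬝ᵥ A *ᵥ (B *ᵥ y) := by
  rw [Matrix.mul_assoc, ← Matrix.mulVec_mulVec, dotProduct_mulVec_transpose, dotProduct_comm,
    ← Matrix.mulVec_mulVec]

theorem dotProduct_mulVec_add_self {A : Matrix ι ι ℝ} (hA : Aᵀ = A) (x y : ι → ℝ) :
    (x + y) ⬝ᵥ A *ᵥ (x + y) = x ⬝ᵥ A *ᵥ x + 2 * (x ⬝ᵥ A *ᵥ y) + y ⬝ᵥ A *ᵥ y := by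
  rw [Matrix.mulVec_add, add_dotProduct, dotProduct_add, dotProduct_add,
    dotProduct_mulVec_symm hA y x]
  ring

theorem dotProduct_mulVec_sub_self {A : Matrix ι ι ℝ} (hA : Aᵀ = A) (x y : ι → ℝ) :
    (x - y) ⬝ᵥ A *ᵥ (x - y) = x ⬝ᵥ A *ᵥ x - 2 * (x ⬝ᵥ A *ᵥ y) + y ⬝ᵥ A *ᵥ y := by
  rw [Matrix.mulVec_sub, sub_dotProduct, dotProduct_sub, dotProduct_sub,
    dotProduct_mulVec_symm hA y x]
  ring

/-- Cauchy-Schwarz inequality. -/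
theorem sq_dotProduct_mulVec_le {A : Matrix ι ι ℝ} (hA : A.PosSemidef) (x y : ι → ℝ) :
    (x ⬝ᵥ A *ᵥ y) ^ 2 ≤ (x ⬝ᵥ A *ᵥ x) * (y ⬝ᵥ A *ᵥ y) := by
  obtain ⟨hs, h⟩ := posSemidef_iff_real.1 hA
  have key : ∀ t : ℝ, 0 ≤ (y ⬝ᵥ A *ᵥ y) * (t * t) + (2 * (x ⬝ᵥ A *ᵥ y)) * t
      + x ⬝ᵥ A *ᵥ x := by
    intro t
    have h0 := h (x + t • y)
    rw [dotProduct_mulVec_add_self hs, Matrix.mulVec_smul, dotProduct_smul, dotProduct_smul,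
      smul_dotProduct, smul_eq_mul, smul_eq_mul, smul_eq_mul] at h0
    linarith
  have := discrim_le_zero key
  rw [discrim] at this
  nlinarith

/-- Meant for the odd splines, which are given by conditions and not by a basis, so that
`orthProjector` does not apply. Definiteness makes u ↦ (A u, ·) injective from `V` to its dual,
hence bijective by dimension. -/
theorem exists_projection_of_posDef {A : Matrix ι ι ℝ} (hA : A.PosDef)
    (V : Submodule ℝ (ι → ℝ)) (x : ι → ℝ) :
    ∃ u ∈ V, ∀ v ∈ V, v ⬝ᵥ A *ᵥ (x - u) = 0 := by
  classical
  let b : (ι → ℝ) →ₗ[ℝ] Module.Dual ℝ V :=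
    LinearMap.mk₂ ℝ (fun (u : ι → ℝ) (v : V) => (v : ι → ℝ) ⬝ᵥ A *ᵥ u)
      (fun u u' v => by rw [Matrix.mulVec_add, dotProduct_add])
      (fun c u v => by rw [Matrix.mulVec_smul, dotProduct_smul])
      (fun u v v' => by rw [Submodule.coe_add, add_dotProduct])
      (fun c u v => by rw [Submodule.coe_smul, smul_dotProduct])
  have hinj : Function.Injective (b ∘ₗ V.subtype) := by
    rw [← LinearMap.ker_eq_bot, LinearMap.ker_eq_bot']
    intro u hu
    have h1 : (u : ι → ℝ) ⬝ᵥ A *ᵥ (u : ι → ℝ) = 0 := LinearMap.congr_fun hu u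
    by_contra hne
    have := (posDef_iff_real.1 hA).2 u (by simpa using hne)
    linarith
  have hsurj := (LinearMap.injective_iff_surjective_of_finrank_eq_finrank
    (Subspace.dual_finrank_eq (K := ℝ) (V := V)).symm).1 hinj
  obtain ⟨u, hu⟩ := hsurj (b x)
  refine ⟨u, u.2, fun v hv => ?_⟩
  have h1 : v ⬝ᵥ A *ᵥ (u : ι → ℝ) = v ⬝ᵥ A *ᵥ x := LinearMap.congr_fun hu ⟨v, hv⟩
  rw [Matrix.mulVec_sub, dotProduct_sub, h1, sub_self]

theorem posDef_conj {A : Matrix ι ι ℝ} (hA : A.PosDef) {E : Matrix ι κ ℝ}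
    (hE : Function.Injective E.mulVec) : (Eᵀ * A * E).PosDef := by
  simpa [Matrix.conjTranspose_eq_transpose_of_trivial] using hA.conjTranspose_mul_mul_same hE

variable {A : Matrix ι ι ℝ} {E : Matrix ι κ ℝ}

theorem transpose_mul_orthProjector [DecidableEq κ] (hA : A.PosDef)
    (hE : Function.Injective E.mulVec) :
    Eᵀ * A * orthProjector A E = Eᵀ * A := by
  have h := (posDef_conj hA hE).isUnit
  rw [Matrix.isUnit_iff_isUnit_det] at h
  rw [orthProjector, ← Matrix.mul_assoc, ← Matrix.mul_assoc, ← Matrix.mul_assoc,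
    Matrix.mul_nonsing_inv _ h, Matrix.one_mul]

theorem orthProjector_galerkin [DecidableEq ι] [DecidableEq κ] (hA : A.PosDef)
    (hE : Function.Injective E.mulVec) :
    Eᵀ * A * (1 - orthProjector A E) = 0 := by
  rw [Matrix.mul_sub, Matrix.mul_one, transpose_mul_orthProjector hA hE, sub_self]

theorem dotProduct_mulVec_of_galerkin {w : ι → ℝ} (hw : (Eᵀ * A) *ᵥ w = 0) (z : κ → ℝ) :
    (E *ᵥ z) ⬝ᵥ A *ᵥ w = 0 := by
  rw [← Matrix.mulVec_mulVec] at hw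
  rw [dotProduct_comm, ← dotProduct_mulVec_transpose, hw, dotProduct_zero]

theorem orthProjector_mulVec [DecidableEq κ] (x : ι → ℝ) :
    orthProjector A E *ᵥ x = E *ᵥ (((Eᵀ * A * E)⁻¹ * Eᵀ * A) *ᵥ x) := by
  simp only [orthProjector, Matrix.mulVec_mulVec, Matrix.mul_assoc]

theorem dotProduct_complement_eq_zero [DecidableEq ι] [DecidableEq κ] (hA : A.PosDef)
    (hE : Function.Injective E.mulVec) (z : κ → ℝ) (x : ι → ℝ) :
    (E *ᵥ z) ⬝ᵥ A *ᵥ ((1 - orthProjector A E) *ᵥ x) = 0 := by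
  refine dotProduct_mulVec_of_galerkin ?_ z
  rw [Matrix.mulVec_mulVec, orthProjector_galerkin hA hE, Matrix.zero_mulVec]

/-- Pythagoras' theorem for the orthogonal projector. -/
theorem orthProjector_pythagoras [DecidableEq ι] [DecidableEq κ] (hA : A.PosDef)
    (hE : Function.Injective E.mulVec) (x : ι → ℝ) :
    x ⬝ᵥ A *ᵥ x = (orthProjector A E *ᵥ x) ⬝ᵥ A *ᵥ (orthProjector A E *ᵥ x)
      + ((1 - orthProjector A E) *ᵥ x) ⬝ᵥ A *ᵥ ((1 - orthProjector A E) *ᵥ x) := by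
  have h := dotProduct_complement_eq_zero hA hE (((Eᵀ * A * E)⁻¹ * Eᵀ * A) *ᵥ x) x
  rw [← orthProjector_mulVec] at h
  have h2 : x = orthProjector A E *ᵥ x + (1 - orthProjector A E) *ᵥ x := by
    rw [← Matrix.add_mulVec, add_sub_cancel, Matrix.one_mulVec]
  conv_lhs => rw [h2]
  rw [dotProduct_mulVec_add_self (posDef_iff_real.1 hA).1, h]
  ring

theorem posSemidef_conj {B : Matrix ι ι ℝ} (hA : A.PosSemidef) : (Bᵀ * A * B).PosSemidef := by
  simpa [Matrix.conjTranspose_eq_transpose_of_trivial] using hA.conjTranspose_mul_mul_same B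

theorem transpose_conj {B : Matrix ι ι ℝ} (hs : Aᵀ = A) : (Bᵀ * A * B)ᵀ = Bᵀ * A * B := by
  simp only [Matrix.transpose_mul, Matrix.transpose_transpose, hs, Matrix.mul_assoc]

/-- By Pythagoras the complement of an orthogonal projector does not increase the `A`-norm. Applied
to the inner projector this is C ≤ A. -/
theorem posSemidef_sub_conj_complement [DecidableEq ι] [DecidableEq κ] (hA : A.PosDef)
    (hE : Function.Injective E.mulVec) :
    (A - (1 - orthProjector A E)ᵀ * A * (1 - orthProjector A E)).PosSemidef := by
  have hs := (posDef_iff_real.1 hA).1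
  refine posSemidef_iff_real.2 ⟨by rw [Matrix.transpose_sub, transpose_conj hs, hs], fun x => ?_⟩
  rw [Matrix.sub_mulVec, dotProduct_sub, dotProduct_conj_mulVec, orthProjector_pythagoras hA hE x,
    add_sub_cancel_right]
  exact (posSemidef_iff_real.1 hA.posSemidef).2 _

end Projector

/-! ### One-dimensional matrices -/

theorem ip_pf_congr_left {n p : ℕ} {c d : Fin (n + p) → ℝ} {f g : ℝ → ℝ}
    (h : ∀ x ∈ Icc (0 : ℝ) 1, pf n p c x = f x + pf n p d x) :
    ip (pf n p c) g = ip (f + pf n p d) g :=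
  ip_congr_ae (Filter.Eventually.of_forall fun x hx => h x (Ioo_subset_Icc_self hx)) (by simp)

/-- The `L²` scalar product in terms of B-spline coefficients. -/
def massForm (n p : ℕ) : (Fin (n + p) → ℝ) →ₗ[ℝ] (Fin (n + p) → ℝ) →ₗ[ℝ] ℝ :=
  LinearMap.mk₂ ℝ (fun c d => ip (pf n p c) (pf n p d))
    (fun c c' d => by
      rw [ip_pf_congr_left fun x hx => pf_add c c' hx,
        ip_add_left (memL2_pf _ _ _) (memL2_pf _ _ _) (memL2_pf _ _ _)])
    (fun a c d => by simp [pf_smul, ip, mul_assoc])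
    (fun d c c' => by
      rw [ip_comm, ip_pf_congr_left fun x hx => pf_add c c' hx,
        ip_add_left (memL2_pf _ _ _) (memL2_pf _ _ _) (memL2_pf _ _ _), ip_comm,
        ip_comm _ (pf n p d)])
    (fun a c d => by simp [pf_smul, ip, mul_left_comm])

theorem massForm_apply {n p : ℕ} (c d : Fin (n + p) → ℝ) :
    massForm n p c d = ip (pf n p c) (pf n p d) := rfl

/-- The Gram matrix of `(u', v')`. -/
def gradMatrix (p n : ℕ) : Matrix (Fin (n + (p + 1))) (Fin (n + (p + 1))) ℝ :=
  LinearMap.toMatrix₂' ℝ ((massForm n p).compl₁₂ (dcoef p n) (dcoef p n))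

theorem dotProduct_toMatrix_mulVec {ι : Type*} [Fintype ι] [DecidableEq ι]
    (B : (ι → ℝ) →ₗ[ℝ] (ι → ℝ) →ₗ[ℝ] ℝ) (x y : ι → ℝ) :
    x ⬝ᵥ (LinearMap.toMatrix₂' ℝ B) *ᵥ y = B x y := by
  rw [← Matrix.toLinearMap₂'_apply', Matrix.toLinearMap₂'_toMatrix']

theorem setIntegral_Ioo_eq (f : ℝ → ℝ) :
    ∫ x in Ioo (0 : ℝ) 1, f x = ∫ x in (0 : ℝ)..1, f x := by
  rw [intervalIntegral.integral_of_le zero_le_one, integral_Ioc_eq_integral_Ioo]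

theorem massMatrix_eq {n : ℕ} (hn : 0 < n) (p : ℕ) :
    massMatrix p n = LinearMap.toMatrix₂' ℝ (massForm n p) := by
  ext i j
  rw [LinearMap.toMatrix₂'_apply, massForm_apply, massMatrix, Matrix.of_apply, setIntegral_Ioo_eq]
  exact ip_congr_ae
    (Filter.Eventually.of_forall fun x hx => bspline_eq_pf hn p i (Ioo_subset_Ico_self hx))
    (Filter.Eventually.of_forall fun x hx => bspline_eq_pf hn p j (Ioo_subset_Ico_self hx))

theorem stiffnessMatrix_eq {n : ℕ} (hn : 0 < n) (p : ℕ) :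
    stiffnessMatrix (p + 1) n = gradMatrix p n + massMatrix (p + 1) n := by
  rw [massMatrix_eq hn]
  ext i j
  rw [gradMatrix, Matrix.add_apply, LinearMap.toMatrix₂'_apply, LinearMap.toMatrix₂'_apply,
    LinearMap.compl₁₂_apply, massForm_apply, massForm_apply, ip, ip,
    ← intervalIntegral.integral_add ((memL2_pf _ _ _).mul (memL2_pf _ _ _))
      ((memL2_pf _ _ _).mul (memL2_pf _ _ _)), ← setIntegral_Ioo_eq, stiffnessMatrix,
    Matrix.of_apply]
  refine setIntegral_congr_ae measurableSet_Ioo ?_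
  filter_upwards [ae_deriv_bspline hn p i, ae_deriv_bspline hn p j] with x h1 h2 hx
  rw [h1 hx, h2 hx, bspline_eq_pf hn _ i (Ioo_subset_Ico_self hx),
    bspline_eq_pf hn _ j (Ioo_subset_Ico_self hx)]

theorem dotProduct_massMatrix {n : ℕ} (hn : 0 < n) {p : ℕ} (x y : Fin (n + p) → ℝ) :
    x ⬝ᵥ massMatrix p n *ᵥ y = ip (pf n p x) (pf n p y) := by
  rw [massMatrix_eq hn, dotProduct_toMatrix_mulVec, massForm_apply]

theorem dotProduct_gradMatrix {n p : ℕ} (x y : Fin (n + (p + 1)) → ℝ) :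
    x ⬝ᵥ gradMatrix p n *ᵥ y = ip (pf n p (dcoef p n x)) (pf n p (dcoef p n y)) := by
  rw [gradMatrix, dotProduct_toMatrix_mulVec, LinearMap.compl₁₂_apply, massForm_apply]

theorem dotProduct_stiffnessMatrix {n : ℕ} (hn : 0 < n) {p : ℕ} (x y : Fin (n + (p + 1)) → ℝ) :
    x ⬝ᵥ stiffnessMatrix (p + 1) n *ᵥ y = ip (pf n p (dcoef p n x)) (pf n p (dcoef p n y))
      + ip (pf n (p + 1) x) (pf n (p + 1) y) := by
  rw [stiffnessMatrix_eq hn, Matrix.add_mulVec, dotProduct_add, dotProduct_massMatrix hn,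
    dotProduct_gradMatrix]

theorem posDef_massMatrix {n : ℕ} (hn : 0 < n) (p : ℕ) : (massMatrix p n).PosDef := by
  refine posDef_iff_real.2 ⟨?_, fun x hx => ?_⟩
  · ext i j
    simp only [massMatrix, Matrix.transpose_apply, Matrix.of_apply, mul_comm]
  · rw [dotProduct_massMatrix hn]
    refine lt_of_le_of_ne (ip_self_nonneg _) fun h => hx (eq_zero_of_pf_eq_zero hn ?_)
    have hm := memL2_pf n p x
    rw [ip, intervalIntegral.integral_of_le zero_le_one, integral_Ioc_eq_integral_Ioo, eq_comm,
      integral_eq_zero_iff_of_nonneg (fun y => mul_self_nonneg _)] at h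
    · filter_upwards [(ae_restrict_iff' measurableSet_Ioo).1 h] with y hy h'
      exact mul_self_eq_zero.1 (hy h')
    · have := hm.mul hm
      rw [intervalIntegrable_iff_integrableOn_Ioo_of_le zero_le_one] at this
      exact this

theorem posSemidef_gradMatrix (n p : ℕ) : (gradMatrix p n).PosSemidef := by
  refine posSemidef_iff_real.2 ⟨?_, fun x => ?_⟩
  · ext i j
    rw [Matrix.transpose_apply, gradMatrix, LinearMap.toMatrix₂'_apply,
      LinearMap.toMatrix₂'_apply, LinearMap.compl₁₂_apply, LinearMap.compl₁₂_apply,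
      massForm_apply, massForm_apply, ip_comm]
  · rw [dotProduct_gradMatrix]
    exact ip_self_nonneg _

theorem posDef_stiffnessMatrix {n : ℕ} (hn : 0 < n) (p : ℕ) :
    (stiffnessMatrix (p + 1) n).PosDef := by
  rw [stiffnessMatrix_eq hn]
  exact Matrix.PosDef.posSemidef_add (posSemidef_gradMatrix n p) (posDef_massMatrix hn _)

/-! ### The boundary correction -/

theorem innerInclusion_mulVec_apply {p n : ℕ} (z : InnerIdx p n → ℝ) (j : InnerIdx p n) :
    (innerInclusion p n *ᵥ z) j.1 = z j := by
  simp only [Matrix.mulVec, dotProduct, innerInclusion, Matrix.of_apply, ite_mul, one_mul, zero_mul]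
  rw [Finset.sum_eq_single j]
  · simp
  · intro k _ hk
    rw [if_neg fun h => hk (Subtype.ext h.symm)]
  · simp

theorem innerInclusion_injective (p n : ℕ) : Function.Injective (innerInclusion p n).mulVec := by
  intro z z' h
  ext j
  rw [← innerInclusion_mulVec_apply z, ← innerInclusion_mulVec_apply z', h]

theorem innerInclusion_mulVec_mem {p n : ℕ} (hn : 0 < n) (z : InnerIdx p n → ℝ) :
    innerInclusion p n *ᵥ z ∈ oddSplines n p := by
  have : innerInclusion p n *ᵥ z = ∑ j, z j • (Pi.single j.1 1 : Fin (n + p) → ℝ) := by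
    ext i
    simp only [Matrix.mulVec, dotProduct, innerInclusion, Matrix.of_apply, Finset.sum_apply,
      Pi.smul_apply, Pi.single_apply, smul_eq_mul, mul_comm]
  rw [this]
  exact Submodule.sum_mem _ fun j _ => Submodule.smul_mem _ _
    (single_mem_symSplines hn p j.1 j.2.1 j.2.2).1

theorem posSemidef_boundaryCorrection {n : ℕ} (hn : 0 < n) (p : ℕ) :
    (boundaryCorrection (p + 1) n).PosSemidef :=
  posSemidef_conj (posDef_stiffnessMatrix hn p).posSemidef

theorem boundaryCorrection_le {n : ℕ} (hn : 0 < n) (p : ℕ) :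
    (stiffnessMatrix (p + 1) n - boundaryCorrection (p + 1) n).PosSemidef :=
  posSemidef_sub_conj_complement (posDef_stiffnessMatrix hn p) (innerInclusion_injective _ _)

/-- The one-dimensional smoothing property: the stiffness matrix is bounded by the smoother
matrix, uniformly in the degree and the grid size. -/
theorem stiffnessMatrix_le {n : ℕ} (hn : 0 < n) (p : ℕ) (x : Fin (n + (p + 1)) → ℝ) :
    x ⬝ᵥ stiffnessMatrix (p + 1) n *ᵥ x ≤ 53 * ((n : ℝ) ^ 2 * (x ⬝ᵥ massMatrix (p + 1) n *ᵥ x)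
      + x ⬝ᵥ boundaryCorrection (p + 1) n *ᵥ x) := by
  have hA := posDef_stiffnessMatrix hn p
  obtain ⟨hs, hpos⟩ := posSemidef_iff_real.1 hA.posSemidef
  have hM := (posDef_massMatrix hn (p + 1)).posSemidef
  obtain ⟨hMs, hMpos⟩ := posSemidef_iff_real.1 hM
  obtain ⟨u, hu, hx⟩ := exists_projection_of_posDef hA (oddSplines n (p + 1)) x
  set e := x - u with he
  have hxe : x = u + e := by rw [he]; abel
  have hn1 : (1 : ℝ) ≤ (n : ℝ) ^ 2 := one_le_pow₀ (by exact_mod_cast hn)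
  have hpyth : x ⬝ᵥ stiffnessMatrix (p + 1) n *ᵥ x = u ⬝ᵥ stiffnessMatrix (p + 1) n *ᵥ u
      + e ⬝ᵥ stiffnessMatrix (p + 1) n *ᵥ e := by
    conv_lhs => rw [hxe]
    rw [dotProduct_mulVec_add_self hs, hx u hu]
    ring
  have hC : e ⬝ᵥ stiffnessMatrix (p + 1) n *ᵥ e ≤ x ⬝ᵥ boundaryCorrection (p + 1) n *ᵥ x := by
    rw [boundaryCorrection, dotProduct_conj_mulVec, innerProjector, Matrix.sub_mulVec,
      Matrix.one_mulVec, orthProjector_mulVec]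
    -- Of the inner projection only its membership in the odd splines matters: `u` is the best
    -- approximation there, so `e` has at most the energy of `x - v`, which is the quadratic form of
    -- C.
    set v := innerInclusion (p + 1) n *ᵥ _ with hv
    have hvm : v ∈ oddSplines n (p + 1) := innerInclusion_mulVec_mem hn _
    have h1 : x - v = (u - v) + e := by rw [hxe]; abel
    rw [h1, dotProduct_mulVec_add_self hs, hx _ (Submodule.sub_mem _ hu hvm)]
    linarith [hpos (u - v)]
  have hAN : (n : ℝ) ^ 2 * (e ⬝ᵥ massMatrix (p + 1) n *ᵥ e)
      ≤ 2 * (e ⬝ᵥ stiffnessMatrix (p + 1) n *ᵥ e) := by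
    rw [dotProduct_massMatrix hn, dotProduct_stiffnessMatrix hn]
    refine aubin_nitsche hn p (memL2_pf n p (dcoef p n e)) rfl fun c hc => ?_
    have := hx c hc
    rw [dotProduct_stiffnessMatrix hn] at this
    rw [ip_comm, ip_comm (pf n (p + 1) e)]
    exact this
  have hinv : u ⬝ᵥ stiffnessMatrix (p + 1) n *ᵥ u
      ≤ (12 * (n : ℝ) ^ 2 + 1) * (u ⬝ᵥ massMatrix (p + 1) n *ᵥ u) := by
    rw [dotProduct_massMatrix hn, dotProduct_stiffnessMatrix hn]
    linarith [inverse_inequality hn p hu]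
  have htri : u ⬝ᵥ massMatrix (p + 1) n *ᵥ u ≤ 2 * (x ⬝ᵥ massMatrix (p + 1) n *ᵥ x
      + e ⬝ᵥ massMatrix (p + 1) n *ᵥ e) := by
    have h1 := hMpos (x + e)
    have h2 : u = x - e := by rw [hxe]; abel
    rw [dotProduct_mulVec_add_self hMs] at h1
    rw [h2, dotProduct_mulVec_sub_self hMs]
    linarith
  have hue : u ⬝ᵥ stiffnessMatrix (p + 1) n *ᵥ u ≤ 13 * (n : ℝ) ^ 2 *
      (2 * (x ⬝ᵥ massMatrix (p + 1) n *ᵥ x + e ⬝ᵥ massMatrix (p + 1) n *ᵥ e)) := by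
    refine hinv.trans ?_
    have := hMpos u
    calc (12 * (n : ℝ) ^ 2 + 1) * (u ⬝ᵥ massMatrix (p + 1) n *ᵥ u)
        ≤ (13 * (n : ℝ) ^ 2) * (u ⬝ᵥ massMatrix (p + 1) n *ᵥ u) := by
          apply mul_le_mul_of_nonneg_right _ this; linarith
      _ ≤ _ := by gcongr
  -- The part `u` contributes 26 n² M(x) + 26 n² M(e), where n² M(e) ≤ 2 A(e) ≤ 2 C(x), and `e`
  -- contributes C(x): in all 26 n² M(x) + 53 C(x).
  have hxM : 0 ≤ (n : ℝ) ^ 2 * (x ⬝ᵥ massMatrix (p + 1) n *ᵥ x) :=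
    mul_nonneg (by positivity) (hMpos x)
  linarith

/-! ### Refinement of the grid -/

/-- The one-dimensional prolongation: `P` represents the embedding of the splines over `n`
intervals into those over `2 n` intervals. -/
def IsProlongation (p n : ℕ) (P : Matrix (Fin (n * 2 + p)) (Fin (n + p)) ℝ) : Prop :=
  ∀ c, ∀ x ∈ Ico (0 : ℝ) 1, pf n p c x = pf (n * 2) p (P *ᵥ c) x

theorem exists_isProlongation {n : ℕ} (hn : 0 < n) (p : ℕ) : ∃ P, IsProlongation p n P := by
  choose d hd using fun j : Fin (n + p) => exists_pf_refine hn p (Pi.single j 1)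
  refine ⟨Matrix.of fun i j => d j i, fun c x hx => ?_⟩
  rw [← sum_bspline_eq_pf hn p c hx, ← sum_bspline_eq_pf (by omega : 0 < n * 2) p _ hx]
  simp only [Matrix.mulVec, dotProduct, Matrix.of_apply, Finset.sum_mul]
  rw [Finset.sum_comm]
  refine Finset.sum_congr rfl fun j _ => ?_
  rw [bspline_eq_pf hn p j hx, hd j x hx, ← sum_bspline_eq_pf (by omega : 0 < n * 2) p _ hx,
    Finset.mul_sum]
  exact Finset.sum_congr rfl fun i _ => by ring

theorem IsProlongation.ae_deriv {n p : ℕ} {P : Matrix (Fin (n * 2 + (p + 1))) (Fin (n + (p + 1))) ℝ}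
    (hP : IsProlongation (p + 1) n P) (c : Fin (n + (p + 1)) → ℝ) :
    ∀ᵐ x, x ∈ Ioo (0 : ℝ) 1 →
      pf n p (dcoef p n c) x = pf (n * 2) p (dcoef p (n * 2) (P *ᵥ c)) x := by
  filter_upwards [ae_hasDerivAt_prim (memL2_pf n p (dcoef p n c)),
    ae_hasDerivAt_prim (memL2_pf (n * 2) p (dcoef p (n * 2) (P *ᵥ c)))] with x h1 h2 hx
  have h1' := (h1 (Ioo_subset_Icc_self hx)).const_add (c (0 : Fin (n + p + 1)))
  have h2' := (h2 (Ioo_subset_Icc_self hx)).const_add ((P *ᵥ c) (0 : Fin (n * 2 + p + 1)))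
  refine (h1'.congr_of_eventuallyEq ?_).unique h2'
  filter_upwards [isOpen_Ioo.mem_nhds hx] with y hy
  exact (hP c y (Ioo_subset_Ico_self hy)).symm

theorem IsProlongation.mass {n p : ℕ} (hn : 0 < n) {P : Matrix (Fin (n * 2 + p)) (Fin (n + p)) ℝ}
    (hP : IsProlongation p n P) : Pᵀ * massMatrix p (n * 2) * P = massMatrix p n := by
  refine Matrix.ext_of_mulVec_single fun j => ?_
  refine dotProduct_eq _ _ fun x => ?_
  rw [dotProduct_comm, dotProduct_comm _ x, dotProduct_conj_mulVec, dotProduct_massMatrix hn,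
    dotProduct_massMatrix (by omega)]
  exact ip_congr_ae
    (Filter.Eventually.of_forall fun y hy => (hP _ y (Ioo_subset_Ico_self hy)).symm)
    (Filter.Eventually.of_forall fun y hy => (hP _ y (Ioo_subset_Ico_self hy)).symm)

theorem IsProlongation.grad {n p : ℕ}
    {P : Matrix (Fin (n * 2 + (p + 1))) (Fin (n + (p + 1))) ℝ}
    (hP : IsProlongation (p + 1) n P) : Pᵀ * gradMatrix p (n * 2) * P = gradMatrix p n := by
  refine Matrix.ext_of_mulVec_single fun j => ?_
  refine dotProduct_eq _ _ fun x => ?_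
  rw [dotProduct_comm, dotProduct_comm _ x, dotProduct_conj_mulVec, dotProduct_gradMatrix,
    dotProduct_gradMatrix]
  refine ip_congr_ae ?_ ?_
  · filter_upwards [hP.ae_deriv x] with y h1 hy using (h1 hy).symm
  · filter_upwards [hP.ae_deriv (Pi.single j 1)] with y h1 hy using (h1 hy).symm

theorem IsProlongation.injective {n p : ℕ} (hn : 0 < n)
    {P : Matrix (Fin (n * 2 + p)) (Fin (n + p)) ℝ} (hP : IsProlongation p n P) :
    Function.Injective P.mulVec := by
  intro c d h
  rw [← sub_eq_zero]
  refine eq_zero_of_pf_eq_zero hn (Filter.Eventually.of_forall fun x hx => ?_)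
  have h0 : P *ᵥ (c - d) = 0 := by rw [Matrix.mulVec_sub]; exact sub_eq_zero.2 h
  rw [hP _ x (Ioo_subset_Ico_self hx), h0]
  simpa using congrFun (pf_smul (n := n * 2) (p := p) 0 0) x

/-- The one-dimensional approximation property. -/
theorem IsProlongation.approximation {n p : ℕ} (hn : 0 < n)
    {P : Matrix (Fin (n * 2 + (p + 1))) (Fin (n + (p + 1))) ℝ}
    (hP : IsProlongation (p + 1) n P) {w : Fin (n * 2 + (p + 1)) → ℝ}
    (hw : (Pᵀ * stiffnessMatrix (p + 1) (n * 2)) *ᵥ w = 0) :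
    (n : ℝ) ^ 2 * (w ⬝ᵥ massMatrix (p + 1) (n * 2) *ᵥ w)
      ≤ 2 * (w ⬝ᵥ stiffnessMatrix (p + 1) (n * 2) *ᵥ w) := by
  have hn2 : 0 < n * 2 := by omega
  have hA := posDef_stiffnessMatrix hn2 p
  rw [dotProduct_massMatrix hn2, dotProduct_stiffnessMatrix hn2]
  refine aubin_nitsche hn p (memL2_pf (n * 2) p (dcoef p (n * 2) w)) rfl fun c _ => ?_
  have h1 := dotProduct_mulVec_of_galerkin hw c
  rw [dotProduct_stiffnessMatrix hn2] at h1
  rw [← h1, ip_comm, ip_comm _ (pf n (p + 1) c)]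
  congr 1
  · exact ip_congr_ae (hP.ae_deriv c) (by simp)
  · exact ip_congr_ae (Filter.Eventually.of_forall fun y hy => hP c y (Ioo_subset_Ico_self hy))
      (by simp)

/-! ### Estimates for Kronecker products -/

section Tensor

/-- The quadratic form of a matrix. -/
abbrev quad {ι : Type*} [Fintype ι] (A : Matrix ι ι ℝ) (x : ι → ℝ) : ℝ := x ⬝ᵥ A *ᵥ x

variable {ι κ : Type*} [Fintype ι] [Fintype κ]

theorem quad_add (A B : Matrix ι ι ℝ) (x : ι → ℝ) : quad (A + B) x = quad A x + quad B x := by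
  rw [quad, Matrix.add_mulVec, dotProduct_add]

theorem quad_smul (c : ℝ) (A : Matrix ι ι ℝ) (x : ι → ℝ) : quad (c • A) x = c * quad A x := by
  rw [quad, Matrix.smul_mulVec, dotProduct_smul, smul_eq_mul]

theorem quad_nonneg {A : Matrix ι ι ℝ} (hA : A.PosSemidef) (x : ι → ℝ) : 0 ≤ quad A x :=
  (posSemidef_iff_real.1 hA).2 x

theorem quad_mulVec (A B : Matrix ι ι ℝ) (x : ι → ℝ) : quad A (B *ᵥ x) = quad (Bᵀ * A * B) x :=
  (dotProduct_conj_mulVec A B x x).symm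

theorem quad_kronecker_mono_left {A B C : Matrix ι ι ℝ} (h : (B - A).PosSemidef)
    (hC : C.PosSemidef) (x : ι × ι → ℝ) : quad (A ⊗ₖ C) x ≤ quad (B ⊗ₖ C) x := by
  have h1 := quad_nonneg (h.kronecker hC) x
  have h2 : B ⊗ₖ C = A ⊗ₖ C + (B - A) ⊗ₖ C := by
    rw [← Matrix.add_kronecker, add_sub_cancel]
  rw [h2, quad_add]
  linarith

theorem quad_kronecker_mono_right {A B C : Matrix ι ι ℝ} (h : (B - A).PosSemidef)
    (hC : C.PosSemidef) (x : ι × ι → ℝ) : quad (C ⊗ₖ A) x ≤ quad (C ⊗ₖ B) x := by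
  have h1 := quad_nonneg (hC.kronecker h) x
  have h2 : C ⊗ₖ B = C ⊗ₖ A + C ⊗ₖ (B - A) := by
    rw [← Matrix.kronecker_add, add_sub_cancel]
  rw [h2, quad_add]
  linarith

theorem quad_add_add_sub_le {A : Matrix ι ι ℝ} (hA : A.PosSemidef) (a b c : ι → ℝ) :
    quad A (a + b - c) ≤ 3 * (quad A a + quad A b + quad A c) := by
  obtain ⟨hs, h⟩ := posSemidef_iff_real.1 hA
  have h1 := h (a - b)
  have h2 := h (a + c)
  have h3 := h (b + c)
  rw [dotProduct_mulVec_add_self hs] at h2 h3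
  rw [dotProduct_mulVec_sub_self hs] at h1
  rw [quad, dotProduct_mulVec_sub_self hs, dotProduct_mulVec_add_self hs, add_dotProduct]
  simp only [quad]
  linarith

theorem posSemidef_sub_of_quad_le {A B : Matrix ι ι ℝ} (hA : Aᵀ = A) (hB : Bᵀ = B)
    (h : ∀ x, quad A x ≤ quad B x) : (B - A).PosSemidef := by
  refine posSemidef_iff_real.2 ⟨by rw [Matrix.transpose_sub, hA, hB], fun x => ?_⟩
  rw [Matrix.sub_mulVec, dotProduct_sub]
  exact sub_nonneg.2 (h x)

variable [DecidableEq ι] [DecidableEq κ]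

/-- Estimate of the Ritz projection error by the image under the operator `M⁻¹ A`. -/
theorem quad_complement_le {A M : Matrix ι ι ℝ} (hA : A.PosDef) (hM : M.PosDef)
    {P : Matrix ι κ ℝ} (hP : Function.Injective P.mulVec) {δ : ℝ} (hδ : 0 ≤ δ)
    (happrox : ∀ w, (Pᵀ * A) *ᵥ w = 0 → quad M w ≤ δ * quad A w) (x : ι → ℝ) :
    quad A ((1 - orthProjector A P) *ᵥ x) ≤ δ * quad (A * M⁻¹ * A) x := by
  have hAs := (posDef_iff_real.1 hA).1
  have hMs := (posDef_iff_real.1 hM).1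
  have hMu := hM.isUnit
  rw [Matrix.isUnit_iff_isUnit_det] at hMu
  set y := (1 - orthProjector A P) *ᵥ x with hy
  have hgal : (Pᵀ * A) *ᵥ y = 0 := by
    rw [hy, Matrix.mulVec_mulVec, orthProjector_galerkin hA hP, Matrix.zero_mulVec]
  have h1 : quad A y = y ⬝ᵥ A *ᵥ x := by
    have h0 := dotProduct_complement_eq_zero hA hP (((Pᵀ * A * P)⁻¹ * Pᵀ * A) *ᵥ x) x
    rw [← orthProjector_mulVec, ← hy, dotProduct_mulVec_symm hAs] at h0
    have h2 : y = x - orthProjector A P *ᵥ x := by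
      rw [hy, Matrix.sub_mulVec, Matrix.one_mulVec]
    have h3 : y ⬝ᵥ A *ᵥ (x - orthProjector A P *ᵥ x) = y ⬝ᵥ A *ᵥ x := by
      rw [Matrix.mulVec_sub, dotProduct_sub, h0, sub_zero]
    rw [← h3, ← h2]
  have h2 : A *ᵥ x = M *ᵥ ((M⁻¹ * A) *ᵥ x) := by
    rw [Matrix.mulVec_mulVec, ← Matrix.mul_assoc, Matrix.mul_nonsing_inv _ hMu, Matrix.one_mul]
  have h3 : quad M ((M⁻¹ * A) *ᵥ x) = quad (A * M⁻¹ * A) x := by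
    rw [quad_mulVec, Matrix.transpose_mul, hAs, Matrix.transpose_nonsing_inv, hMs,
      Matrix.mul_assoc A, Matrix.nonsing_inv_mul _ hMu, Matrix.mul_one, Matrix.mul_assoc]
  have h4 : quad A y ^ 2 ≤ quad M y * quad M ((M⁻¹ * A) *ᵥ x) := by
    rw [h1, h2]
    exact sq_dotProduct_mulVec_le hM.posSemidef y ((M⁻¹ * A) *ᵥ x)
  have h5 := happrox y hgal
  have h6 : 0 ≤ quad (A * M⁻¹ * A) x := h3 ▸ quad_nonneg hM.posSemidef _
  rw [h3] at h4
  rcases (quad_nonneg hA.posSemidef y).eq_or_lt with h7 | h7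
  · rw [← h7]; positivity
  · have : quad A y * quad A y ≤ quad A y * (δ * quad (A * M⁻¹ * A) x) := by
      nlinarith [mul_le_mul_of_nonneg_right h5 h6]
    exact le_of_mul_le_mul_left this h7

/-- The approximation property on the tensor-product grid follows from the one-dimensional one,
by a discrete version of the Aubin-Nitsche argument. -/
theorem tensor_approximation {K M : Matrix ι ι ℝ} (hK : K.PosSemidef) (hM : M.PosDef)
    {P : Matrix ι κ ℝ} (hP : Function.Injective P.mulVec) {δ : ℝ} (hδ : 0 ≤ δ)
    (happrox : ∀ w, (Pᵀ * (K + M)) *ᵥ w = 0 → quad M w ≤ δ * quad (K + M) w)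
    {w : ι × ι → ℝ}
    (hw : ((P ⊗ₖ P)ᵀ * (K ⊗ₖ M + M ⊗ₖ K + M ⊗ₖ M)) *ᵥ w = 0) :
    quad (M ⊗ₖ M) w ≤ 24 * δ * quad (K ⊗ₖ M + M ⊗ₖ K + M ⊗ₖ M) w := by
  set A := K + M with hAdef
  have hA : A.PosDef := Matrix.PosDef.posSemidef_add hK hM
  have hAs := (posDef_iff_real.1 hA).1
  have hKs := (posSemidef_iff_real.1 hK).1
  have hMs := (posDef_iff_real.1 hM).1
  have hMu := hM.isUnit
  rw [Matrix.isUnit_iff_isUnit_det] at hMu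
  have hMM := hM.kronecker hM
  set 𝓐 := K ⊗ₖ M + M ⊗ₖ K + M ⊗ₖ M with h𝓐def
  have h𝓐 : 𝓐.PosDef := Matrix.PosDef.posSemidef_add
    ((hK.kronecker hM.posSemidef).add (hM.posSemidef.kronecker hK)) hMM
  have h𝓐s := (posDef_iff_real.1 h𝓐).1
  have h𝓐u := h𝓐.isUnit
  rw [Matrix.isUnit_iff_isUnit_det] at h𝓐u
  have h𝓐1 : 𝓐 = A ⊗ₖ M + M ⊗ₖ K := by
    rw [h𝓐def, hAdef, Matrix.add_kronecker]; abel
  have h𝓐2 : 𝓐 = M ⊗ₖ A + K ⊗ₖ M := by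
    rw [h𝓐def, hAdef, Matrix.kronecker_add]; abel
  have hinvM : M⁻¹ * M = 1 := Matrix.nonsing_inv_mul _ hMu
  have hMinv : M * M⁻¹ = 1 := Matrix.mul_nonsing_inv _ hMu
  set G := A * M⁻¹ * A with hG
  set H := K * M⁻¹ * K with hH
  have hHp : H.PosSemidef := by
    have := posSemidef_conj (B := K) hM.inv.posSemidef
    rwa [hKs] at this
  have hGA : (G - A).PosSemidef := by
    have : G - A = H + K := by
      have hKM : K * M⁻¹ * M = K := by rw [Matrix.mul_assoc, hinvM, Matrix.mul_one]
      rw [hG, hAdef, Matrix.add_mul, hMinv, Matrix.add_mul, Matrix.mul_add, hKM, Matrix.one_mul]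
      abel
    rw [this]
    exact hHp.add hK
  have hGp : G.PosSemidef := by
    have := hGA.add hA.posSemidef
    rwa [sub_add_cancel] at this
  -- The discrete dual problem with the error `w` as right-hand side.
  obtain ⟨ψ, hψ1⟩ : ∃ ψ, 𝓐 *ᵥ ψ = (M ⊗ₖ M) *ᵥ w :=
    ⟨𝓐⁻¹ *ᵥ ((M ⊗ₖ M) *ᵥ w), by
      rw [Matrix.mulVec_mulVec, Matrix.mul_nonsing_inv _ h𝓐u, Matrix.one_mulVec]⟩
  set N := quad (M ⊗ₖ M) w with hN
  have hMMi : (M⁻¹ ⊗ₖ M⁻¹) * (M ⊗ₖ M) = 1 := by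
    rw [← Matrix.mul_kronecker_mul, hinvM, Matrix.one_kronecker_one]
  have hNψ : N = quad (𝓐 * (M⁻¹ ⊗ₖ M⁻¹) * 𝓐) ψ := by
    have h1 := quad_mulVec (M⁻¹ ⊗ₖ M⁻¹) 𝓐 ψ
    rw [h𝓐s] at h1
    rw [← h1, hψ1, quad_mulVec]
    have h2 : (M ⊗ₖ M)ᵀ = M ⊗ₖ M := (posDef_iff_real.1 hMM).1
    rw [h2, Matrix.mul_assoc, hMMi, Matrix.mul_one]
  -- The substitute for H² regularity: all terms are positive semidefinite, so `N` bounds the pure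
  -- second-order term G ⊗ M and twice the mixed term A ⊗ K at ψ. The second expansion exchanges the
  -- roles of the two variables.
  have hexp1 : 𝓐 * (M⁻¹ ⊗ₖ M⁻¹) * 𝓐 = G ⊗ₖ M + (A ⊗ₖ K + A ⊗ₖ K) + M ⊗ₖ H := by
    rw [h𝓐1]
    simp only [Matrix.add_mul, Matrix.mul_add, ← Matrix.mul_kronecker_mul, hMinv, Matrix.one_mul,
      hG, hH, Matrix.mul_assoc, hinvM, Matrix.mul_one]
    abel
  have hexp2 : 𝓐 * (M⁻¹ ⊗ₖ M⁻¹) * 𝓐 = M ⊗ₖ G + (K ⊗ₖ A + K ⊗ₖ A) + H ⊗ₖ M := by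
    rw [h𝓐2]
    simp only [Matrix.add_mul, Matrix.mul_add, ← Matrix.mul_kronecker_mul, hMinv, Matrix.one_mul,
      hG, hH, Matrix.mul_assoc, hinvM, Matrix.mul_one]
    abel
  have hN1 := hNψ
  rw [hexp1, quad_add, quad_add, quad_add] at hN1
  have hN2 := hNψ
  rw [hexp2, quad_add, quad_add, quad_add] at hN2
  have p1 := quad_nonneg (hGp.kronecker hM.posSemidef) ψ
  have p2 := quad_nonneg (hA.posSemidef.kronecker hK) ψ
  have p3 := quad_nonneg (hM.posSemidef.kronecker hHp) ψ
  have p4 := quad_nonneg (hM.posSemidef.kronecker hGp) ψ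
  have p5 := quad_nonneg (hK.kronecker hA.posSemidef) ψ
  have p6 := quad_nonneg (hHp.kronecker hM.posSemidef) ψ
  have hAA : quad (A ⊗ₖ A) ψ ≤ 3 / 2 * N := by
    have h1 : A ⊗ₖ A = A ⊗ₖ K + A ⊗ₖ M := by rw [← Matrix.kronecker_add]
    have h2 := quad_kronecker_mono_left hGA hM.posSemidef ψ
    rw [h1, quad_add]
    linarith
  set T := orthProjector A P with hT
  set R := 1 - T with hR
  -- T ⊗ T need not be the Ritz projector of 𝓐. It is enough that it maps into the coarse space, to
  -- which `w` is orthogonal. The error splits as 1 - T ⊗ T = R ⊗ 1 + 1 ⊗ R - R ⊗ R.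
  set η := ψ - (T ⊗ₖ T) *ᵥ ψ with hη
  have hηeq : η = (R ⊗ₖ 1) *ᵥ ψ + (1 ⊗ₖ R) *ᵥ ψ - (R ⊗ₖ R) *ᵥ ψ := by
    have hT' : T = 1 - R := by rw [hR]; abel
    have h1 : (1 : Matrix (ι × ι) (ι × ι) ℝ) = (R + T) ⊗ₖ (R + T) := by
      rw [hR, sub_add_cancel, Matrix.one_kronecker_one]
    have h2 : R ⊗ₖ (1 : Matrix ι ι ℝ) = R ⊗ₖ (R + T) := by rw [hR, sub_add_cancel]
    have h3 : (1 : Matrix ι ι ℝ) ⊗ₖ R = (R + T) ⊗ₖ R := by rw [hR, sub_add_cancel]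
    have h4 : (1 : Matrix (ι × ι) (ι × ι) ℝ) - T ⊗ₖ T = R ⊗ₖ 1 + 1 ⊗ₖ R - R ⊗ₖ R := by
      rw [h1, h2, h3]
      simp only [Matrix.add_kronecker, Matrix.kronecker_add]
      abel
    rw [hη, ← Matrix.add_mulVec, ← Matrix.sub_mulVec, ← h4, Matrix.sub_mulVec, Matrix.one_mulVec]
  have h𝓐le : ∀ x, quad 𝓐 x ≤ quad (A ⊗ₖ M) x + quad (M ⊗ₖ A) x := by
    intro x
    have h1 : A ⊗ₖ M + M ⊗ₖ A = 𝓐 + M ⊗ₖ M := by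
      rw [h𝓐1, hAdef, Matrix.kronecker_add]; abel
    rw [← quad_add, h1, quad_add 𝓐 (M ⊗ₖ M) x]
    linarith [quad_nonneg hMM.posSemidef x]
  set RA := Rᵀ * A * R with hRA
  set RM := Rᵀ * M * R with hRM
  have hRAs : RAᵀ = RA := transpose_conj hAs
  have hRMs : RMᵀ = RM := transpose_conj hMs
  have hRAp : RA.PosSemidef := posSemidef_conj hA.posSemidef
  have hRMp : RM.PosSemidef := posSemidef_conj hM.posSemidef
  have hRA_A : (A - RA).PosSemidef := posSemidef_sub_conj_complement hA hP
  have hGs := (posSemidef_iff_real.1 hGp).1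
  -- Two ways to gain a factor δ from one occurrence of R: the energy error is bounded by
  -- second-order data, the L² error by the energy.
  have hRA_G : (δ • G - RA).PosSemidef := by
    refine posSemidef_sub_of_quad_le hRAs (by rw [Matrix.transpose_smul, hGs]) fun x => ?_
    rw [hRA, ← quad_mulVec, quad_smul]
    exact quad_complement_le hA hM hP hδ happrox x
  have hRM_A : (δ • A - RM).PosSemidef := by
    refine posSemidef_sub_of_quad_le hRMs (by rw [Matrix.transpose_smul, hAs]) fun x => ?_
    rw [hRM, ← quad_mulVec, quad_smul]
    refine (happrox _ ?_).trans (mul_le_mul_of_nonneg_left ?_ hδ)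
    · rw [Matrix.mulVec_mulVec, hR, orthProjector_galerkin hA hP, Matrix.zero_mulVec]
    · rw [quad_mulVec]
      have := quad_nonneg hRA_A x
      have h1 : quad A x = quad (A - RA) x + quad RA x := by rw [← quad_add, sub_add_cancel]
      linarith
  have hquad : ∀ X Y S Q : Matrix ι ι ℝ,
      quad (X ⊗ₖ Y) ((S ⊗ₖ Q) *ᵥ ψ) = quad ((Sᵀ * X * S) ⊗ₖ (Qᵀ * Y * Q)) ψ := by
    intro X Y S Q
    rw [quad_mulVec, ← Matrix.kroneckerMap_transpose, ← Matrix.mul_kronecker_mul,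
      ← Matrix.mul_kronecker_mul]
  have e1 : quad (A ⊗ₖ M) ((R ⊗ₖ 1) *ᵥ ψ) ≤ δ * N := by
    rw [hquad, Matrix.transpose_one, Matrix.one_mul, Matrix.mul_one]
    refine (quad_kronecker_mono_left hRA_G hM.posSemidef ψ).trans ?_
    rw [Matrix.smul_kronecker, quad_smul]
    exact mul_le_mul_of_nonneg_left (by linarith) hδ
  have e2 : quad (M ⊗ₖ A) ((R ⊗ₖ 1) *ᵥ ψ) ≤ δ * (3 / 2 * N) := by
    rw [hquad, Matrix.transpose_one, Matrix.one_mul, Matrix.mul_one]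
    refine (quad_kronecker_mono_left hRM_A hA.posSemidef ψ).trans ?_
    rw [Matrix.smul_kronecker, quad_smul]
    exact mul_le_mul_of_nonneg_left hAA hδ
  have e3 : quad (A ⊗ₖ M) ((1 ⊗ₖ R) *ᵥ ψ) ≤ δ * (3 / 2 * N) := by
    rw [hquad, Matrix.transpose_one, Matrix.one_mul, Matrix.mul_one]
    refine (quad_kronecker_mono_right hRM_A hA.posSemidef ψ).trans ?_
    rw [Matrix.kronecker_smul, quad_smul]
    exact mul_le_mul_of_nonneg_left hAA hδ
  have e4 : quad (M ⊗ₖ A) ((1 ⊗ₖ R) *ᵥ ψ) ≤ δ * N := by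
    rw [hquad, Matrix.transpose_one, Matrix.one_mul, Matrix.mul_one]
    refine (quad_kronecker_mono_right hRA_G hM.posSemidef ψ).trans ?_
    rw [Matrix.kronecker_smul, quad_smul]
    exact mul_le_mul_of_nonneg_left (by linarith) hδ
  have e5 : quad (A ⊗ₖ M) ((R ⊗ₖ R) *ᵥ ψ) ≤ δ * (3 / 2 * N) := by
    rw [hquad]
    refine (quad_kronecker_mono_left hRA_A hRMp ψ).trans ?_
    refine (quad_kronecker_mono_right hRM_A hA.posSemidef ψ).trans ?_
    rw [Matrix.kronecker_smul, quad_smul]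
    exact mul_le_mul_of_nonneg_left hAA hδ
  have e6 : quad (M ⊗ₖ A) ((R ⊗ₖ R) *ᵥ ψ) ≤ δ * (3 / 2 * N) := by
    rw [hquad]
    refine (quad_kronecker_mono_right hRA_A hRMp ψ).trans ?_
    refine (quad_kronecker_mono_left hRM_A hA.posSemidef ψ).trans ?_
    rw [Matrix.smul_kronecker, quad_smul]
    exact mul_le_mul_of_nonneg_left hAA hδ
  -- The constant is 3 · (1 + 3/2 + 3/2 + 1 + 3/2 + 3/2): the six bounds above, and 3 for the square
  -- of a sum of three terms.
  have hηle : quad 𝓐 η ≤ 24 * δ * N := by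
    rw [hηeq]
    refine (quad_add_add_sub_le h𝓐.posSemidef _ _ _).trans ?_
    have f1 := h𝓐le ((R ⊗ₖ 1) *ᵥ ψ)
    have f2 := h𝓐le ((1 ⊗ₖ R) *ᵥ ψ)
    have f3 := h𝓐le ((R ⊗ₖ R) *ᵥ ψ)
    linarith
  have hNη : N = w ⬝ᵥ 𝓐 *ᵥ η := by
    have h1 : (T ⊗ₖ T) *ᵥ ψ = (P ⊗ₖ P) *ᵥ
        ((((Pᵀ * A * P)⁻¹ * Pᵀ * A) ⊗ₖ ((Pᵀ * A * P)⁻¹ * Pᵀ * A)) *ᵥ ψ) := by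
      rw [Matrix.mulVec_mulVec, ← Matrix.mul_kronecker_mul, hT, orthProjector]
      simp only [Matrix.mul_assoc]
    have h2 : w ⬝ᵥ 𝓐 *ᵥ ((T ⊗ₖ T) *ᵥ ψ) = 0 := by
      rw [dotProduct_mulVec_symm h𝓐s, h1]
      exact dotProduct_mulVec_of_galerkin hw _
    rw [hη, Matrix.mulVec_sub, dotProduct_sub, h2, sub_zero, hψ1]
  have hcs := sq_dotProduct_mulVec_le h𝓐.posSemidef w η
  rw [← hNη] at hcs
  change N ^ 2 ≤ quad 𝓐 w * quad 𝓐 η at hcs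
  have hw0 := quad_nonneg h𝓐.posSemidef w
  rcases (quad_nonneg hMM.posSemidef w).eq_or_lt with h7 | h7
  · rw [hN, ← h7]; positivity
  · have : N * N ≤ N * (24 * δ * quad 𝓐 w) := by
      nlinarith [mul_le_mul_of_nonneg_left hηle hw0]
    exact le_of_mul_le_mul_left this h7

end Tensor

/-! ### Two-dimensional matrices -/

theorem gradMatrix_apply {n : ℕ} (hn : 0 < n) (p : ℕ) (i j : Fin (n + (p + 1))) :
    gradMatrix p n i j
      = ∫ x in Ioo (0 : ℝ) 1, deriv (bspline (p + 1) n i) x * deriv (bspline (p + 1) n j) x := by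
  rw [gradMatrix, LinearMap.toMatrix₂'_apply, LinearMap.compl₁₂_apply, massForm_apply, ip,
    ← setIntegral_Ioo_eq]
  refine setIntegral_congr_ae measurableSet_Ioo ?_
  filter_upwards [ae_deriv_bspline hn p i, ae_deriv_bspline hn p j] with x h1 h2 hx
  rw [h1 hx, h2 hx]

theorem integrableOn_of_ae_eq_mul {f g k : ℝ → ℝ} (hg : MemL2 g) (hk : MemL2 k)
    (h : ∀ᵐ x, x ∈ Ioo (0 : ℝ) 1 → f x = g x * k x) : IntegrableOn f (Ioo 0 1) := by
  have h1 := hg.mul hk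
  rw [intervalIntegrable_iff_integrableOn_Ioo_of_le zero_le_one] at h1
  exact Integrable.congr h1 ((ae_restrict_iff' measurableSet_Ioo).2 (by
    filter_upwards [h] with x hx h' using (hx h').symm))

theorem integrableOn_bspline_mul {n : ℕ} (hn : 0 < n) (p : ℕ) (i j : Fin (n + p)) :
    IntegrableOn (fun x => bspline p n i x * bspline p n j x) (Ioo 0 1) :=
  integrableOn_of_ae_eq_mul (memL2_pf n p (Pi.single i 1)) (memL2_pf n p (Pi.single j 1))
    (Filter.Eventually.of_forall fun x hx => by
      rw [bspline_eq_pf hn p i (Ioo_subset_Ico_self hx),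
        bspline_eq_pf hn p j (Ioo_subset_Ico_self hx)])

theorem integrableOn_deriv_bspline_mul {n : ℕ} (hn : 0 < n) (p : ℕ) (i j : Fin (n + (p + 1))) :
    IntegrableOn (fun x => deriv (bspline (p + 1) n i) x * deriv (bspline (p + 1) n j) x)
      (Ioo 0 1) := by
  refine integrableOn_of_ae_eq_mul (memL2_pf n p (dcoef p n (Pi.single i 1)))
    (memL2_pf n p (dcoef p n (Pi.single j 1))) ?_
  filter_upwards [ae_deriv_bspline hn p i, ae_deriv_bspline hn p j] with x h1 h2 hx
  rw [h1 hx, h2 hx]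

theorem integrableOn_unitSquare_mul {f g : ℝ → ℝ} (hf : IntegrableOn f (Ioo 0 1))
    (hg : IntegrableOn g (Ioo 0 1)) :
    Integrable (fun z : ℝ × ℝ => f z.1 * g z.2) (volume.restrict unitSquare) := by
  have := Integrable.mul_prod hf hg
  rwa [Measure.prod_restrict] at this

theorem integral_unitSquare_mul (f g : ℝ → ℝ) :
    ∫ z in unitSquare, f z.1 * g z.2 = (∫ x in Ioo (0 : ℝ) 1, f x) * ∫ x in Ioo (0 : ℝ) 1, g x :=
  setIntegral_prod_mul f g _ _

theorem stiffnessMatrix₂_eq {n : ℕ} (hn : 0 < n) (p : ℕ) :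
    stiffnessMatrix₂ (p + 1) n = gradMatrix p n ⊗ₖ massMatrix (p + 1) n
      + massMatrix (p + 1) n ⊗ₖ gradMatrix p n
      + massMatrix (p + 1) n ⊗ₖ massMatrix (p + 1) n := by
  ext ⟨i₁, i₂⟩ ⟨j₁, j₂⟩
  simp only [Matrix.add_apply, Matrix.kroneckerMap_apply, gradMatrix_apply hn, massMatrix,
    Matrix.of_apply, stiffnessMatrix₂, energyForm]
  have hm1 := integrableOn_bspline_mul hn (p + 1) i₁ j₁
  have hm2 := integrableOn_bspline_mul hn (p + 1) i₂ j₂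
  have hd1 := integrableOn_deriv_bspline_mul hn p i₁ j₁
  have hd2 := integrableOn_deriv_bspline_mul hn p i₂ j₂
  rw [← integral_unitSquare_mul, ← integral_unitSquare_mul, ← integral_unitSquare_mul,
    ← integral_add (integrableOn_unitSquare_mul hd1 hm2) (integrableOn_unitSquare_mul hm1 hd2)]
  refine Eq.trans ?_ (integral_add ((integrableOn_unitSquare_mul hd1 hm2).add
      (integrableOn_unitSquare_mul hm1 hd2)) (integrableOn_unitSquare_mul hm1 hm2))
  congr 1
  ext z
  -- Constant factors leave `deriv` even where the B-spline is not differentiable, so this identity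
  -- of integrands holds pointwise without exceptional set.
  simp only [partialX, partialY, tensorBspline, deriv_mul_const_field, deriv_const_mul_field]
  ring

theorem posDef_stiffnessMatrix₂ {n : ℕ} (hn : 0 < n) (p : ℕ) :
    (stiffnessMatrix₂ (p + 1) n).PosDef := by
  have hM := posDef_massMatrix hn (p + 1)
  have hK := posSemidef_gradMatrix n p
  rw [stiffnessMatrix₂_eq hn]
  exact Matrix.PosDef.posSemidef_add
    ((hK.kronecker hM.posSemidef).add (hM.posSemidef.kronecker hK)) (hM.kronecker hM)

/-- The subtracted C ⊗ C cancels exactly the highest-order boundary term of L ⊗ L; the scaling by h²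
then balances the rest. -/
theorem smootherMatrix₂_eq {n : ℕ} (hn : 0 < n) (p : ℕ) :
    smootherMatrix₂ p n = (boundaryCorrection p n ⊗ₖ massMatrix p n
      + massMatrix p n ⊗ₖ boundaryCorrection p n)
      + (n : ℝ) ^ 2 • (massMatrix p n ⊗ₖ massMatrix p n) := by
  have hn' : (n : ℝ) ≠ 0 := by exact_mod_cast hn.ne'
  ext ⟨i₁, i₂⟩ ⟨j₁, j₂⟩
  simp only [smootherMatrix₂, smootherMatrix, Matrix.add_apply, Matrix.sub_apply,
    Matrix.smul_apply, Matrix.kroneckerMap_apply, smul_eq_mul]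
  field_simp
  ring

theorem posDef_smootherMatrix₂ {n : ℕ} (hn : 0 < n) (p : ℕ) :
    (smootherMatrix₂ (p + 1) n).PosDef := by
  have hM := posDef_massMatrix hn (p + 1)
  have hC := posSemidef_boundaryCorrection hn p
  rw [smootherMatrix₂_eq hn]
  refine Matrix.PosDef.posSemidef_add
    ((hC.kronecker hM.posSemidef).add (hM.posSemidef.kronecker hC)) ((hM.kronecker hM).smul ?_)
  positivity

/-- The smoothing property. -/
theorem stiffnessMatrix₂_le {n : ℕ} (hn : 0 < n) (p : ℕ)
    (x : Idx (p + 1) n → ℝ) :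
    quad (stiffnessMatrix₂ (p + 1) n) x ≤ 106 * quad (smootherMatrix₂ (p + 1) n) x := by
  have hM := posDef_massMatrix hn (p + 1)
  have hC := posSemidef_boundaryCorrection hn p
  have hA := posDef_stiffnessMatrix hn p
  have hMs := (posDef_iff_real.1 hM).1
  have hCs := (posSemidef_iff_real.1 hC).1
  set L : Matrix _ _ ℝ := (53 : ℝ) • ((n : ℝ) ^ 2 • massMatrix (p + 1) n
    + boundaryCorrection (p + 1) n) with hL
  have h1 : (L - stiffnessMatrix (p + 1) n).PosSemidef := by
    refine posSemidef_sub_of_quad_le (posDef_iff_real.1 hA).1 ?_ fun y => ?_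
    · rw [hL, Matrix.transpose_smul, Matrix.transpose_add, Matrix.transpose_smul, hMs, hCs]
    · rw [hL, quad_smul, quad_add, quad_smul]
      exact stiffnessMatrix_le hn p y
  have h2 := quad_kronecker_mono_left h1 hM.posSemidef x
  have h3 := quad_kronecker_mono_right h1 hM.posSemidef x
  rw [hL, Matrix.smul_kronecker, Matrix.add_kronecker, Matrix.smul_kronecker, quad_smul, quad_add,
    quad_smul] at h2
  rw [hL, Matrix.kronecker_smul, Matrix.kronecker_add, Matrix.kronecker_smul, quad_smul, quad_add,
    quad_smul] at h3
  rw [stiffnessMatrix_eq hn, Matrix.add_kronecker, quad_add] at h2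
  rw [stiffnessMatrix_eq hn, Matrix.kronecker_add, quad_add] at h3
  rw [stiffnessMatrix₂_eq hn, smootherMatrix₂_eq hn, quad_add, quad_add, quad_add, quad_add,
    quad_smul]
  have h4 := quad_nonneg (hM.kronecker hM).posSemidef x
  have h5 := quad_nonneg (hM.posSemidef.kronecker hC) x
  have h6 := quad_nonneg (hC.kronecker hM.posSemidef) x
  linarith

/-- With C ≤ A the boundary terms are at most A ⊗ M + M ⊗ A = 𝓐 + M ⊗ M ≤ 2 𝓐. What remains is the
L² term that the tensor approximation property controls. -/
theorem smootherMatrix₂_le {n : ℕ} (hn : 0 < n) (p : ℕ) (x : Idx (p + 1) n → ℝ) :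
    quad (smootherMatrix₂ (p + 1) n) x ≤ 2 * quad (stiffnessMatrix₂ (p + 1) n) x
      + (n : ℝ) ^ 2 * quad (massMatrix (p + 1) n ⊗ₖ massMatrix (p + 1) n) x := by
  have hM := posDef_massMatrix hn (p + 1)
  have hK := posSemidef_gradMatrix n p
  have h1 := boundaryCorrection_le hn p
  have h2 := quad_kronecker_mono_left h1 hM.posSemidef x
  have h3 := quad_kronecker_mono_right h1 hM.posSemidef x
  rw [stiffnessMatrix_eq hn, Matrix.add_kronecker, quad_add] at h2
  rw [stiffnessMatrix_eq hn, Matrix.kronecker_add, quad_add] at h3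
  rw [stiffnessMatrix₂_eq hn, smootherMatrix₂_eq hn, quad_add, quad_add, quad_add, quad_add,
    quad_smul]
  have h5 := quad_nonneg (hM.posSemidef.kronecker hK) x
  have h6 := quad_nonneg (hK.kronecker hM.posSemidef) x
  linarith

/-! ### The prolongation -/

theorem IsProlongation.bspline_eq {n p : ℕ} (hn : 0 < n)
    {P : Matrix (Fin (n * 2 + p)) (Fin (n + p)) ℝ} (hP : IsProlongation p n P) (j : Fin (n + p))
    {x : ℝ} (hx : x ∈ Ioo (0 : ℝ) 1) :
    bspline p n j x = ∑ i, P i j * bspline p (n * 2) i x := by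
  have hx' := Ioo_subset_Ico_self hx
  rw [bspline_eq_pf hn p j hx', hP _ x hx', ← sum_bspline_eq_pf (by omega) p _ hx']
  simp

theorem IsProlongation.isEmbeddingMatrix {n p : ℕ} (hn : 0 < n)
    {P : Matrix (Fin (n * 2 + p)) (Fin (n + p)) ℝ} (hP : IsProlongation p n P) :
    IsEmbeddingMatrix p n (n * 2) (P ⊗ₖ P) := by
  rintro ⟨j₁, j₂⟩ z hz
  simp only [tensorBspline, Matrix.kroneckerMap_apply, hP.bspline_eq hn _ hz.1,
    hP.bspline_eq hn _ hz.2, Fintype.sum_prod_type, Finset.sum_mul_sum]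
  refine Finset.sum_congr rfl fun i₁ _ => Finset.sum_congr rfl fun i₂ _ => by ring

theorem eq_zero_of_sum_bspline_eq_zero {n : ℕ} (hn : 0 < n) {p : ℕ} {c : Fin (n + p) → ℝ}
    (h : ∀ x ∈ Ioo (0 : ℝ) 1, ∑ i, c i * bspline p n i x = 0) : c = 0 :=
  eq_zero_of_pf_eq_zero hn (Filter.Eventually.of_forall fun x hx => by
    rw [← sum_bspline_eq_pf hn p c (Ioo_subset_Ico_self hx), h x hx])

/-- The tensor-product B-splines are linearly independent on the unit square. -/
theorem eq_zero_of_sum_tensorBspline_eq_zero {n : ℕ} (hn : 0 < n) {p : ℕ} {c : Idx p n → ℝ}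
    (h : ∀ z ∈ unitSquare, ∑ i, c i * tensorBspline p n i z = 0) : c = 0 := by
  have h1 : ∀ y ∈ Ioo (0 : ℝ) 1, ∀ i₁, ∑ i₂, c (i₁, i₂) * bspline p n i₂ y = 0 := by
    intro y hy i₁
    refine congrFun (eq_zero_of_sum_bspline_eq_zero hn
      (c := fun i₁ => ∑ i₂, c (i₁, i₂) * bspline p n i₂ y) fun x hx => ?_) i₁
    rw [← h (x, y) ⟨hx, hy⟩, Fintype.sum_prod_type]
    refine Finset.sum_congr rfl fun i₁ _ => ?_
    rw [Finset.sum_mul]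
    exact Finset.sum_congr rfl fun i₂ _ => by simp only [tensorBspline]; ring
  ext ⟨i₁, i₂⟩
  exact congrFun (eq_zero_of_sum_bspline_eq_zero hn (c := fun i₂ => c (i₁, i₂))
    fun y hy => h1 y hy i₁) i₂

theorem IsEmbeddingMatrix.unique {p n n' : ℕ} (hn' : 0 < n') {P Q : Matrix (Idx p n') (Idx p n) ℝ}
    (hP : IsEmbeddingMatrix p n n' P) (hQ : IsEmbeddingMatrix p n n' Q) : P = Q := by
  ext i j
  have h1 : (fun i => P i j - Q i j) = 0 := by
    refine eq_zero_of_sum_tensorBspline_eq_zero hn' fun z hz => ?_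
    simp only [sub_mul, Finset.sum_sub_distrib]
    rw [← hP j z hz, ← hQ j z hz, sub_self]
  exact sub_eq_zero.1 (congrFun h1 i)

/-- Everything about two consecutive grids that the convergence analysis uses. -/
theorem prolongation_properties {n n' : ℕ} (hn : 0 < n) (hn' : n' = n * 2) (p : ℕ) :
    IsEmbeddingMatrix (p + 1) n n' (prolongation (p + 1) n n') ∧
    (prolongation (p + 1) n n')ᵀ * stiffnessMatrix₂ (p + 1) n' * prolongation (p + 1) n n'
      = stiffnessMatrix₂ (p + 1) n ∧
    ∀ w, ((prolongation (p + 1) n n')ᵀ * stiffnessMatrix₂ (p + 1) n') *ᵥ w = 0 →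
      quad (smootherMatrix₂ (p + 1) n') w ≤ 194 * quad (stiffnessMatrix₂ (p + 1) n') w := by
  subst hn'
  have hn2 : 0 < n * 2 := by omega
  have hn0 : (0 : ℝ) < n := by exact_mod_cast hn
  obtain ⟨P, hP⟩ := exists_isProlongation hn (p + 1)
  have hemb := hP.isEmbeddingMatrix hn
  have hpro : IsEmbeddingMatrix (p + 1) n (n * 2) (prolongation (p + 1) n (n * 2)) :=
    Classical.epsilon_spec (p := IsEmbeddingMatrix (p + 1) n (n * 2)) ⟨_, hemb⟩
  -- Linear independence identifies the embedding matrix picked by `Classical.epsilon`, making its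
  -- tensor structure available.
  have heq : prolongation (p + 1) n (n * 2) = P ⊗ₖ P := hpro.unique hn2 hemb
  refine ⟨hpro, ?_, fun w hw => ?_⟩
  · rw [heq, stiffnessMatrix₂_eq hn, stiffnessMatrix₂_eq hn2, ← Matrix.kroneckerMap_transpose]
    simp only [Matrix.mul_add, Matrix.add_mul, ← Matrix.mul_kronecker_mul, hP.mass hn, hP.grad]
  · rw [heq, stiffnessMatrix₂_eq hn2] at hw
    have h1 := tensor_approximation (posSemidef_gradMatrix (n * 2) p)
      (posDef_massMatrix hn2 (p + 1)) (hP.injective hn) (δ := 2 / (n : ℝ) ^ 2) (by positivity)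
      (fun v hv => by
        rw [← stiffnessMatrix_eq hn2] at hv ⊢
        have := hP.approximation hn hv
        rw [div_mul_eq_mul_div, le_div_iff₀ (by positivity)]
        linarith) hw
    rw [← stiffnessMatrix₂_eq hn2] at h1
    have h2 := smootherMatrix₂_le hn2 p w
    -- The estimate refers to the coarse grid size, with δ = 2/n², while the smoother carries the
    -- fine one: (2n)² · 24 · 2/n² = 192.
    have h3 : ((n * 2 : ℕ) : ℝ) ^ 2 * quad (massMatrix (p + 1) (n * 2) ⊗ₖ
        massMatrix (p + 1) (n * 2)) w ≤ 192 * quad (stiffnessMatrix₂ (p + 1) (n * 2)) w := by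
      calc _ ≤ ((n * 2 : ℕ) : ℝ) ^ 2 *
            (24 * (2 / (n : ℝ) ^ 2) * quad (stiffnessMatrix₂ (p + 1) (n * 2)) w) := by gcongr
        _ = _ := by push_cast; field_simp; ring
    linarith

/-! ### Abstract convergence analysis -/

section Multigrid

variable {ι κ : Type*} [Fintype ι] [Fintype κ]

theorem matrixNorm_eq (Q : Matrix ι ι ℝ) (v : ι → ℝ) : matrixNorm Q v = Real.sqrt (quad Q v) := by
  rw [matrixNorm, dotProduct_comm]

theorem matrixNorm_nonneg (Q : Matrix ι ι ℝ) (v : ι → ℝ) : 0 ≤ matrixNorm Q v := Real.sqrt_nonneg _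

theorem matrixNorm_sq {Q : Matrix ι ι ℝ} (hQ : Q.PosSemidef) (v : ι → ℝ) :
    matrixNorm Q v ^ 2 = quad Q v := by
  rw [matrixNorm_eq, Real.sq_sqrt (quad_nonneg hQ v)]

theorem matrixNorm_le_mul {Q : Matrix ι ι ℝ} {Q' : Matrix κ κ ℝ} {c : ℝ} (hc : 0 ≤ c)
    {x : ι → ℝ} {y : κ → ℝ} (h : quad Q x ≤ c ^ 2 * quad Q' y) :
    matrixNorm Q x ≤ c * matrixNorm Q' y := by
  rw [matrixNorm_eq, matrixNorm_eq]
  refine (Real.sqrt_le_sqrt h).trans ?_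
  rw [Real.sqrt_mul (sq_nonneg c), Real.sqrt_sq hc]

theorem matrixNorm_le {Q : Matrix ι ι ℝ} {Q' : Matrix κ κ ℝ} {x : ι → ℝ} {y : κ → ℝ}
    (h : quad Q x ≤ quad Q' y) : matrixNorm Q x ≤ matrixNorm Q' y := by
  rw [matrixNorm_eq, matrixNorm_eq]
  exact Real.sqrt_le_sqrt h

theorem matrixNorm_add_le {Q : Matrix ι ι ℝ} (hQ : Q.PosSemidef) (x y : ι → ℝ) :
    matrixNorm Q (x + y) ≤ matrixNorm Q x + matrixNorm Q y := by
  have hx := matrixNorm_nonneg Q x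
  have hy := matrixNorm_nonneg Q y
  have h1 := sq_dotProduct_mulVec_le hQ x y
  have h2 : x ⬝ᵥ Q *ᵥ y ≤ matrixNorm Q x * matrixNorm Q y := by
    refine abs_le_of_sq_le_sq' ?_ (mul_nonneg hx hy) |>.2
    rw [mul_pow, matrixNorm_sq hQ, matrixNorm_sq hQ]
    exact h1
  have h3 : matrixNorm Q (x + y) ^ 2 ≤ (matrixNorm Q x + matrixNorm Q y) ^ 2 := by
    rw [matrixNorm_sq hQ, quad, dotProduct_mulVec_add_self (posSemidef_iff_real.1 hQ).1, add_sq,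
      matrixNorm_sq hQ, matrixNorm_sq hQ]
    simp only [quad]
    linarith
  exact (sq_le_sq₀ (matrixNorm_nonneg Q _) (add_nonneg hx hy)).1 h3

theorem dotProduct_mulVec_of_transpose_mul {S Q : Matrix ι ι ℝ} (h : Sᵀ * Q = Q * S)
    (x y : ι → ℝ) : x ⬝ᵥ Q *ᵥ (S *ᵥ y) = (S *ᵥ x) ⬝ᵥ Q *ᵥ y := by
  rw [Matrix.mulVec_mulVec, ← h, ← Matrix.mulVec_mulVec, dotProduct_mulVec_transpose,
    dotProduct_comm]

theorem mulVec_injective_of_posDef {A : Matrix ι ι ℝ} {P : Matrix ι κ ℝ}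
    (h : (Pᵀ * A * P).PosDef) : Function.Injective P.mulVec := by
  intro x y hxy
  by_contra hne
  have h1 := (posDef_iff_real.1 h).2 (x - y) (sub_ne_zero.2 hne)
  have h2 : P *ᵥ (x - y) = 0 := by rw [Matrix.mulVec_sub]; exact sub_eq_zero.2 hxy
  rw [dotProduct_conj_mulVec, h2, zero_dotProduct] at h1
  exact lt_irrefl _ h1

variable [DecidableEq ι]

/-- The iteration matrix of the smoother. -/
def smoothOp (A L : Matrix ι ι ℝ) (τ : ℝ) : Matrix ι ι ℝ := 1 - τ • (L⁻¹ * A)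

theorem smooth_iterate_error {A L : Matrix ι ι ℝ} {τ : ℝ} {f u v : ι → ℝ} (hu : A *ᵥ u = f)
    (k : ℕ) :
    u - (fun v => v + τ • (L⁻¹ *ᵥ (f - A *ᵥ v)))^[k] v = (smoothOp A L τ ^ k) *ᵥ (u - v) := by
  induction k with
  | zero => simp
  | succ k ih =>
    rw [Function.iterate_succ_apply', pow_succ', ← Matrix.mulVec_mulVec, ← ih]
    set y := (fun v => v + τ • (L⁻¹ *ᵥ (f - A *ᵥ v)))^[k] v
    rw [smoothOp, Matrix.sub_mulVec, Matrix.one_mulVec, Matrix.smul_mulVec, ← Matrix.mulVec_mulVec,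
      Matrix.mulVec_sub A, hu]
    abel

/-- `a` is a decreasing sequence, so that its last term is at most its mean. -/
theorem mul_le_of_antitone_of_sum_le {a : ℕ → ℝ} {C : ℝ} (ha : Antitone a) (m : ℕ)
    (h : ∑ j ∈ Finset.range (m + 1), a j ≤ C) : (m + 1) * a m ≤ C := by
  refine le_trans ?_ h
  have := Finset.card_nsmul_le_sum (Finset.range (m + 1)) a (a m) fun j hj =>
    ha (Nat.lt_succ_iff.1 (Finset.mem_range.1 hj))
  simpa using this

/-! ### Smoothing estimates without diagonalization -/

section Smoother

variable {A L : Matrix ι ι ℝ} {τ : ℝ}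

theorem mulVec_inv_mul_mulVec (hL : L.PosDef) (x : ι → ℝ) :
    L *ᵥ ((L⁻¹ * A) *ᵥ x) = A *ᵥ x := by
  have hu := hL.isUnit
  rw [Matrix.isUnit_iff_isUnit_det] at hu
  rw [Matrix.mulVec_mulVec, ← Matrix.mul_assoc, Matrix.mul_nonsing_inv _ hu, Matrix.one_mul]

theorem mul_smoothOp (hL : L.PosDef) : L * smoothOp A L τ = L - τ • A := by
  have hu := hL.isUnit
  rw [Matrix.isUnit_iff_isUnit_det] at hu
  rw [smoothOp, Matrix.mul_sub, Matrix.mul_one, Matrix.mul_smul, ← Matrix.mul_assoc,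
    Matrix.mul_nonsing_inv _ hu, Matrix.one_mul]

theorem transpose_smoothOp_mul (hA : A.PosDef) (hL : L.PosDef) :
    (smoothOp A L τ)ᵀ * L = L * smoothOp A L τ := by
  have hAs := (posDef_iff_real.1 hA).1
  have hLs := (posDef_iff_real.1 hL).1
  have h1 : (L * smoothOp A L τ)ᵀ = L * smoothOp A L τ := by
    rw [mul_smoothOp hL, Matrix.transpose_sub, Matrix.transpose_smul, hAs, hLs]
  rw [Matrix.transpose_mul, hLs] at h1
  exact h1

theorem transpose_pow_mul_of_transpose_mul {S L : Matrix ι ι ℝ} (h : Sᵀ * L = L * S) (k : ℕ) :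
    (S ^ k)ᵀ * L = L * S ^ k := by
  induction k with
  | zero => simp
  | succ k ih =>
    rw [pow_succ, Matrix.transpose_mul, Matrix.mul_assoc, ih, ← Matrix.mul_assoc, h,
      Matrix.mul_assoc, ← pow_succ', ← pow_succ]

theorem transpose_smoothOp_mul_stiffness (hA : A.PosDef) (hL : L.PosDef) :
    (smoothOp A L τ)ᵀ * A = A * smoothOp A L τ := by
  have hAs := (posDef_iff_real.1 hA).1
  have hLs := (posDef_iff_real.1 hL).1
  simp only [smoothOp, Matrix.transpose_sub, Matrix.transpose_one, Matrix.transpose_smul,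
    Matrix.transpose_mul, Matrix.transpose_nonsing_inv, hAs, hLs, Matrix.sub_mul, Matrix.mul_sub,
    Matrix.one_mul, Matrix.mul_one, Matrix.smul_mul, Matrix.mul_smul, Matrix.mul_assoc]

/-- The iteration matrix S is self-adjoint for `L`, so even powers give squares, and for odd powers
one factor L S = L - τ A ≥ 0 is left in the middle. -/
theorem smoothOp_pow_nonneg (hA : A.PosDef) (hL : L.PosDef)
    (h : ∀ x, τ * quad A x ≤ quad L x) (j : ℕ) (x : ι → ℝ) :
    0 ≤ x ⬝ᵥ L *ᵥ ((smoothOp A L τ ^ j) *ᵥ x) := by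
  have hS := transpose_smoothOp_mul (τ := τ) hA hL
  rcases Nat.even_or_odd' j with ⟨i, rfl | rfl⟩
  · rw [two_mul, pow_add, ← Matrix.mulVec_mulVec,
      dotProduct_mulVec_of_transpose_mul (transpose_pow_mul_of_transpose_mul hS i)]
    exact quad_nonneg hL.posSemidef _
  · rw [two_mul, add_assoc, pow_add, ← Matrix.mulVec_mulVec,
      dotProduct_mulVec_of_transpose_mul (transpose_pow_mul_of_transpose_mul hS i), pow_succ',
      ← Matrix.mulVec_mulVec, Matrix.mulVec_mulVec _ L, mul_smoothOp hL, Matrix.sub_mulVec,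
      dotProduct_sub, Matrix.smul_mulVec, dotProduct_smul, smul_eq_mul]
    exact sub_nonneg.2 (h _)

/-- The dual form τ A L⁻¹ A ≤ A of τ A ≤ L. For z = L⁻¹ A x one has ‖z‖_L² = (A x, z) ≤ ‖x‖_A ‖z‖_A,
and √τ ‖z‖_A ≤ ‖z‖_L cancels one factor. -/
theorem smul_quad_mul_inv_mul_le (hA : A.PosDef) (hL : L.PosDef) (hτ : 0 < τ)
    (h : ∀ x, τ * quad A x ≤ quad L x) (x : ι → ℝ) :
    τ * quad L ((L⁻¹ * A) *ᵥ x) ≤ quad A x := by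
  have hzL := mulVec_inv_mul_mulVec (A := A) hL x
  set z := (L⁻¹ * A) *ᵥ x with hz
  have h1 : quad L z ^ 2 ≤ quad A z * quad A x := by
    have := sq_dotProduct_mulVec_le hA.posSemidef z x
    have e : quad L z = z ⬝ᵥ A *ᵥ x := by rw [quad, hzL]
    rw [e]
    exact this
  have h2 := h z
  have h3 := quad_nonneg hA.posSemidef x
  rcases (quad_nonneg hL.posSemidef z).eq_or_lt with h4 | h4
  · rw [← h4, mul_zero]; exact h3
  · have : quad L z * (τ * quad L z) ≤ quad L z * quad A x := by
      nlinarith [mul_le_mul_of_nonneg_right h2 h3, mul_le_mul_of_nonneg_left h1 hτ.le]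
    exact le_of_mul_le_mul_left this h4

theorem stiffness_smoothOp_pow_nonneg (hA : A.PosDef) (hL : L.PosDef) (hτ : 0 < τ)
    (h : ∀ x, τ * quad A x ≤ quad L x) (j : ℕ) (x : ι → ℝ) :
    0 ≤ x ⬝ᵥ A *ᵥ ((smoothOp A L τ ^ j) *ᵥ x) := by
  have hS := transpose_smoothOp_mul_stiffness (τ := τ) hA hL
  rcases Nat.even_or_odd' j with ⟨i, rfl | rfl⟩
  · rw [two_mul, pow_add, ← Matrix.mulVec_mulVec,
      dotProduct_mulVec_of_transpose_mul (transpose_pow_mul_of_transpose_mul hS i)]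
    exact quad_nonneg hA.posSemidef _
  · rw [two_mul, add_assoc, pow_add, ← Matrix.mulVec_mulVec,
      dotProduct_mulVec_of_transpose_mul (transpose_pow_mul_of_transpose_mul hS i), pow_succ',
      ← Matrix.mulVec_mulVec]
    set y := (smoothOp A L τ ^ i) *ᵥ x
    have h1 : quad L ((L⁻¹ * A) *ᵥ y) = y ⬝ᵥ A *ᵥ ((L⁻¹ * A) *ᵥ y) := by
      rw [quad, mulVec_inv_mul_mulVec hL, dotProduct_mulVec_symm (posDef_iff_real.1 hA).1]
    rw [smoothOp, Matrix.sub_mulVec, Matrix.one_mulVec, Matrix.smul_mulVec, Matrix.mulVec_sub,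
      Matrix.mulVec_smul, dotProduct_sub, dotProduct_smul, smul_eq_mul, ← h1]
    exact sub_nonneg.2 (smul_quad_mul_inv_mul_le hA hL hτ h y)

/-- For x = y, summation over j telescopes, which bounds τ ∑ (A Sʲ x, x) by ‖x‖_L². Being
nonincreasing, the terms are individually small. -/
theorem dotProduct_sub_pow_succ (hL : L.PosDef) (j : ℕ) (x y : ι → ℝ) :
    x ⬝ᵥ L *ᵥ ((smoothOp A L τ ^ j) *ᵥ y) - x ⬝ᵥ L *ᵥ ((smoothOp A L τ ^ (j + 1)) *ᵥ y)
      = τ * (x ⬝ᵥ A *ᵥ ((smoothOp A L τ ^ j) *ᵥ y)) := by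
  rw [pow_succ', ← Matrix.mulVec_mulVec, Matrix.mulVec_mulVec _ L (smoothOp A L τ),
    mul_smoothOp hL, Matrix.sub_mulVec, dotProduct_sub, Matrix.smul_mulVec, dotProduct_smul,
    smul_eq_mul]
  ring

theorem stiffness_sub_pow_succ (hA : A.PosDef) (hL : L.PosDef) (j : ℕ) (x : ι → ℝ) :
    x ⬝ᵥ A *ᵥ ((smoothOp A L τ ^ j) *ᵥ x) - x ⬝ᵥ A *ᵥ ((smoothOp A L τ ^ (j + 1)) *ᵥ x)
      = τ * (((L⁻¹ * A) *ᵥ x) ⬝ᵥ L *ᵥ ((smoothOp A L τ ^ j) *ᵥ ((L⁻¹ * A) *ᵥ x))) := by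
  have h1 : x - smoothOp A L τ *ᵥ x = τ • ((L⁻¹ * A) *ᵥ x) := by
    rw [smoothOp, Matrix.sub_mulVec, Matrix.one_mulVec, Matrix.smul_mulVec, sub_sub_cancel]
  rw [pow_succ, ← Matrix.mulVec_mulVec, ← dotProduct_sub, ← Matrix.mulVec_sub, ← Matrix.mulVec_sub,
    h1, Matrix.mulVec_smul, Matrix.mulVec_smul, dotProduct_smul, smul_eq_mul,
    dotProduct_mulVec_symm (posDef_iff_real.1 hA).1,
    dotProduct_mulVec_symm (posDef_iff_real.1 hL).1,
    mulVec_inv_mul_mulVec hL]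

theorem antitone_stiffness_smoothOp_pow (hA : A.PosDef) (hL : L.PosDef) (hτ : 0 < τ)
    (h : ∀ x, τ * quad A x ≤ quad L x) (x : ι → ℝ) :
    Antitone fun j => x ⬝ᵥ A *ᵥ ((smoothOp A L τ ^ j) *ᵥ x) := by
  refine antitone_nat_of_succ_le fun j => ?_
  rw [← sub_nonneg, stiffness_sub_pow_succ hA hL]
  exact mul_nonneg hτ.le (smoothOp_pow_nonneg hA hL h _ _)

/-- The smoother does not increase the energy norm. -/
theorem quad_smoothOp_pow_le (hA : A.PosDef) (hL : L.PosDef) (hτ : 0 < τ)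
    (h : ∀ x, τ * quad A x ≤ quad L x) (k : ℕ) (x : ι → ℝ) :
    quad A ((smoothOp A L τ ^ k) *ᵥ x) ≤ quad A x := by
  have hS := transpose_pow_mul_of_transpose_mul
    (transpose_smoothOp_mul_stiffness (τ := τ) hA hL) k
  have h1 := antitone_stiffness_smoothOp_pow hA hL hτ h x (Nat.zero_le (k + k))
  simp only [pow_zero, Matrix.one_mulVec, pow_add, ← Matrix.mulVec_mulVec] at h1
  rwa [dotProduct_mulVec_of_transpose_mul hS] at h1

/-- Smoothing estimate in the norm of the smoother. -/
theorem smoothing_estimate (hA : A.PosDef) (hL : L.PosDef) (hτ : 0 < τ)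
    (h : ∀ x, τ * quad A x ≤ quad L x) (m : ℕ) (x : ι → ℝ) :
    (τ * (m + 1)) ^ 2 * quad L ((L⁻¹ * A) *ᵥ ((smoothOp A L τ ^ m) *ᵥ x)) ≤ quad L x := by
  have hAs := (posDef_iff_real.1 hA).1
  have hm : (0 : ℝ) < m + 1 := by positivity
  -- This replaces the spectral bound t (1 - τt)ᵐ ≤ 1 / (τ (m + 1)) on [0, 1/τ]: the last term of a
  -- nonincreasing telescoping sum is at most its mean.
  have hmean : ∀ y, τ * (m + 1) * (y ⬝ᵥ A *ᵥ ((smoothOp A L τ ^ m) *ᵥ y)) ≤ quad L y := by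
    intro y
    have h1 : Antitone fun j => τ * (y ⬝ᵥ A *ᵥ ((smoothOp A L τ ^ j) *ᵥ y)) :=
      (antitone_stiffness_smoothOp_pow hA hL hτ h y).const_mul hτ.le
    have h2 := mul_le_of_antitone_of_sum_le h1 m (C := quad L y) (by
      simp only [← dotProduct_sub_pow_succ hL]
      rw [Finset.sum_range_sub' (fun j => y ⬝ᵥ L *ᵥ ((smoothOp A L τ ^ j) *ᵥ y)), pow_zero,
        Matrix.one_mulVec]
      exact sub_le_self _ (smoothOp_pow_nonneg hA hL h _ _))
    linarith
  -- The form of A Sᵐ is semidefinite, so Cauchy-Schwarz upgrades the quadratic bound above to the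
  -- norm of L⁻¹ A Sᵐ.
  set N := A * smoothOp A L τ ^ m with hN
  have hNeq : ∀ y z, y ⬝ᵥ N *ᵥ z = y ⬝ᵥ A *ᵥ ((smoothOp A L τ ^ m) *ᵥ z) := fun y z => by
    rw [hN, Matrix.mulVec_mulVec]
  have hNp : N.PosSemidef := by
    refine posSemidef_iff_real.2 ⟨?_, fun y => ?_⟩
    · rw [hN, Matrix.transpose_mul, hAs, transpose_pow_mul_of_transpose_mul
        (transpose_smoothOp_mul_stiffness (τ := τ) hA hL)]
    · rw [hNeq]
      exact stiffness_smoothOp_pow_nonneg hA hL hτ h m y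
  set z := (L⁻¹ * A) *ᵥ ((smoothOp A L τ ^ m) *ᵥ x) with hz
  have hzz : quad L z = z ⬝ᵥ N *ᵥ x := by
    rw [hNeq, quad, hz, mulVec_inv_mul_mulVec hL]
  have hcs := sq_dotProduct_mulVec_le hNp z x
  rw [← hzz, hNeq, hNeq] at hcs
  have h1 := hmean z
  have h2 := hmean x
  have h3 := stiffness_smoothOp_pow_nonneg hA hL hτ h m x
  have h4 := stiffness_smoothOp_pow_nonneg hA hL hτ h m z
  have hc : 0 < τ * (m + 1) := mul_pos hτ hm
  set c := τ * (m + 1)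
  rcases (quad_nonneg hL.posSemidef z).eq_or_lt with h5 | h5
  · rw [← h5, mul_zero]; exact quad_nonneg hL.posSemidef x
  · have h6 : (c * (z ⬝ᵥ A *ᵥ ((smoothOp A L τ ^ m) *ᵥ z)))
        * (c * (x ⬝ᵥ A *ᵥ ((smoothOp A L τ ^ m) *ᵥ x))) ≤ quad L z * quad L x :=
      mul_le_mul h1 h2 (mul_nonneg hc.le h3) h5.le
    have h7 : quad L z * (c ^ 2 * quad L z) ≤ quad L z * quad L x := by
      refine le_trans ?_ h6
      have := mul_le_mul_of_nonneg_left hcs (sq_nonneg c)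
      linarith
    exact le_of_mul_le_mul_left h7 h5

theorem commute_inv_mul_smoothOp (k : ℕ) :
    (L⁻¹ * A) * smoothOp A L τ ^ k = smoothOp A L τ ^ k * (L⁻¹ * A) := by
  have h1 : Commute (L⁻¹ * A) (smoothOp A L τ) :=
    (Commute.one_right _).sub_right ((Commute.refl _).smul_right τ)
  exact h1.pow_right k

/-- Smoothing estimate in the energy norm. -/
theorem smoothing_estimate_energy (hA : A.PosDef) (hL : L.PosDef) (hτ : 0 < τ)
    (h : ∀ x, τ * quad A x ≤ quad L x) (k : ℕ) (x : ι → ℝ) :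
    τ * (2 * k + 1) * quad L ((L⁻¹ * A) *ᵥ ((smoothOp A L τ ^ k) *ᵥ x)) ≤ quad A x := by
  set z := (L⁻¹ * A) *ᵥ x with hz
  have h1 : Antitone fun j => τ * (z ⬝ᵥ L *ᵥ ((smoothOp A L τ ^ j) *ᵥ z)) := by
    refine Antitone.const_mul (antitone_nat_of_succ_le fun j => ?_) hτ.le
    rw [← sub_nonneg, dotProduct_sub_pow_succ hL]
    exact mul_nonneg hτ.le (stiffness_smoothOp_pow_nonneg hA hL hτ h _ _)
  have h2 := mul_le_of_antitone_of_sum_le h1 (k + k) (C := quad A x) (by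
    simp only [hz, ← stiffness_sub_pow_succ hA hL]
    rw [Finset.sum_range_sub' (fun j => x ⬝ᵥ A *ᵥ ((smoothOp A L τ ^ j) *ᵥ x)), pow_zero,
      Matrix.one_mulVec]
    exact sub_le_self _ (stiffness_smoothOp_pow_nonneg hA hL hτ h _ _))
  have h3 : quad L ((L⁻¹ * A) *ᵥ ((smoothOp A L τ ^ k) *ᵥ x))
      = z ⬝ᵥ L *ᵥ ((smoothOp A L τ ^ (k + k)) *ᵥ z) := by
    rw [Matrix.mulVec_mulVec, commute_inv_mul_smoothOp, ← Matrix.mulVec_mulVec, ← hz, pow_add,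
      ← Matrix.mulVec_mulVec, dotProduct_mulVec_of_transpose_mul
        (transpose_pow_mul_of_transpose_mul (transpose_smoothOp_mul hA hL) k)]
  rw [h3]
  push_cast at h2
  linarith

end Smoother

/-! ### Coarse-grid correction, two-grid method and W-cycle -/

section CoarseGrid

variable [DecidableEq κ] {A L : Matrix ι ι ℝ} {P : Matrix ι κ ℝ}

/-- The coarse-grid correction, estimated through the approximation property. -/
theorem coarse_correction_estimate (hA : A.PosDef) (hL : L.PosDef)
    (hP : Function.Injective P.mulVec) {c : ℝ}
    (happrox : ∀ w, (Pᵀ * A) *ᵥ w = 0 → quad L w ≤ c * quad A w) (hc : 0 ≤ c) (v : ι → ℝ) :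
    quad A ((1 - orthProjector A P) *ᵥ v) ≤ c * quad L ((L⁻¹ * A) *ᵥ v) ∧
      quad L ((1 - orthProjector A P) *ᵥ v) ≤ c ^ 2 * quad L ((L⁻¹ * A) *ᵥ v) := by
  have hAs := (posDef_iff_real.1 hA).1
  have hzL := mulVec_inv_mul_mulVec (A := A) hL v
  set z := (L⁻¹ * A) *ᵥ v with hz
  set y := (1 - orthProjector A P) *ᵥ v with hy
  have hgal : (Pᵀ * A) *ᵥ y = 0 := by
    rw [hy, Matrix.mulVec_mulVec, orthProjector_galerkin hA hP, Matrix.zero_mulVec]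
  have h0 := dotProduct_complement_eq_zero hA hP (((Pᵀ * A * P)⁻¹ * Pᵀ * A) *ᵥ v) v
  rw [← orthProjector_mulVec, ← hy, dotProduct_mulVec_symm hAs] at h0
  have h1 : quad A y = y ⬝ᵥ L *ᵥ z := by
    have h2 : y = v - orthProjector A P *ᵥ v := by
      rw [hy, Matrix.sub_mulVec, Matrix.one_mulVec]
    have h3 : y ⬝ᵥ A *ᵥ (v - orthProjector A P *ᵥ v) = y ⬝ᵥ A *ᵥ v := by
      rw [Matrix.mulVec_sub, dotProduct_sub, h0, sub_zero]
    rw [hzL, ← h3, ← h2]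
  have h2 : quad A y ^ 2 ≤ quad L y * quad L z := by
    rw [h1]
    exact sq_dotProduct_mulVec_le hL.posSemidef y z
  have h3 := happrox y hgal
  have h4 := quad_nonneg hL.posSemidef z
  have h5 : quad A y ≤ c * quad L z := by
    rcases (quad_nonneg hA.posSemidef y).eq_or_lt with h6 | h6
    · rw [← h6]; positivity
    · have : quad A y * quad A y ≤ quad A y * (c * quad L z) := by
        nlinarith [mul_le_mul_of_nonneg_right h3 h4]
      exact le_of_mul_le_mul_left this h6
  refine ⟨h5, h3.trans ?_⟩
  have := mul_le_mul_of_nonneg_left h5 hc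
  linarith

variable {τ c : ℝ}

/-- Convergence of the two-grid method. -/
theorem two_grid_estimate (hA : A.PosDef) (hL : L.PosDef) (hτ : 0 < τ)
    (h : ∀ x, τ * quad A x ≤ quad L x) (hP : Function.Injective P.mulVec)
    (happrox : ∀ w, (Pᵀ * A) *ᵥ w = 0 → quad L w ≤ c * quad A w) (hc : 0 ≤ c) {ν : ℕ}
    (hν : 0 < ν) (e : ι → ℝ) :
    matrixNorm L ((1 - orthProjector A P) *ᵥ ((smoothOp A L τ ^ ν) *ᵥ e))
      ≤ c / τ / ν * matrixNorm L e := by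
  have hν' : (0 : ℝ) < ν := by exact_mod_cast hν
  refine matrixNorm_le_mul (by positivity) ?_
  have h1 := (coarse_correction_estimate hA hL hP happrox hc ((smoothOp A L τ ^ ν) *ᵥ e)).2
  have h2 := smoothing_estimate hA hL hτ h ν e
  set Q := quad L ((L⁻¹ * A) *ᵥ ((smoothOp A L τ ^ ν) *ᵥ e))
  have hQ : 0 ≤ Q := quad_nonneg hL.posSemidef _
  have h3 : (τ * ν) ^ 2 * Q ≤ quad L e := by
    refine le_trans ?_ h2
    gcongr
    linarith
  refine h1.trans ?_
  have h4 : c ^ 2 * Q = (c / τ / ν) ^ 2 * ((τ * ν) ^ 2 * Q) := by field_simp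
  rw [h4]
  gcongr

/-- The symmetric two-grid method in the energy norm. -/
theorem symmetric_two_grid_estimate (hA : A.PosDef) (hL : L.PosDef) (hτ : 0 < τ)
    (h : ∀ x, τ * quad A x ≤ quad L x) (hP : Function.Injective P.mulVec)
    (happrox : ∀ w, (Pᵀ * A) *ᵥ w = 0 → quad L w ≤ c * quad A w) (hc : 0 ≤ c) {k : ℕ}
    (hk : 0 < k) (e : ι → ℝ) :
    matrixNorm A ((smoothOp A L τ ^ k) *ᵥ
        ((1 - orthProjector A P) *ᵥ ((smoothOp A L τ ^ k) *ᵥ e)))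
      ≤ c / τ / (2 * k) * matrixNorm A e := by
  have hk' : (0 : ℝ) < k := by exact_mod_cast hk
  set γ := c / τ / (2 * k) with hγ
  have hγ0 : 0 ≤ γ := by positivity
  have hS := transpose_pow_mul_of_transpose_mul
    (transpose_smoothOp_mul_stiffness (τ := τ) hA hL) k
  have hbound : ∀ x, quad A ((1 - orthProjector A P) *ᵥ ((smoothOp A L τ ^ k) *ᵥ x))
      ≤ γ * quad A x := by
    intro x
    have h1 := (coarse_correction_estimate hA hL hP happrox hc ((smoothOp A L τ ^ k) *ᵥ x)).1
    have h2 := smoothing_estimate_energy hA hL hτ h k x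
    set Q := quad L ((L⁻¹ * A) *ᵥ ((smoothOp A L τ ^ k) *ᵥ x))
    have hQ : 0 ≤ Q := quad_nonneg hL.posSemidef _
    have h3 : τ * (2 * k) * Q ≤ quad A x := by
      refine le_trans ?_ h2
      gcongr
      linarith
    refine h1.trans ?_
    have h4 : c * Q = γ * (τ * (2 * k) * Q) := by rw [hγ]; field_simp
    rw [h4]
    gcongr
  refine matrixNorm_le_mul hγ0 ?_
  set y := (smoothOp A L τ ^ k) *ᵥ ((1 - orthProjector A P) *ᵥ ((smoothOp A L τ ^ k) *ᵥ e)) with hy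
  set a := (1 - orthProjector A P) *ᵥ ((smoothOp A L τ ^ k) *ᵥ e) with ha
  set b := (1 - orthProjector A P) *ᵥ ((smoothOp A L τ ^ k) *ᵥ y) with hb
  -- With B = (1 - T) Sᵏ, T the Ritz projector, Sᵏ (1 - T) Sᵏ equals B*B for the energy scalar
  -- product, so its norm is the square of that of B: the square root of γ enters twice.
  have h1 : quad A y = b ⬝ᵥ A *ᵥ a := by
    have h2 : quad A y = ((smoothOp A L τ ^ k) *ᵥ y) ⬝ᵥ A *ᵥ a := by
      conv_lhs => rw [quad]; enter [2, 2]; rw [hy]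
      rw [dotProduct_mulVec_of_transpose_mul hS]
    have h3 := dotProduct_complement_eq_zero hA hP
      (((Pᵀ * A * P)⁻¹ * Pᵀ * A) *ᵥ ((smoothOp A L τ ^ k) *ᵥ y)) ((smoothOp A L τ ^ k) *ᵥ e)
    rw [← orthProjector_mulVec, ← ha] at h3
    rw [h2, hb, Matrix.sub_mulVec, Matrix.one_mulVec, sub_dotProduct, h3, sub_zero]
  have h2 : quad A y ^ 2 ≤ quad A b * quad A a := by
    rw [h1]
    exact sq_dotProduct_mulVec_le hA.posSemidef b a
  have h3 := hbound y
  have h4 := hbound e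
  have h5 := quad_nonneg hA.posSemidef a
  have h6 := quad_nonneg hA.posSemidef e
  rcases (quad_nonneg hA.posSemidef y).eq_or_lt with h7 | h7
  · rw [← h7]; positivity
  · have h8 : quad A b * quad A a ≤ (γ * quad A y) * (γ * quad A e) :=
      mul_le_mul h3 h4 h5 (mul_nonneg hγ0 h7.le)
    have : quad A y * quad A y ≤ quad A y * (γ ^ 2 * quad A e) := by nlinarith
    exact le_of_mul_le_mul_left this h7

/-- One step of the recursion for the convergence rate of the W-cycle. -/
theorem w_cycle_estimate (hA : A.PosDef) (hL : L.PosDef) (hτ : 0 < τ)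
    (h : ∀ x, τ * quad A x ≤ quad L x) (hAc : (Pᵀ * A * P).PosDef)
    (happrox : ∀ w, (Pᵀ * A) *ᵥ w = 0 → quad L w ≤ c * quad A w) (hc : 0 ≤ c) {k : ℕ}
    (hk : 0 < k) {q : ℝ} (hq0 : 0 ≤ q) (hq : q ≤ 1 / 2) (hqc : c / τ / (2 * k) ≤ q / 2)
    (e : ι → ℝ) {d : κ → ℝ}
    (hd : matrixNorm (Pᵀ * A * P)
        ((Pᵀ * A * P)⁻¹ *ᵥ ((Pᵀ * A) *ᵥ ((smoothOp A L τ ^ k) *ᵥ e)) - d)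
      ≤ q ^ 2 * matrixNorm (Pᵀ * A * P)
        ((Pᵀ * A * P)⁻¹ *ᵥ ((Pᵀ * A) *ᵥ ((smoothOp A L τ ^ k) *ᵥ e)))) :
    matrixNorm A ((smoothOp A L τ ^ k) *ᵥ ((smoothOp A L τ ^ k) *ᵥ e - P *ᵥ d))
      ≤ q * matrixNorm A e := by
  have hP := mulVec_injective_of_posDef hAc
  set S := smoothOp A L τ ^ k with hS
  set e₁ := S *ᵥ e with he₁
  set d' := (Pᵀ * A * P)⁻¹ *ᵥ ((Pᵀ * A) *ᵥ e₁) with hd'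
  have hPd : P *ᵥ d' = orthProjector A P *ᵥ e₁ := by
    rw [hd', orthProjector_mulVec, Matrix.mulVec_mulVec _ _ (Pᵀ * A)]
    simp only [Matrix.mul_assoc]
  have hsplit : e₁ - P *ᵥ d = (1 - orthProjector A P) *ᵥ e₁ + P *ᵥ (d' - d) := by
    rw [Matrix.sub_mulVec, Matrix.one_mulVec, Matrix.mulVec_sub, hPd]
    abel
  have hPnorm : ∀ x, matrixNorm (Pᵀ * A * P) x = matrixNorm A (P *ᵥ x) := fun x => by
    rw [matrixNorm_eq, matrixNorm_eq, quad, quad, dotProduct_conj_mulVec]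
  have hSA : ∀ x, matrixNorm A (S *ᵥ x) ≤ matrixNorm A x := fun x =>
    matrixNorm_le (quad_smoothOp_pow_le hA hL hτ h k x)
  have h1 : matrixNorm A (P *ᵥ (d' - d)) ≤ q ^ 2 * matrixNorm A e := by
    rw [← hPnorm]
    refine hd.trans (mul_le_mul_of_nonneg_left ?_ (sq_nonneg q))
    rw [hPnorm, hPd]
    refine le_trans (matrixNorm_le ?_) (hSA e)
    rw [← he₁]
    have := orthProjector_pythagoras hA hP e₁
    have h2 := quad_nonneg hA.posSemidef ((1 - orthProjector A P) *ᵥ e₁)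
    simp only [quad] at h2 ⊢
    linarith
  have h2 := symmetric_two_grid_estimate hA hL hτ h hP happrox hc hk e
  have he0 := matrixNorm_nonneg A e
  calc matrixNorm A (S *ᵥ (e₁ - P *ᵥ d))
      = matrixNorm A (S *ᵥ ((1 - orthProjector A P) *ᵥ e₁) + S *ᵥ (P *ᵥ (d' - d))) := by
        rw [hsplit, Matrix.mulVec_add]
    _ ≤ matrixNorm A (S *ᵥ ((1 - orthProjector A P) *ᵥ e₁))
        + matrixNorm A (S *ᵥ (P *ᵥ (d' - d))) := matrixNorm_add_le hA.posSemidef _ _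
    _ ≤ c / τ / (2 * k) * matrixNorm A e + q ^ 2 * matrixNorm A e :=
        add_le_add h2 ((hSA _).trans h1)
    -- The two-grid part takes half of the rate by assumption, and q ≤ 1/2 gives q² ≤ q/2 for the
    -- inexact coarse solve.
    _ ≤ q / 2 * matrixNorm A e + q / 2 * matrixNorm A e := by
        gcongr
        nlinarith
    _ = q * matrixNorm A e := by ring

end CoarseGrid

end Multigrid

/-! ### Convergence of the spline multigrid method -/

section Level

variable {p n₀ : ℕ}

theorem gridCount_pos (hn₀ : 0 < n₀) (ℓ : ℕ) : 0 < gridCount n₀ ℓ := by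
  unfold gridCount
  positivity

theorem gridCount_succ (n₀ ℓ : ℕ) : gridCount n₀ (ℓ + 1) = gridCount n₀ ℓ * 2 := by
  rw [gridCount, gridCount, pow_succ, mul_assoc]

theorem posDef_levelA (hp : 1 ≤ p) (hn₀ : 0 < n₀) (ℓ : ℕ) : (levelA p n₀ ℓ).PosDef := by
  obtain ⟨p, rfl⟩ := Nat.exists_eq_add_of_le' hp
  exact posDef_stiffnessMatrix₂ (gridCount_pos hn₀ ℓ) p

theorem posDef_levelL (hp : 1 ≤ p) (hn₀ : 0 < n₀) (ℓ : ℕ) : (levelL p n₀ ℓ).PosDef := by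
  obtain ⟨p, rfl⟩ := Nat.exists_eq_add_of_le' hp
  exact posDef_smootherMatrix₂ (gridCount_pos hn₀ ℓ) p

theorem levelA_le (hp : 1 ≤ p) (hn₀ : 0 < n₀) (ℓ : ℕ) (x : Vec p n₀ ℓ) :
    1 / 106 * quad (levelA p n₀ ℓ) x ≤ quad (levelL p n₀ ℓ) x := by
  obtain ⟨p, rfl⟩ := Nat.exists_eq_add_of_le' hp
  have h := stiffnessMatrix₂_le (gridCount_pos hn₀ ℓ) p x
  simp only [levelA, levelL, quad] at h ⊢
  linarith

theorem isEmbeddingMatrix_levelP (hp : 1 ≤ p) (hn₀ : 0 < n₀) (ℓ : ℕ) :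
    IsEmbeddingMatrix p (gridCount n₀ ℓ) (gridCount n₀ (ℓ + 1)) (levelP p n₀ ℓ) := by
  obtain ⟨p, rfl⟩ := Nat.exists_eq_add_of_le' hp
  exact (prolongation_properties (gridCount_pos hn₀ ℓ) (gridCount_succ n₀ ℓ) p).1

theorem transpose_levelP_mul (hp : 1 ≤ p) (hn₀ : 0 < n₀) (ℓ : ℕ) :
    (levelP p n₀ ℓ)ᵀ * levelA p n₀ (ℓ + 1) * levelP p n₀ ℓ = levelA p n₀ ℓ := by
  obtain ⟨p, rfl⟩ := Nat.exists_eq_add_of_le' hp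
  exact (prolongation_properties (gridCount_pos hn₀ ℓ) (gridCount_succ n₀ ℓ) p).2.1

theorem level_approximation (hp : 1 ≤ p) (hn₀ : 0 < n₀) (ℓ : ℕ) (w : Vec p n₀ (ℓ + 1))
    (hw : ((levelP p n₀ ℓ)ᵀ * levelA p n₀ (ℓ + 1)) *ᵥ w = 0) :
    quad (levelL p n₀ (ℓ + 1)) w ≤ 194 * quad (levelA p n₀ (ℓ + 1)) w := by
  obtain ⟨p, rfl⟩ := Nat.exists_eq_add_of_le' hp
  exact (prolongation_properties (gridCount_pos hn₀ ℓ) (gridCount_succ n₀ ℓ) p).2.2 w hw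

theorem sub_smooth {τ : ℝ} {ℓ : ℕ} {f uStar : Vec p n₀ ℓ} (hu : levelA p n₀ ℓ *ᵥ uStar = f)
    (k : ℕ) (v : Vec p n₀ ℓ) :
    uStar - smooth p n₀ τ ℓ k f v
      = (smoothOp (levelA p n₀ ℓ) (levelL p n₀ ℓ) τ ^ k) *ᵥ (uStar - v) :=
  smooth_iterate_error hu k

theorem restrictedDefect_eq {ℓ : ℕ} {f uStar : Vec p n₀ (ℓ + 1)}
    (hu : levelA p n₀ (ℓ + 1) *ᵥ uStar = f) (v : Vec p n₀ (ℓ + 1)) :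
    restrictedDefect p n₀ ℓ f v
      = ((levelP p n₀ ℓ)ᵀ * levelA p n₀ (ℓ + 1)) *ᵥ (uStar - v) := by
  rw [restrictedDefect, ← hu, ← Matrix.mulVec_sub, Matrix.mulVec_mulVec]

theorem convergesWithRate_twoGridStep (hp : 1 ≤ p) (hn₀ : 0 < n₀) (ℓ : ℕ) {ν : ℕ}
    (hν : (20564 : ℝ) < ν) :
    ConvergesWithRate (levelA p n₀ (ℓ + 1)) (levelL p n₀ (ℓ + 1))
      (twoGridStep p n₀ (1 / 106) ν ℓ) (20564 / ν) := by
  have hν0 : (0 : ℝ) < ν := by linarith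
  refine ⟨(div_lt_one hν0).2 hν, fun f uStar u hu => ?_⟩
  have hA := posDef_levelA hp hn₀ (ℓ + 1)
  have hP := mulVec_injective_of_posDef
    ((transpose_levelP_mul hp hn₀ ℓ).symm ▸ posDef_levelA hp hn₀ ℓ)
  have h := two_grid_estimate hA (posDef_levelL hp hn₀ (ℓ + 1)) (by norm_num)
    (levelA_le hp hn₀ (ℓ + 1)) hP (level_approximation hp hn₀ ℓ) (by norm_num)
    (by exact_mod_cast hν0 : 0 < ν) (uStar - u)
  have herr : uStar - twoGridStep p n₀ (1 / 106) ν ℓ f u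
      = (1 - orthProjector (levelA p n₀ (ℓ + 1)) (levelP p n₀ ℓ)) *ᵥ
        ((smoothOp (levelA p n₀ (ℓ + 1)) (levelL p n₀ (ℓ + 1)) (1 / 106) ^ ν) *ᵥ (uStar - u)) := by
    rw [← sub_smooth hu, twoGridStep]
    rw [restrictedDefect_eq hu, Matrix.sub_mulVec, Matrix.one_mulVec, orthProjector_mulVec,
      transpose_levelP_mul hp hn₀, ← sub_sub]
    simp only [Matrix.mulVec_mulVec, Matrix.mul_assoc]
  rw [herr]
  refine h.trans_eq ?_
  norm_num

theorem convergesWithRate_wCycleStep (hp : 1 ≤ p) (hn₀ : 0 < n₀) {k : ℕ}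
    (hk : (41128 : ℝ) < k) (ℓ : ℕ) :
    ConvergesWithRate (levelA p n₀ ℓ) (levelA p n₀ ℓ) (wCycleStep p n₀ (1 / 106) k ℓ)
      (20564 / k) := by
  have hk0 : (0 : ℝ) < k := by linarith
  have hq : (20564 : ℝ) / k ≤ 1 / 2 := by
    rw [div_le_div_iff₀ hk0 two_pos]
    linarith
  have hq0 : (0 : ℝ) ≤ 20564 / k := by positivity
  induction ℓ with
  | zero =>
    refine ⟨by linarith, fun f uStar u hu => ?_⟩
    have hdet := (Matrix.isUnit_iff_isUnit_det _).1 (posDef_levelA hp hn₀ 0).isUnit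
    rw [wCycleStep, ← hu, Matrix.mulVec_mulVec, Matrix.nonsing_inv_mul _ hdet, Matrix.one_mulVec,
      sub_self, matrixNorm_eq, quad, zero_dotProduct, Real.sqrt_zero]
    exact mul_nonneg hq0 (matrixNorm_nonneg _ _)
  | succ ℓ ih =>
    refine ⟨by linarith, fun f uStar u hu => ?_⟩
    have hAc := posDef_levelA hp hn₀ ℓ
    have hPAP := transpose_levelP_mul hp hn₀ ℓ
    have hdet := (Matrix.isUnit_iff_isUnit_det _).1 hAc.isUnit
    rw [wCycleStep]
    set v := smooth p n₀ (1 / 106) (ℓ + 1) k f u with hv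
    set r := restrictedDefect p n₀ ℓ f v with hr
    set c₁ := wCycleStep p n₀ (1 / 106) k ℓ r 0 with hc₁
    set c₂ := wCycleStep p n₀ (1 / 106) k ℓ r c₁ with hc₂
    have hsol : levelA p n₀ ℓ *ᵥ ((levelA p n₀ ℓ)⁻¹ *ᵥ r) = r := by
      rw [Matrix.mulVec_mulVec, Matrix.mul_nonsing_inv _ hdet, Matrix.one_mulVec]
    -- Two coarse cycles started from 0, with exact solution A⁻¹ r, leave the fraction q² of its
    -- norm.
    have h1 := ih.2 r _ 0 hsol
    have h2 := ih.2 r _ c₁ hsol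
    rw [← hc₁, sub_zero] at h1
    rw [← hc₂] at h2
    have hd : matrixNorm (levelA p n₀ ℓ) ((levelA p n₀ ℓ)⁻¹ *ᵥ r - c₂)
        ≤ (20564 / k) ^ 2 * matrixNorm (levelA p n₀ ℓ) ((levelA p n₀ ℓ)⁻¹ *ᵥ r) := by
      refine h2.trans ((mul_le_mul_of_nonneg_left h1 hq0).trans_eq ?_)
      ring
    rw [hr, restrictedDefect_eq hu, hv, sub_smooth hu, ← hPAP] at hd
    have h := w_cycle_estimate (posDef_levelA hp hn₀ (ℓ + 1)) (posDef_levelL hp hn₀ (ℓ + 1))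
      (by norm_num) (levelA_le hp hn₀ (ℓ + 1)) (hPAP.symm ▸ hAc) (level_approximation hp hn₀ ℓ)
      (by norm_num) (by exact_mod_cast hk0 : 0 < k) hq0 hq
      (le_of_eq (by field_simp; norm_num)) (uStar - u) hd
    rw [sub_smooth hu, ← sub_sub, hv, sub_smooth hu]
    exact h

end Level

end SplineMultigrid

end

/-! ### The main theorem, with explicit constants -/

theorem theorem5p4 :
    ∃ τ ν₀ : ℝ, 0 < τ ∧ 0 < ν₀ ∧ ∀ p n₀ : ℕ, 1 ≤ p → p < n₀ →
      -- all matrices that the methods invert are symmetric positive definite,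
      -- and the prolongations are the canonical embeddings
      (∀ ℓ : ℕ, (SplineMultigrid.levelA p n₀ ℓ).PosDef ∧ (SplineMultigrid.levelL p n₀ ℓ).PosDef ∧
        SplineMultigrid.IsEmbeddingMatrix p (SplineMultigrid.gridCount n₀ ℓ)
          (SplineMultigrid.gridCount n₀ (ℓ + 1)) (SplineMultigrid.levelP p n₀ ℓ)) ∧
      -- the two-grid method with `ν` smoothing steps, between the levels `ℓ + 1` and `ℓ`
      (∀ ℓ ν : ℕ, ν₀ < (ν : ℝ) →
        SplineMultigrid.ConvergesWithRate
          (SplineMultigrid.levelA p n₀ (ℓ + 1)) (SplineMultigrid.levelL p n₀ (ℓ + 1))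
          (SplineMultigrid.twoGridStep p n₀ τ ν ℓ) (ν₀ / (ν : ℝ))) ∧
      -- the W-cycle with `ν / 2` pre-smoothing and `ν / 2` post-smoothing steps
      (∀ ℓ ν : ℕ, Even ν → 4 * ν₀ < (ν : ℝ) →
        SplineMultigrid.ConvergesWithRate
          (SplineMultigrid.levelA p n₀ ℓ) (SplineMultigrid.levelA p n₀ ℓ)
          (SplineMultigrid.wCycleStep p n₀ τ (ν / 2) ℓ) (2 * ν₀ / (ν : ℝ))) := by
  -- 1/106 is the reciprocal of the smoothing constant, and 20564 = 194 · 106 is the approximation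
  -- constant divided by τ. For ν = 2k the condition ν > 4ν₀ says that the W-cycle rate ν₀/k is
  -- below 1/2.
  refine ⟨1 / 106, 20564, by norm_num, by norm_num, fun p n₀ hp hpn => ?_⟩
  have hn₀ : 0 < n₀ := by omega
  refine ⟨fun ℓ => ⟨SplineMultigrid.posDef_levelA hp hn₀ ℓ, SplineMultigrid.posDef_levelL hp hn₀ ℓ,
    SplineMultigrid.isEmbeddingMatrix_levelP hp hn₀ ℓ⟩,
    fun ℓ ν hν => SplineMultigrid.convergesWithRate_twoGridStep hp hn₀ ℓ hν, ?_⟩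
  rintro ℓ ν ⟨k, rfl⟩ hν
  push_cast at hν
  have hk : (k + k) / 2 = k := by omega
  have hrate : 2 * 20564 / (((k + k : ℕ)) : ℝ) = 20564 / k := by
    push_cast
    rw [← two_mul, mul_div_mul_left _ _ two_ne_zero]
  rw [hk, hrate]
  exact SplineMultigrid.convergesWithRate_wCycleStep hp hn₀ (by linarith) ℓ
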